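/- **Setting.** Let $Z,U$ be Banach spaces, $0<\eta<1$, $m\ge 1$, $0=p_0<t_1<p_1<t_2<\dots<p_m<t_{m+1}=p_{m+1}=a$. Let $A$ be densely defined and generate a $C_0$-semigroup $T(t)$ on $Z$ with $M=\sup_{t\ge 0}\|T(t)\|<\infty$; let $B:L^q([0,a];U)\to L^q([0,a];Z)$ be linear and such that, for each $r=0,\dots,m$, the restriction of $Bu$ to $[p_r,t_{r+1}]$ depends only on the restriction of $u$ to $[p_r,t_{r+1}]$; let $h:[0,a]\times Z\to Z$ (measurable in $t$), $\psi_r:[t_r,p_r]\times Z\to Z$ ($1\le r\le m$) and $z_0\in Z$. Consider the system $$ {}_0D_t^{\eta}z(t)=Az(t)+Bu(t)+h(t,z(t)),\ t\in\bigcup_{r=0}^m(p_r,t_{r+1}];\qquad z(t)=\psi_r(t,z(t_r^-)),\ t\in(t_r,p_r],\ 1\le r\le m; $$ $$ {}_{p_r}I_t^{1-\eta}z(t)|_{t=p_r}=\psi_r(p_r,z(t_r^-)),\ 1\le r\le m;\qquad {}_0I_t^{1-\eta}z(t)|_{t=0}=z_0 . \tag{1}$$ Put $T_\eta(t)=\eta\int_0^\infty\theta\,\xi_\eta(\theta)T(t^\eta\theta)\,d\theta$,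 where $\xi_\eta(\theta)=\frac1\eta\theta^{-1-1/\eta}\varpi_\eta(\theta^{-1/\eta})$ and $\varpi_\eta(\theta)=\frac1\pi\sum_{n\ge1}(-1)^{n-1}\theta^{-n\eta-1}\frac{\Gamma(n\eta+1)}{n!}\sin(n\pi\eta)$. $PC_{1-\eta}([0,a];Z)$ is the set of functions $z$ that are continuous on the open intervals $(p_r,t_{r+1})$ and $(t_r,p_r)$, left-continuous at $t_r$ and $p_r$ ($1\le r\le m$), and such that $(t-p_r)^{1-\eta}\|z(t)\|$ is bounded on $(p_r,p_{r+1}]$ for $0\le r\le m$. A *mild solution* of (1) for $u\in L^q([0,a];U)$ is a $z\in PC_{1-\eta}([0,a];Z)$ such that $z(t)=\psi_r(t,z(t_r^-))$ on $(t_r,p_r]$ for $1\le r\le m$, and for $t\in(p_r,t_{r+1}]$, $0\le r\le m$, $$z(t)=(t-p_r)^{\eta-1}T_\eta(t-p_r)\psi_r(p_r,z(t_r^-))+\int_{p_r}^t(t-s)^{\eta-1}T_\eta(t-s)\big[Bu(s)+h(s,z(s))+\phi_r(s,z)\big]ds,$$ where for $r=0$ the term $\psi_r(p_r,z(t_r^-))$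 is read as $z_0$, $\phi_0=0$, and for $r\ge1$ $$\phi_r(s,z)=\frac{\eta}{\Gamma(1-\eta)}\sum_{k=0}^{r-1}\Big(\int_{p_k}^{t_{k+1}}\frac{z(\sigma)\,d\sigma}{(s-\sigma)^{1+\eta}}+\int_{t_{k+1}}^{p_{k+1}}\frac{\psi_{k+1}(\sigma,z(t_{k+1}^-))\,d\sigma}{(s-\sigma)^{1+\eta}}\Big).$$ The reachable set $K_a$ is the set of all $z(a)$, where $z$ is a mild solution for some $u\in L^q([0,a];U)$. Write $\tau=\max_{0\le r\le m}(t_{r+1}-p_r)$, $E_\eta(w)=\sum_{i\ge0}\frac{w^i}{\Gamma(\eta i+1)}$, $\mathbb F_r f=\int_{p_r}^{t_{r+1}}(t_{r+1}-s)^{\eta-1}T_\eta(t_{r+1}-s)f(s)\,ds$, $\varrho=\frac{M}{\Gamma(\eta)}\big(\frac{q-1}{q\eta-1}\big)^{\frac{q-1}{q}}\tau^{1-\frac1q}$, and, for given $b_1,\dots,b_m$, $\mu=\max_{1\le r\le m}\mu_r$ with $$\mu_r=\tfrac{Mb_r}{\Gamma(\eta)(t_r-p_{r-1})^{1-\eta}}+\tfrac{M}{\Gamma(1+\eta)\Gamma(1-\eta)}\Big(\sum_{k=0}^{r-1}\big(\tfrac{t_{k+1}-p_k}{p_r-t_{k+1}}\big)^\eta+\sum_{k=0}^{r-2}\tfrac{b_{k+1}(t_{r+1}-p_r)}{(t_{k+1}-p_k)^{1-\eta}(p_r-p_{k+1})^\eta}\Big)+\tfrac{Mb_r(t_{r+1}-p_r)^{1-\eta}}{(t_r-p_{r-1})^{1-\eta}}.$$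 **Theorem.** Assume: - (H0) $q\in(\frac1\eta,\frac1{1-\eta})$. - (H1) For some $\kappa>0$: $\|h(t,z)-h(t,y)\|\le\kappa\|z-y\|$ for all $t\in[0,a]$, $z,y\in Z$. - (H2) For some $\varsigma\in L^q([0,a];\mathbb R^+)$ and $d>0$: $\|h(t,z)\|\le\varsigma(t)+d(t-p_r)^{1-\eta}\|z\|$ for a.e. $t\in(p_r,p_{r+1}]$, $0\le r\le m$, and all $z\in Z$. - (H3) Each $\psi_r$ is continuous and for some $b_r\in(0,1]$: $\|\psi_r(t,z)-\psi_r(t,y)\|\le b_r\|z-y\|$. - (H4) $\nu:=\max_{1\le r\le m}\big(\mu_r+\frac{M\kappa\Gamma(\eta)}{\Gamma(2\eta)}(t_{r+1}-p_r)^\eta\big)<1$. - (H5) For some $\tilde\kappa>0$: $\|h(t,z)-h(t,y)\|\le\tilde\kappa(t-p_r)^{1-\eta}\|z-y\|$ for $t\in(p_r,p_{r+1}]$, $0\le r\le m$, $z,y\in Z$. - (H6) For some $c_r\in(0,1]$: $\|\psi_r(t,z)\|\le c_r\|z\|$ for $t\in[t_r,p_r]$, $z\in Z$, $1\le r\le m$.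 - (H7) $\mu E_\eta(M\tilde\kappa\tau)<1$. - (H8) There is a constant $\aleph>0$ such that for $0\le r\le m$, every $\epsilon>0$ and every $\vartheta\in L^q([p_r,t_{r+1}];Z)$ there is $u\in L^q([0,a];U)$ with $\|\mathbb F_r\vartheta-\mathbb F_rBu\|<\epsilon$ and $\|Bu\|_{L^q([p_r,t_{r+1}];Z)}\le\aleph\|\vartheta\|_{L^q([p_r,t_{r+1}];Z)}$; and for each $r=1,\dots,m$ $$\aleph\Big[\tilde\kappa(t_{r+1}-p_r)^{\frac1q}+\frac1{\Gamma(1-\eta)}\sum_{k=0}^{r-1}\frac{(t_{k+1}-p_k)^\eta(t_{r+1}-p_r)^{\frac1q}}{(p_r-t_{k+1})^{1+\eta}}\Big]\frac{\varrho E_\eta(M\tilde\kappa\tau)}{1-\mu E_\eta(M\tilde\kappa\tau)}<1 .$$ Assume moreover that either $T(t)$ is a differentiable semigroup (that is, $t\mapsto T(t)x$ is differentiable on $(0,\infty)$ for all $x\in Z$), or $z_0\in D(A)$ and $\psi_r(p_r,z(t_r))\in D(A)$ for all mild solutions $z$ and $1\le r\le m$. Then $K_a$ is dense in $Z$, i.e.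 system (1) is approximately controllable on $[0,a]$. -/

import Mathlib

open Set Filter Topology MeasureTheory

noncomputable section

namespace RLImpulsive

/-- One-parameter family `T(t)`, `t ≥ 0`, forming a `C₀`-semigroup (values at `t < 0` play no role). -/
structure IsC0Semigroup {Z : Type*} [NormedAddCommGroup Z] [NormedSpace ℝ Z]
    (T : ℝ → Z →L[ℝ] Z) : Prop where
  zero : T 0 = ContinuousLinearMap.id ℝ Z
  add : ∀ s t : ℝ, 0 ≤ s → 0 ≤ t → T (s + t) = (T s).comp (T t)
  tendsto_zero : ∀ x : Z, Tendsto (fun t : ℝ => T t x) (𝓝[>] 0) (𝓝 x)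

/-- `A` (with its domain) is the infinitesimal generator of `T`: `x ∈ D(A)` with `A x = y`
iff `(T(t) x - x) / t → y` as `t → 0+`. -/
def IsGenerator {Z : Type*} [NormedAddCommGroup Z] [NormedSpace ℝ Z]
    (A : Z →ₗ.[ℝ] Z) (T : ℝ → Z →L[ℝ] Z) : Prop :=
  ∀ x y : Z, (x, y) ∈ A.graph ↔
    Tendsto (fun t : ℝ => t⁻¹ • (T t x - x)) (𝓝[>] 0) (𝓝 y)

/-- The semigroup is differentiable: every orbit is differentiable on `(0, ∞)`. -/
def IsDifferentiableSemigroup {Z : Type*} [NormedAddCommGroup Z] [NormedSpace ℝ Z]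
    (T : ℝ → Z →L[ℝ] Z) : Prop :=
  ∀ x : Z, ∀ t : ℝ, 0 < t → DifferentiableAt ℝ (fun s : ℝ => T s x) t

/-- The one-parameter Mittag-Leffler function (at real arguments). -/
def mittagLeffler (η w : ℝ) : ℝ :=
  ∑' i : ℕ, w ^ i / Real.Gamma (η * i + 1)

/-- The function `ϖ_η` (the one-sided stable density), as a series in `n = k + 1 ≥ 1`. -/
def stableDensity (η θ : ℝ) : ℝ :=
  (1 / Real.pi) * ∑' k : ℕ, (-1 : ℝ) ^ k * θ ^ (-((k + 1 : ℕ) : ℝ) * η - 1) *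
    (Real.Gamma (((k + 1 : ℕ) : ℝ) * η + 1) / ((k + 1).factorial : ℝ)) *
    Real.sin (((k + 1 : ℕ) : ℝ) * Real.pi * η)

/-- The probability density `ξ_η` on `(0, ∞)`. -/
def xi (η θ : ℝ) : ℝ :=
  (1 / η) * θ ^ (-1 - 1 / η) * stableDensity η (θ ^ (-(1 / η)))

/-- `T_η(t) x = η ∫₀^∞ θ ξ_η(θ) T(t^η θ) x dθ`. -/
def fracSemigroup {Z : Type*} [NormedAddCommGroup Z] [NormedSpace ℝ Z]
    (T : ℝ → Z →L[ℝ] Z) (η t : ℝ) (x : Z) : Z :=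
  η • ∫ θ in Ioi (0 : ℝ), (θ * xi η θ) • T (t ^ η * θ) x

/-- The control system
`D^η z = A z + B u + h(t, z)` on `⋃_{r=0}^m (p_r, t_{r+1}]`, `z(t) = ψ_r(t, z(t_r⁻))` on `(t_r, p_r]`,
`I^{1-η} z |_{p_r} = ψ_r(p_r, z(t_r⁻))`, `I^{1-η} z |_0 = z₀`, with its standing assumptions.
Only the indices `p_0, …, p_{m+1}`, `t_1, …, t_{m+1}`, `ψ_1, …, ψ_m` are meaningful. -/
structure ImpulsiveSystem (Z U : Type*) [NormedAddCommGroup Z] [NormedSpace ℝ Z]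
    [NormedAddCommGroup U] [NormedSpace ℝ U] where
  /-- order of the Riemann-Liouville derivative -/
  η : ℝ
  /-- integrability exponent of the controls -/
  q : ℝ
  /-- final time -/
  a : ℝ
  /-- number of impulses -/
  m : ℕ
  p : ℕ → ℝ
  t : ℕ → ℝ
  T : ℝ → Z →L[ℝ] Z
  A : Z →ₗ.[ℝ] Z
  B : Lp U (ENNReal.ofReal q) (volume.restrict (Icc 0 a)) →ₗ[ℝ]
    Lp Z (ENNReal.ofReal q) (volume.restrict (Icc 0 a))
  h : ℝ → Z → Z
  ψ : ℕ → ℝ → Z → Z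
  z₀ : Z
  η_pos : 0 < η
  η_lt_one : η < 1
  one_le_m : 1 ≤ m
  p_zero : p 0 = 0
  p_lt_t : ∀ r ≤ m, p r < t (r + 1)
  t_lt_p : ∀ r, 1 ≤ r → r ≤ m → t r < p r
  t_last : t (m + 1) = a
  p_last : p (m + 1) = a
  semigroup : IsC0Semigroup T
  generator : IsGenerator A T
  dense_domain : Dense (A.domain : Set Z)
  /-- the semigroup is bounded, i.e. the constant `M` below is finite -/
  bounded : BddAbove ((fun s : ℝ => ‖T s‖) '' Ici 0)
  /-- `B` acts from `L^q([p_r, t_{r+1}]; U)` to `L^q([p_r, t_{r+1}]; Z)`: on each of these intervals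
  `B u` depends only on the restriction of `u` to that interval -/
  B_local : ∀ r ≤ m, ∀ u : Lp U (ENNReal.ofReal q) (volume.restrict (Icc 0 a)),
    (∀ᵐ s ∂(volume.restrict (Icc (p r) (t (r + 1)))), u s = 0) →
    ∀ᵐ s ∂(volume.restrict (Icc (p r) (t (r + 1)))), B u s = 0
  /-- `h` is measurable in time -/
  h_meas : ∀ x : Z, AEStronglyMeasurable (fun s => h s x) (volume.restrict (Icc 0 a))

namespace ImpulsiveSystem

variable {Z U : Type*} [NormedAddCommGroup Z] [NormedSpace ℝ Z]
  [NormedAddCommGroup U] [NormedSpace ℝ U]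

/-- The space `L^q([0,a]; U)` of controls. -/
abbrev Control (S : ImpulsiveSystem Z U) : Type _ :=
  Lp U (ENNReal.ofReal S.q) (volume.restrict (Icc 0 S.a))

/-- `T_η(t)` for the given system. -/
def Tη (S : ImpulsiveSystem Z U) (s : ℝ) (x : Z) : Z :=
  fracSemigroup S.T S.η s x

/-- `M = sup_{t ≥ 0} ‖T(t)‖`. -/
def M (S : ImpulsiveSystem Z U) : ℝ :=
  sSup ((fun s : ℝ => ‖S.T s‖) '' Ici 0)

/-- `τ = max_{0 ≤ r ≤ m} (t_{r+1} - p_r)`. -/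
def τ (S : ImpulsiveSystem Z U) : ℝ :=
  ⨆ r : Fin (S.m + 1), (S.t (r + 1) - S.p r)

/-- Membership in `PC_{1-η}([0,a]; Z)`. -/
def IsPC (S : ImpulsiveSystem Z U) (z : ℝ → Z) : Prop :=
  ContinuousOn z ((⋃ r ∈ Icc 0 S.m, Ioo (S.p r) (S.t (r + 1))) ∪
    ⋃ r ∈ Icc 1 S.m, Ioo (S.t r) (S.p r)) ∧
  (∀ r ∈ Icc 1 S.m, Tendsto z (𝓝[<] S.p r) (𝓝 (z (S.p r)))) ∧
  (∀ r ∈ Icc 1 S.m, Tendsto z (𝓝[<] S.t r) (𝓝 (z (S.t r)))) ∧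
  ∀ r ∈ Icc 0 S.m,
    BddAbove ((fun s => (s - S.p r) ^ (1 - S.η) * ‖z s‖) '' Ioc (S.p r) (S.p (r + 1)))

/-- The memory term `φ_r(s, z)`; the sum is empty for `r = 0`, so `φ_0 = 0`.
For `z ∈ PC_{1-η}` one has `z(t_k⁻) = z(t_k)`. -/
def φ (S : ImpulsiveSystem Z U) (r : ℕ) (s : ℝ) (z : ℝ → Z) : Z :=
  (S.η / Real.Gamma (1 - S.η)) • ∑ k ∈ Finset.range r,
    ((∫ σ in (S.p k)..(S.t (k + 1)), ((s - σ) ^ (1 + S.η))⁻¹ • z σ) +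
      ∫ σ in (S.t (k + 1))..(S.p (k + 1)),
        ((s - σ) ^ (1 + S.η))⁻¹ • S.ψ (k + 1) σ (z (S.t (k + 1))))

/-- The datum of the Riemann-Liouville integral at `p_r`: `z₀` for `r = 0`, and
`ψ_r(p_r, z(t_r⁻))` for `r ≥ 1`. -/
def datum (S : ImpulsiveSystem Z U) (r : ℕ) (z : ℝ → Z) : Z :=
  if r = 0 then S.z₀ else S.ψ r (S.p r) (z (S.t r))

/-- The integrand of the variation of constants formula on `(p_r, t_{r+1}]`. -/
def mildIntegrand (S : ImpulsiveSystem Z U) (u : S.Control) (z : ℝ → Z) (r : ℕ) (s σ : ℝ) : Z :=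
  (s - σ) ^ (S.η - 1) • S.Tη (s - σ) (S.B u σ + S.h σ (z σ) + S.φ r σ z)

/-- `z` is a mild solution for the control `u` (the integrals are required to exist). -/
def IsMildSolution (S : ImpulsiveSystem Z U) (u : S.Control) (z : ℝ → Z) : Prop :=
  S.IsPC z ∧
  (∀ r ∈ Icc 0 S.m, ∀ s ∈ Ioc (S.p r) (S.t (r + 1)),
    IntervalIntegrable (S.mildIntegrand u z r s) volume (S.p r) s ∧
    z s = (s - S.p r) ^ (S.η - 1) • S.Tη (s - S.p r) (S.datum r z) +
      ∫ σ in (S.p r)..s, S.mildIntegrand u z r s σ) ∧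
  ∀ r ∈ Icc 1 S.m, ∀ s ∈ Ioc (S.t r) (S.p r), z s = S.ψ r s (z (S.t r))

/-- The reachable set `K_a` at the final time. -/
def reachableSet (S : ImpulsiveSystem Z U) : Set Z :=
  {x | ∃ (u : S.Control) (z : ℝ → Z), S.IsMildSolution u z ∧ x = z S.a}

/-- Approximate controllability on `[0,a]`. -/
def ApproximatelyControllable (S : ImpulsiveSystem Z U) : Prop :=
  Dense S.reachableSet

/-- The operator `𝔽` on `L^q([p_r, t_{r+1}]; Z)`. -/
def F (S : ImpulsiveSystem Z U) (r : ℕ) (f : ℝ → Z) : Z :=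
  ∫ s in (S.p r)..(S.t (r + 1)),
    (S.t (r + 1) - s) ^ (S.η - 1) • S.Tη (S.t (r + 1) - s) (f s)

/-- The part of the constants `ν` and `μ` for the index `r` that they have in common. -/
def muTerm (S : ImpulsiveSystem Z U) (b : ℕ → ℝ) (r : ℕ) : ℝ :=
  S.M * b r / (Real.Gamma S.η * (S.t r - S.p (r - 1)) ^ (1 - S.η)) +
  S.M / (Real.Gamma (1 + S.η) * Real.Gamma (1 - S.η)) *
    ((∑ k ∈ Finset.range r, ((S.t (k + 1) - S.p k) / (S.p r - S.t (k + 1))) ^ S.η) +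
      ∑ k ∈ Finset.range (r - 1), b (k + 1) * (S.t (r + 1) - S.p r) /
        ((S.t (k + 1) - S.p k) ^ (1 - S.η) * (S.p r - S.p (k + 1)) ^ S.η)) +
  S.M * b r * (S.t (r + 1) - S.p r) ^ (1 - S.η) / (S.t r - S.p (r - 1)) ^ (1 - S.η)

/-- The constant `μ` (maximum over `1 ≤ r ≤ m`). -/
def μ (S : ImpulsiveSystem Z U) (b : ℕ → ℝ) : ℝ :=
  ⨆ i : Fin S.m, S.muTerm b (i + 1)

/-- The constant `ν` (maximum over `1 ≤ r ≤ m`). -/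
def ν (S : ImpulsiveSystem Z U) (b : ℕ → ℝ) (κ : ℝ) : ℝ :=
  ⨆ i : Fin S.m, (S.muTerm b (i + 1) +
    S.M * κ * Real.Gamma S.η / Real.Gamma (2 * S.η) * (S.t (i + 1 + 1) - S.p (i + 1)) ^ S.η)

/-- The constant `ϱ`. -/
def ϱ (S : ImpulsiveSystem Z U) : ℝ :=
  S.M / Real.Gamma S.η * ((S.q - 1) / (S.q * S.η - 1)) ^ ((S.q - 1) / S.q) *
    S.τ ^ (1 - 1 / S.q)

def H0 (S : ImpulsiveSystem Z U) : Prop :=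
  S.q ∈ Ioo (1 / S.η) (1 / (1 - S.η))

def H1 (S : ImpulsiveSystem Z U) (κ : ℝ) : Prop :=
  0 < κ ∧ ∀ s ∈ Icc 0 S.a, ∀ x y : Z, ‖S.h s x - S.h s y‖ ≤ κ * ‖x - y‖

def H2 (S : ImpulsiveSystem Z U) (ς : ℝ → ℝ) (d : ℝ) : Prop :=
  MemLp ς (ENNReal.ofReal S.q) (volume.restrict (Icc 0 S.a)) ∧
  (∀ᵐ s ∂(volume.restrict (Icc 0 S.a)), 0 ≤ ς s) ∧ 0 < d ∧
  ∀ r ∈ Icc 0 S.m, ∀ᵐ s ∂(volume.restrict (Ioc (S.p r) (S.p (r + 1)))), ∀ x : Z,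
    ‖S.h s x‖ ≤ ς s + d * (s - S.p r) ^ (1 - S.η) * ‖x‖

def H3 (S : ImpulsiveSystem Z U) (b : ℕ → ℝ) : Prop :=
  ∀ r ∈ Icc 1 S.m,
    ContinuousOn (fun w : ℝ × Z => S.ψ r w.1 w.2) (Icc (S.t r) (S.p r) ×ˢ univ) ∧
    b r ∈ Ioc 0 1 ∧
    ∀ s ∈ Icc (S.t r) (S.p r), ∀ x y : Z, ‖S.ψ r s x - S.ψ r s y‖ ≤ b r * ‖x - y‖

def H4 (S : ImpulsiveSystem Z U) (b : ℕ → ℝ) (κ : ℝ) : Prop :=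
  S.ν b κ < 1

def H5 (S : ImpulsiveSystem Z U) (κ' : ℝ) : Prop :=
  0 < κ' ∧ ∀ r ∈ Icc 0 S.m, ∀ s ∈ Ioc (S.p r) (S.p (r + 1)), ∀ x y : Z,
    ‖S.h s x - S.h s y‖ ≤ κ' * (s - S.p r) ^ (1 - S.η) * ‖x - y‖

def H6 (S : ImpulsiveSystem Z U) (c : ℕ → ℝ) : Prop :=
  ∀ r ∈ Icc 1 S.m,
    ContinuousOn (fun w : ℝ × Z => S.ψ r w.1 w.2) (Icc (S.t r) (S.p r) ×ˢ univ) ∧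
    c r ∈ Ioc 0 1 ∧
    ∀ s ∈ Icc (S.t r) (S.p r), ∀ x : Z, ‖S.ψ r s x‖ ≤ c r * ‖x‖

def H7 (S : ImpulsiveSystem Z U) (b : ℕ → ℝ) (κ' : ℝ) : Prop :=
  S.μ b * mittagLeffler S.η (S.M * κ' * S.τ) < 1

/-- Range condition on `B` with constant `ℵ`, together with the smallness of `ℵ`. -/
def H8 (S : ImpulsiveSystem Z U) (b : ℕ → ℝ) (κ' ℵ : ℝ) : Prop :=
  0 < ℵ ∧
  (∀ r ∈ Icc 0 S.m, ∀ ε : ℝ, 0 < ε → ∀ ϑ : ℝ → Z,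
    MemLp ϑ (ENNReal.ofReal S.q) (volume.restrict (Icc (S.p r) (S.t (r + 1)))) →
    ∃ u : S.Control, ‖S.F r ϑ - S.F r (S.B u)‖ < ε ∧
      eLpNorm (S.B u) (ENNReal.ofReal S.q) (volume.restrict (Icc (S.p r) (S.t (r + 1)))) ≤
        ENNReal.ofReal ℵ *
          eLpNorm ϑ (ENNReal.ofReal S.q) (volume.restrict (Icc (S.p r) (S.t (r + 1))))) ∧
  ∀ r ∈ Icc 1 S.m,
    ℵ * (κ' * (S.t (r + 1) - S.p r) ^ (1 / S.q) +
      1 / Real.Gamma (1 - S.η) * ∑ k ∈ Finset.range r,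
        (S.t (k + 1) - S.p k) ^ S.η * (S.t (r + 1) - S.p r) ^ (1 / S.q) /
          (S.p r - S.t (k + 1)) ^ (1 + S.η)) *
      (S.ϱ * mittagLeffler S.η (S.M * κ' * S.τ) /
        (1 - S.μ b * mittagLeffler S.η (S.M * κ' * S.τ))) < 1

/-- The initial and impulse data lie in `D(A)`: `z₀ ∈ D(A)` and `ψ_r(p_r, z(t_r)) ∈ D(A)` for
`1 ≤ r ≤ m` and all mild solutions `z`. -/
def DataInDomain (S : ImpulsiveSystem Z U) : Prop :=
  S.z₀ ∈ S.A.domain ∧ ∀ (u : S.Control) (z : ℝ → Z), S.IsMildSolution u z →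
    ∀ r ∈ Icc 1 S.m, S.ψ r (S.p r) (z (S.t r)) ∈ S.A.domain

end ImpulsiveSystem

end RLImpulsive

end

/-!
The proof rests on one observation: everything that happens before `p_m` can be frozen. Let `z` be
the solution produced up to time `p_m` by a control with `B u = 0`. By locality of `B`, a control
acting on the last interval `[p_m, a]` can be cut off to the left of `p_m` without changing `B u` on
that interval, so `z` may be continued with any such `v = B u`. The datum at `p_m` and the memory
term on `[p_m, a]` are then fixed, and the final state is
  `z(a) = G + 𝔽 v + 𝔽 (N v)`,
where `G ∈ Z` does not depend on `v`, `𝔽` is the linear operator `S.F m`, and `N v` is the function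
`s ↦ h(s, z_v(s))` along the solution `z_v` belonging to `v`.

* The range of `𝔽` is dense, because `T_η(0) = Γ(η)⁻¹ • id` and `𝔽` can be tested on functions
  concentrated near `a` (`IsBoundedFamily.exists_norm_volterra_sub_lt`).
* `N` is Lipschitz on `L^q`: a Gronwall inequality for the kernel `(t - s)^(η - 1)`
  (`le_mul_mittagLeffler`) bounds the weighted difference of two solutions by
  `ϱ E_η(M κ' τ) ‖v₁ - v₂‖` (`IsLocalSolution.weighted_sub_le`). The last inequality in `(H8)` says
  that `ℵ` times the Lipschitz constant of `N` is smaller than `1`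
  (`ImpulsiveSystem.aleph_mul_lt_one`).
* By `(H8)` every `𝔽 f` is approximated by some `𝔽 (B u)` with `‖B u‖ ≤ ℵ ‖f‖`. Correcting the
  error `𝔽 (N v - N v')` repeatedly, at the cost of a factor `< 1` each time, yields `v = B u` with
  `𝔽 v + 𝔽 (N v)` close to any prescribed value of `𝔽`
  (`exists_mem_norm_map_add_map_sub_lt`).

What remains is the well-posedness that this argument presupposes. The operators `T_η(t)` are bounded
by `M / Γ(η)` and strongly continuous because `ξ_η ≥ 0` and `∫ θ ξ_η(θ) dθ = 1 / Γ(1 + η)`. Both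
facts are derived from the series defining `ξ_η`, which is resummed to an integral of
`exp(ζ - θ ζ^η)` along a ray of argument slightly larger than `π / 2` (`mul_xi_eq_im_integral`). The
moment follows from Fubini (`integral_mul_xi`); for the sign, the ray is turned to the imaginary axis,
where `exp(-θ (ir)^η)` is a limit of characteristic functions of compound Poisson laws, as
`1 - (1 - w)^η` has nonnegative Taylor coefficients (`isPosHalfLine_exp_neg_cpow`, `xi_nonneg`).
Solutions exist on each interval because an iterate of the Picard map contracts
(`exists_isLocalSolution`), once the memory term is known to blow up no faster than `(s - p_r)^(-η)`
(`ImpulsiveSystem.phi_properties`); they are glued interval by interval.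
-/

namespace RLImpulsive

/-! ### Positivity of one-sided Fourier integrals -/

open Complex in
/-- A bounded measurable function `ψ` on the half-line whose Gaussian-regularized one-sided Fourier
integrals all have nonnegative real part. For the boundary values of the Laplace transform of a
probability measure on `[0, ∞)` these real parts are, up to a constant, the values of the density of
the convolution with a Gaussian. -/
structure IsPosHalfLine (ψ : ℝ → ℂ) : Prop where
  meas : AEStronglyMeasurable ψ (volume.restrict (Ioi 0))
  bdd : ∃ B : ℝ, ∀ r ∈ Ioi (0 : ℝ), ‖ψ r‖ ≤ B
  nonneg : ∀ x ε : ℝ, 0 < ε →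
    0 ≤ (∫ r in Ioi (0 : ℝ), ψ r * (cexp ((x * r : ℝ) * I) * (Real.exp (-ε * r ^ 2) : ℝ))).re

namespace IsPosHalfLine

open Complex

lemma norm_kernel (x ε r : ℝ) :
    ‖cexp ((x * r : ℝ) * I) * (Real.exp (-ε * r ^ 2) : ℝ)‖ = Real.exp (-ε * r ^ 2) := by
  rw [norm_mul, norm_exp_ofReal_mul_I, one_mul, norm_real, Real.norm_eq_abs, abs_of_pos (Real.exp_pos _)]

lemma continuous_kernel (x ε : ℝ) :
    Continuous fun r : ℝ => cexp ((x * r : ℝ) * I) * (Real.exp (-ε * r ^ 2) : ℝ) := by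
  fun_prop

lemma integrable {ψ : ℝ → ℂ} (hψ : IsPosHalfLine ψ) (x : ℝ) {ε : ℝ} (hε : 0 < ε) :
    IntegrableOn (fun r : ℝ => ψ r * (cexp ((x * r : ℝ) * I) * (Real.exp (-ε * r ^ 2) : ℝ)))
      (Ioi 0) := by
  obtain ⟨B, hB⟩ := hψ.bdd
  have h1 : IntegrableOn (fun r : ℝ => cexp ((x * r : ℝ) * I) * (Real.exp (-ε * r ^ 2) : ℝ))
      (Ioi 0) := by
    refine ((integrable_exp_neg_mul_sq hε).integrableOn (s := Ioi (0 : ℝ))).mono'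
      (continuous_kernel x ε).aestronglyMeasurable (ae_of_all _ fun r => ?_)
    rw [norm_kernel]
  refine h1.bdd_mul hψ.meas (c := B) ?_
  filter_upwards [ae_restrict_mem measurableSet_Ioi] with r hr using hB r hr

lemma one : IsPosHalfLine fun _ => 1 := by
  refine ⟨aestronglyMeasurable_const, ⟨1, fun r _ => by simp⟩, fun x ε hε => ?_⟩
  have hi : IntegrableOn (fun r : ℝ => (1 : ℂ) * (cexp ((x * r : ℝ) * I) *
      (Real.exp (-ε * r ^ 2) : ℝ))) (Ioi 0) := by
    simp only [one_mul]
    refine ((integrable_exp_neg_mul_sq hε).integrableOn (s := Ioi (0 : ℝ))).mono'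
      (continuous_kernel x ε).aestronglyMeasurable (ae_of_all _ fun r => ?_)
    rw [norm_kernel]
  have hre : (∫ r in Ioi (0 : ℝ), (1 : ℂ) * (cexp ((x * r : ℝ) * I) *
      (Real.exp (-ε * r ^ 2) : ℝ))).re =
      ∫ r in Ioi (0 : ℝ), Real.cos (x * r) * Real.exp (-ε * r ^ 2) := by
    rw [← RCLike.re_eq_complex_re, ← integral_re hi]
    refine integral_congr_ae (ae_of_all _ fun r => ?_)
    simp only [one_mul, RCLike.re_eq_complex_re, re_mul_ofReal, exp_ofReal_mul_I_re]
  have habs : ∫ r : ℝ, Real.cos (x * r) * Real.exp (-ε * r ^ 2) =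
      2 * ∫ r in Ioi (0 : ℝ), Real.cos (x * r) * Real.exp (-ε * r ^ 2) := by
    rw [← integral_comp_abs (f := fun r : ℝ => Real.cos (x * r) * Real.exp (-ε * r ^ 2))]
    refine integral_congr_ae (ae_of_all _ fun r => ?_)
    rcases abs_choice r with h | h <;> simp [h]
  have hint : Integrable fun r : ℝ => cexp ((-ε : ℂ) * r ^ 2 + (x * I) * r + 0) := by
    refine (integrable_exp_neg_mul_sq hε).mono' (by fun_prop) (ae_of_all _ fun r => ?_)
    rw [norm_exp]
    simp [← ofReal_pow]
  have hfull : ∫ r : ℝ, Real.cos (x * r) * Real.exp (-ε * r ^ 2) =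
      (∫ r : ℝ, cexp ((-ε : ℂ) * r ^ 2 + (x * I) * r + 0)).re := by
    rw [← RCLike.re_eq_complex_re, ← integral_re hint]
    refine integral_congr_ae (ae_of_all _ fun r => ?_)
    simp only [RCLike.re_eq_complex_re, add_zero, exp_re]
    have h1 : ((-ε : ℂ) * r ^ 2 + (x * I) * r).re = -ε * r ^ 2 := by simp [← ofReal_pow]
    have h2 : ((-ε : ℂ) * r ^ 2 + (x * I) * r).im = x * r := by simp [← ofReal_pow]
    rw [h1, h2, mul_comm]
  have hpos : 0 ≤ ∫ r : ℝ, Real.cos (x * r) * Real.exp (-ε * r ^ 2) := by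
    rw [hfull, integral_cexp_quadratic (by simpa using hε)]
    have e1 : ((Real.pi : ℂ) / -(-ε : ℂ)) ^ (1 / 2 : ℂ) = ((Real.pi / ε) ^ (1 / 2 : ℝ) : ℝ) := by
      rw [ofReal_cpow (by positivity)]
      push_cast
      simp
    have e2 : cexp (0 - (x * I) ^ 2 / (4 * (-ε : ℂ))) = (Real.exp (-(x ^ 2 / (4 * ε))) : ℝ) := by
      rw [ofReal_exp]
      congr 1
      push_cast
      rw [mul_pow, I_sq]
      field_simp
      ring
    rw [e1, e2, ← ofReal_mul, ofReal_re]
    positivity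
  rw [hre]
  linarith

/-- Multiplication by `ρ e^{-iδr}` translates the underlying law by `δ` and scales it by `ρ`. -/
lemma mul_shift {ψ : ℝ → ℂ} (hψ : IsPosHalfLine ψ) (δ : ℝ) {ρ : ℝ} (hρ : 0 ≤ ρ) :
    IsPosHalfLine fun r => (ρ * cexp ((-(δ * r) : ℝ) * I)) * ψ r := by
  obtain ⟨B, hB⟩ := hψ.bdd
  refine ⟨?_, ⟨ρ * B, fun r hr => ?_⟩, fun x ε hε => ?_⟩
  · exact AEStronglyMeasurable.mul (by fun_prop) hψ.meas
  · rw [norm_mul, norm_mul, norm_exp_ofReal_mul_I, mul_one, norm_real, Real.norm_eq_abs,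
      abs_of_nonneg hρ]
    exact mul_le_mul_of_nonneg_left (hB r hr) hρ
  · have : ∀ r : ℝ, (ρ * cexp ((-(δ * r) : ℝ) * I)) * ψ r *
        (cexp ((x * r : ℝ) * I) * (Real.exp (-ε * r ^ 2) : ℝ)) =
        (ρ : ℂ) * (ψ r * (cexp (((x - δ) * r : ℝ) * I) * (Real.exp (-ε * r ^ 2) : ℝ))) := by
      intro r
      have : cexp (((x - δ) * r : ℝ) * I) = cexp ((-(δ * r) : ℝ) * I) * cexp ((x * r : ℝ) * I) := by
        rw [← Complex.exp_add]
        congr 1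
        push_cast
        ring
      rw [this]
      ring
    simp_rw [this]
    rw [integral_const_mul, re_ofReal_mul]
    exact mul_nonneg hρ (hψ.nonneg _ _ hε)

lemma add {ψ χ : ℝ → ℂ} (hψ : IsPosHalfLine ψ) (hχ : IsPosHalfLine χ) :
    IsPosHalfLine fun r => ψ r + χ r := by
  obtain ⟨B, hB⟩ := hψ.bdd
  obtain ⟨B', hB'⟩ := hχ.bdd
  refine ⟨hψ.meas.add hχ.meas, ⟨B + B', fun r hr => ?_⟩, fun x ε hε => ?_⟩
  · exact (norm_add_le _ _).trans (add_le_add (hB r hr) (hB' r hr))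
  · simp_rw [add_mul]
    rw [integral_add (hψ.integrable x hε) (hχ.integrable x hε), add_re]
    exact add_nonneg (hψ.nonneg _ _ hε) (hχ.nonneg _ _ hε)

lemma const_mul {ψ : ℝ → ℂ} (hψ : IsPosHalfLine ψ) {c : ℝ} (hc : 0 ≤ c) :
    IsPosHalfLine fun r => (c : ℂ) * ψ r := by
  simpa using hψ.mul_shift 0 hc

lemma zero : IsPosHalfLine fun _ => 0 := by
  simpa using one.const_mul le_rfl

lemma sum {ψ : ℕ → ℝ → ℂ} (hψ : ∀ n, IsPosHalfLine (ψ n)) (N : ℕ) :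
    IsPosHalfLine fun r => ∑ n ∈ Finset.range N, ψ n r := by
  induction N with
  | zero => simpa using zero
  | succ N ih => simpa [Finset.sum_range_succ] using ih.add (hψ N)

/-- The class is closed under bounded pointwise limits. -/
lemma of_tendsto {ψ : ℕ → ℝ → ℂ} {χ : ℝ → ℂ} (hψ : ∀ n, IsPosHalfLine (ψ n)) {B : ℝ}
    (hB : ∀ n, ∀ r ∈ Ioi (0 : ℝ), ‖ψ n r‖ ≤ B)
    (hlim : ∀ r ∈ Ioi (0 : ℝ), Tendsto (fun n => ψ n r) atTop (𝓝 (χ r))) :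
    IsPosHalfLine χ := by
  have hae : ∀ᵐ r ∂(volume.restrict (Ioi (0 : ℝ))), Tendsto (fun n => ψ n r) atTop (𝓝 (χ r)) := by
    filter_upwards [ae_restrict_mem measurableSet_Ioi] with r hr using hlim r hr
  refine ⟨aestronglyMeasurable_of_tendsto_ae _ (fun n => (hψ n).meas) hae,
    ⟨B, fun r hr => le_of_tendsto (hlim r hr).norm (Eventually.of_forall fun n => hB n r hr)⟩,
    fun x ε hε => ?_⟩
  have h := tendsto_integral_of_dominated_convergence (μ := volume.restrict (Ioi (0 : ℝ)))
    (F := fun n r => ψ n r * (cexp ((x * r : ℝ) * I) * (Real.exp (-ε * r ^ 2) : ℝ)))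
    (f := fun r => χ r * (cexp ((x * r : ℝ) * I) * (Real.exp (-ε * r ^ 2) : ℝ)))
    (fun r => B * Real.exp (-ε * r ^ 2))
    (fun n => ((hψ n).integrable x hε).aestronglyMeasurable)
    (((integrable_exp_neg_mul_sq hε).integrableOn).const_mul B)
    (fun n => by
      filter_upwards [ae_restrict_mem measurableSet_Ioi] with r hr
      rw [norm_mul, norm_kernel]
      exact mul_le_mul_of_nonneg_right (hB n r hr) (Real.exp_pos _).le)
    (by filter_upwards [hae] with r hr using hr.mul_const _)
  exact ge_of_tendsto' ((continuous_re.tendsto _).comp h) fun n => (hψ n).nonneg x ε hε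

lemma mul_pow_shift {ψ : ℝ → ℂ} (hψ : IsPosHalfLine ψ) (δ : ℝ) {ρ : ℝ} (hρ : 0 ≤ ρ) (n : ℕ) :
    IsPosHalfLine fun r => (ρ * cexp ((-(δ * r) : ℝ) * I)) ^ n * ψ r := by
  induction n with
  | zero => simpa using hψ
  | succ n ih =>
    have := ih.mul_shift δ hρ
    simpa only [pow_succ', mul_assoc] using this

/-- Multiplication by a power series with nonnegative coefficients in `w = ρ e^{-iδr}`. -/
lemma mul_powerSeries {ψ : ℝ → ℂ} (hψ : IsPosHalfLine ψ) (δ : ℝ) {ρ : ℝ} (hρ : 0 ≤ ρ) {c : ℕ → ℝ}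
    (hc : ∀ n, 0 ≤ c n) (hs : Summable fun n => c n * ρ ^ n) {g : ℝ → ℂ}
    (hg : ∀ r, HasSum (fun n => (c n : ℂ) * (ρ * cexp ((-(δ * r) : ℝ) * I)) ^ n) (g r)) :
    IsPosHalfLine fun r => g r * ψ r := by
  obtain ⟨B, hB⟩ := hψ.bdd
  refine of_tendsto (ψ := fun N r => ∑ n ∈ Finset.range N,
    (c n : ℂ) * ((ρ * cexp ((-(δ * r) : ℝ) * I)) ^ n * ψ r)) (B := (∑' n, c n * ρ ^ n) * B)
    (fun N => sum (fun n => (hψ.mul_pow_shift δ hρ n).const_mul (hc n)) N) (fun N r hr => ?_)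
    (fun r _ => ?_)
  · have hB0 : 0 ≤ B := (norm_nonneg _).trans (hB r hr)
    simp_rw [← mul_assoc]
    rw [← Finset.sum_mul, norm_mul]
    refine mul_le_mul ?_ (hB r hr) (norm_nonneg _) (tsum_nonneg fun n => mul_nonneg (hc n) (by positivity))
    refine (norm_sum_le _ _).trans ?_
    refine le_trans (le_of_eq ?_) (hs.sum_le_tsum (Finset.range N)
      fun n _ => mul_nonneg (hc n) (by positivity))
    refine Finset.sum_congr rfl fun n _ => ?_
    rw [norm_mul, norm_pow, norm_mul, norm_exp_ofReal_mul_I, mul_one, norm_real, norm_real,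
      Real.norm_of_nonneg hρ, Real.norm_of_nonneg (hc n)]
  · simp_rw [← mul_assoc, ← Finset.sum_mul]
    exact (hg r).tendsto_sum_nat.mul_const _

/-- Exponentials of multipliers of the class belong to the class. -/
lemma exp_mul {g : ℝ → ℂ} (hg : ∀ ψ, IsPosHalfLine ψ → IsPosHalfLine fun r => g r * ψ r) {G : ℝ}
    (hG : ∀ r ∈ Ioi (0 : ℝ), ‖g r‖ ≤ G) : IsPosHalfLine fun r => cexp (g r) := by
  have hpow : ∀ n : ℕ, IsPosHalfLine fun r => g r ^ n := by
    intro n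
    induction n with
    | zero => simpa using one
    | succ n ih => simpa only [pow_succ'] using hg _ ih
  have hG0 : 0 ≤ G := (norm_nonneg _).trans (hG 1 (by simp))
  refine of_tendsto (ψ := fun N r => ∑ n ∈ Finset.range N, (((n.factorial : ℝ)⁻¹ : ℝ) : ℂ) * g r ^ n)
    (B := Real.exp G)
    (fun N => sum (fun n => (hpow n).const_mul (by positivity)) N) (fun N r hr => ?_)
    (fun r _ => ?_)
  · refine (norm_sum_le _ _).trans (le_trans ?_ (Real.sum_le_exp_of_nonneg hG0 N))
    refine Finset.sum_le_sum fun n _ => ?_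
    rw [norm_mul, norm_pow, norm_real, Real.norm_of_nonneg (by positivity), mul_comm, div_eq_mul_inv]
    gcongr
    exact hG r hr
  · have h := (NormedSpace.exp_series_hasSum_exp' (𝕂 := ℂ) (g r)).tendsto_sum_nat
    rw [← Complex.exp_eq_exp_ℂ] at h
    simpa using h

end IsPosHalfLine

/-- The numbers `a_k` in the expansion `1 - (1 - w)^η = ∑ a_k w^k`. -/
noncomputable def binomCoeff (η : ℝ) (k : ℕ) : ℝ :=
  if k = 0 then 0 else -(-1) ^ k * Ring.choose η k

lemma choose_succ (η : ℝ) (k : ℕ) :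
    Ring.choose η (k + 1) = Ring.choose η k * (η - k) / (k + 1) := by
  rw [Ring.choose_eq_smul, Ring.choose_eq_smul, descPochhammer_succ_right, Polynomial.smeval_mul,
    Nat.factorial_succ]
  simp only [Polynomial.smeval_sub, Polynomial.smeval_X, pow_one, Polynomial.smeval_natCast,
    pow_zero, nsmul_eq_mul, mul_one, smul_eq_mul]
  push_cast
  have : ((k.factorial : ℕ) : ℝ) ≠ 0 := by positivity
  field_simp

lemma binomCoeff_nonneg {η : ℝ} (h0 : 0 < η) (h1 : η < 1) (k : ℕ) : 0 ≤ binomCoeff η k := by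
  rcases k with _ | k
  · simp [binomCoeff]
  induction k with
  | zero => simp [binomCoeff, h0.le]
  | succ k ih =>
    have : binomCoeff η (k + 1 + 1) = binomCoeff η (k + 1) * (((k : ℝ) + 1 - η) / (k + 2)) := by
      simp only [binomCoeff, Nat.succ_ne_zero, if_false]
      rw [choose_succ η (k + 1)]
      push_cast
      field_simp
      ring
    rw [this]
    have hk : (0 : ℝ) ≤ k := Nat.cast_nonneg k
    exact mul_nonneg ih (div_nonneg (by linarith) (by linarith))

lemma hasSum_binomCoeff (η : ℝ) {w : ℂ} (hw : ‖w‖ < 1) :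
    HasSum (fun k => (binomCoeff η k : ℂ) * w ^ k) (1 - (1 - w) ^ (η : ℂ)) := by
  have hmem : -w ∈ Metric.eball (0 : ℂ) 1 := by
    rw [← ENNReal.ofReal_one, Metric.eball_ofReal]
    simpa using hw
  have h := (Complex.one_add_cpow_hasFPowerSeriesOnBall_zero (a := (η : ℂ))).hasSum hmem
  have h2 := (hasSum_ite_eq 0 (1 : ℂ)).sub h
  rw [zero_add, ← sub_eq_add_neg] at h2
  refine h2.congr_fun fun k => ?_
  rw [binomialSeries_apply]
  rcases k with _ | k
  · simp [binomCoeff]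
  · simp [binomCoeff, Complex.ofReal_choose, neg_pow w]
    ring

lemma cpow_re_nonneg {η : ℝ} (h0 : 0 ≤ η) (h1 : η ≤ 1) {z : ℂ} (hz : 0 ≤ z.re) :
    0 ≤ (z ^ (η : ℂ)).re := by
  rw [Complex.cpow_ofReal_re]
  refine mul_nonneg (Real.rpow_nonneg (norm_nonneg _) _) (Real.cos_nonneg_of_mem_Icc ?_)
  have h := abs_le.mp (Complex.abs_arg_le_pi_div_two_iff.mpr hz)
  have hp := Real.pi_pos
  constructor <;> nlinarith [h.1, h.2]

lemma ofReal_mul_cpow {a : ℝ} (ha : 0 < a) {z : ℂ} (hz : z ≠ 0) (η : ℝ) :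
    ((a : ℂ) * z) ^ (η : ℂ) = (a ^ η : ℝ) * z ^ (η : ℂ) := by
  have ha' : (a : ℂ) ≠ 0 := by exact_mod_cast ha.ne'
  rw [Complex.cpow_def_of_ne_zero (mul_ne_zero ha' hz), Complex.log_ofReal_mul ha hz, add_mul,
    Complex.exp_add, Complex.cpow_def_of_ne_zero hz, Real.rpow_def_of_pos ha]
  push_cast
  rfl

/-- The function `r ↦ exp(-θ (ir)^η)`, the boundary value of the Laplace transform `exp(-θ λ^η)`, is
the limit as `δ → 0` of `exp(-θ δ^{-η} (1 - w)^η)` with `w = exp(-(δ + ir)δ)`; since `1 - (1 - w)^η`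
has nonnegative Taylor coefficients, these are Laplace transforms of discrete compound Poisson
laws. -/
theorem isPosHalfLine_exp_neg_cpow {η : ℝ} (h0 : 0 < η) (h1 : η < 1) {θ : ℝ} (hθ : 0 ≤ θ) :
    IsPosHalfLine fun r : ℝ => Complex.exp (-(θ * (r * Complex.I) ^ (η : ℂ))) := by
  set δ : ℕ → ℝ := fun n => 1 / ((n : ℝ) + 1) with hδ
  have hδ0 : ∀ n, 0 < δ n := fun n => by positivity
  set ρ : ℕ → ℝ := fun n => Real.exp (-(δ n * δ n)) with hρ
  have hρ0 : ∀ n, 0 ≤ ρ n := fun n => (Real.exp_pos _).le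
  have hρ1 : ∀ n, ρ n < 1 := fun n => by
    rw [hρ, Real.exp_lt_one_iff]
    nlinarith [hδ0 n]
  set w : ℕ → ℝ → ℂ := fun n r => ρ n * Complex.exp ((-(δ n * r) : ℝ) * Complex.I) with hw
  have hwn : ∀ n r, ‖w n r‖ = ρ n := fun n r => by
    rw [hw, norm_mul, Complex.norm_exp_ofReal_mul_I, mul_one, Complex.norm_real,
      Real.norm_of_nonneg (hρ0 n)]
  set k : ℕ → ℝ := fun n => θ * (δ n)⁻¹ ^ η with hk
  have hk0 : ∀ n, 0 ≤ k n := fun n => mul_nonneg hθ (Real.rpow_nonneg (inv_pos.mpr (hδ0 n)).le _)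
  have hre : ∀ n r, 0 < (1 - w n r).re := fun n r => by
    have := Complex.re_le_norm (w n r)
    rw [hwn] at this
    rw [Complex.sub_re, Complex.one_re]
    linarith [hρ1 n]
  have hψ : ∀ n, IsPosHalfLine fun r => Complex.exp (-(k n * (1 - w n r) ^ (η : ℂ))) := by
    intro n
    have hs : Summable fun j => k n * binomCoeff η j * ρ n ^ j := by
      have h := hasSum_binomCoeff η (w := (ρ n : ℂ))
        (by rw [Complex.norm_real, Real.norm_of_nonneg (hρ0 n)]; exact hρ1 n)
      have h' : Summable fun j => ((binomCoeff η j * ρ n ^ j : ℝ) : ℂ) := by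
        refine h.summable.congr fun j => ?_
        push_cast
        rfl
      simp_rw [mul_assoc]
      exact (Complex.summable_ofReal.mp h').mul_left _
    have hg : ∀ r, HasSum (fun j => ((k n * binomCoeff η j : ℝ) : ℂ) * (w n r) ^ j)
        (k n * (1 - (1 - w n r) ^ (η : ℂ))) := by
      intro r
      have := (hasSum_binomCoeff η (w := w n r) (by rw [hwn]; exact hρ1 n)).mul_left (k n : ℂ)
      refine this.congr_fun fun j => ?_
      push_cast
      ring
    have h := IsPosHalfLine.exp_mul (g := fun r => (k n : ℂ) * (1 - (1 - w n r) ^ (η : ℂ)))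
      (G := ∑' j, k n * binomCoeff η j * ρ n ^ j)
      (fun ψ hψ => hψ.mul_powerSeries (δ n) (hρ0 n)
        (fun j => mul_nonneg (hk0 n) (binomCoeff_nonneg h0 h1 j)) hs hg)
      (fun r _ => by
        rw [← (hg r).tsum_eq]
        refine tsum_of_norm_bounded hs.hasSum fun j => ?_
        rw [norm_mul, norm_pow, hwn, Complex.norm_real,
          Real.norm_of_nonneg (mul_nonneg (hk0 n) (binomCoeff_nonneg h0 h1 j))])
    have h' := h.const_mul (Real.exp_pos (-(k n))).le
    convert h' using 2 with r
    rw [Complex.ofReal_exp, ← Complex.exp_add]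
    congr 1
    push_cast
    ring
  refine IsPosHalfLine.of_tendsto hψ (B := 1) (fun n r _ => ?_) (fun r hr => ?_)
  · rw [Complex.norm_exp, Real.exp_le_one_iff, Complex.neg_re, Complex.re_ofReal_mul]
    have := mul_nonneg (hk0 n) (cpow_re_nonneg h0.le h1.le (hre n r).le)
    linarith
  · have hr' : (0 : ℝ) < r := hr
    have hδlim : Tendsto δ atTop (𝓝[≠] 0) := by
      refine tendsto_nhdsWithin_iff.mpr ⟨tendsto_one_div_add_atTop_nhds_zero_nat,
        Eventually.of_forall fun n => (hδ0 n).ne'⟩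
    have hd : HasDerivAt (fun t : ℝ => 1 - Complex.exp (-((t + r * Complex.I) * t)))
        (r * Complex.I) 0 := by
      have h1 : HasDerivAt (fun t : ℝ => (t : ℂ)) 1 0 := Complex.ofRealCLM.hasDerivAt
      have := ((((h1.add_const (r * Complex.I)).mul h1).neg).cexp).const_sub 1
      convert! this using 1
      simp
    have hsl := (hasDerivAt_iff_tendsto_slope.mp hd).comp hδlim
    have hlim : Tendsto (fun n => ((δ n)⁻¹ : ℝ) * (1 - w n r)) atTop (𝓝 (r * Complex.I)) := by
      refine hsl.congr fun n => ?_
      simp only [Function.comp, slope_def_module, sub_zero, Complex.real_smul]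
      have : Complex.exp (-((δ n + r * Complex.I) * δ n)) = w n r := by
        rw [hw, hρ]
        simp only
        rw [Complex.ofReal_exp, ← Complex.exp_add]
        congr 1
        push_cast
        ring
      rw [this]
      simp
    have hslit : (r * Complex.I : ℂ) ∈ Complex.slitPlane := by
      right
      simp [hr'.ne']
    have hc := (continuousAt_cpow_const hslit (b := (η : ℂ))).tendsto.comp hlim
    have hc2 := (((hc.const_mul (θ : ℂ)).neg).cexp)
    refine hc2.congr fun n => ?_
    have hne : (1 - w n r) ≠ 0 := fun h => by
      have := hre n r
      rw [h] at this
      simp at this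
    simp only [Function.comp, hk]
    rw [ofReal_mul_cpow (inv_pos.mpr (hδ0 n)) hne]
    push_cast
    ring_nf

/-- One-sided Fourier integrals of `exp(-θ (ir)^η)` have nonnegative real part. -/
theorem re_integral_exp_neg_cpow_nonneg {η : ℝ} (h0 : 0 < η) (h1 : η < 1) {θ : ℝ} (hθ : 0 < θ) :
    0 ≤ (∫ r in Ioi (0 : ℝ),
      Complex.exp (r * Complex.I - θ * (r * Complex.I) ^ (η : ℂ))).re := by
  have hpos := isPosHalfLine_exp_neg_cpow h0 h1 hθ.le
  have hcos : 0 < Real.cos (Real.pi / 2 * η) := by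
    apply Real.cos_pos_of_mem_Ioo
    have := Real.pi_pos
    constructor <;> nlinarith
  have hre : ∀ r ∈ Ioi (0 : ℝ), ((r * Complex.I : ℂ) ^ (η : ℂ)).re =
      Real.cos (Real.pi / 2 * η) * r ^ η := by
    intro r hr
    rw [Complex.cpow_ofReal_re, Complex.arg_real_mul _ hr, Complex.arg_I]
    simp [abs_of_pos (show (0:ℝ) < r from hr), mul_comm]
  set ε : ℕ → ℝ := fun n => 1 / ((n : ℝ) + 1) with hε
  have hint : IntegrableOn (fun r : ℝ => Real.exp (-(θ * Real.cos (Real.pi / 2 * η)) * r ^ η))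
      (Ioi 0) := by
    simpa using integrableOn_rpow_mul_exp_neg_mul_rpow (s := 0) (by norm_num) h0 (mul_pos hθ hcos)
  have h := tendsto_integral_of_dominated_convergence (μ := volume.restrict (Ioi (0 : ℝ)))
    (F := fun (n : ℕ) r => Complex.exp (-(θ * (r * Complex.I) ^ (η : ℂ))) *
      (Complex.exp ((1 * r : ℝ) * Complex.I) * (Real.exp (-ε n * r ^ 2) : ℝ)))
    (f := fun r => Complex.exp (r * Complex.I - θ * (r * Complex.I) ^ (η : ℂ)))
    (fun r => Real.exp (-(θ * Real.cos (Real.pi / 2 * η)) * r ^ η))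
    (fun n => (hpos.integrable 1 (by positivity)).aestronglyMeasurable) hint
    (fun n => by
      filter_upwards [ae_restrict_mem measurableSet_Ioi] with r hr
      rw [norm_mul, IsPosHalfLine.norm_kernel, Complex.norm_exp, Complex.neg_re,
        Complex.re_ofReal_mul, hre r hr, ← mul_assoc, ← neg_mul]
      refine mul_le_of_le_one_right (Real.exp_pos _).le (Real.exp_le_one_iff.mpr ?_)
      have : 0 ≤ ε n * r ^ 2 := by positivity
      linarith)
    (ae_of_all _ fun r => by
      have hε0 : Tendsto ε atTop (𝓝 0) := tendsto_one_div_add_atTop_nhds_zero_nat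
      have h1 : Tendsto (fun n => ((Real.exp (-ε n * r ^ 2) : ℝ) : ℂ)) atTop (𝓝 ((1 : ℝ) : ℂ)) := by
        refine (Complex.continuous_ofReal.tendsto _).comp ?_
        have := ((hε0.neg.mul_const (r ^ 2)).rexp)
        simpa using this
      have h2 := (h1.const_mul (Complex.exp ((1 * r : ℝ) * Complex.I))).const_mul
        (Complex.exp (-(θ * (r * Complex.I) ^ (η : ℂ))))
      convert h2 using 2
      rw [Complex.ofReal_one, mul_one, ← Complex.exp_add, one_mul]
      congr 1
      ring)
  exact ge_of_tendsto' ((Complex.continuous_re.tendsto _).comp h) fun n =>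
    hpos.nonneg 1 (ε n) (by positivity)

/-! ### Gamma integrals with complex rate -/

lemma integrableOn_rpow_mul_exp_neg {s c : ℝ} (hs : 0 < s) (hc : 0 < c) :
    IntegrableOn (fun r : ℝ => r ^ (s - 1) * Real.exp (-(c * r))) (Ioi 0) := by
  have h := integrableOn_rpow_mul_exp_neg_mul_rpow (s := s - 1) (p := 1) (b := c) (by linarith)
    one_pos hc
  simpa using h

lemma norm_rpow_mul_cexp {s r : ℝ} (b : ℂ) (hr : 0 < r) :
    ‖((r ^ s : ℝ) : ℂ) * Complex.exp (-(b * r))‖ = r ^ s * Real.exp (-(b.re * r)) := by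
  rw [norm_mul, Complex.norm_real, Real.norm_of_nonneg (by positivity), Complex.norm_exp]
  simp

lemma integrableOn_rpow_mul_cexp_neg {s : ℝ} (hs : 0 < s) {b : ℂ} (hb : 0 < b.re) :
    IntegrableOn (fun r : ℝ => ((r ^ (s - 1) : ℝ) : ℂ) * Complex.exp (-(b * r))) (Ioi 0) := by
  refine (integrableOn_rpow_mul_exp_neg hs hb).mono' (Measurable.aestronglyMeasurable (by fun_prop)) ?_
  filter_upwards [ae_restrict_mem measurableSet_Ioi] with r hr
  rw [norm_rpow_mul_cexp b hr]

/-- Integration by parts for the Gamma integral with complex rate. -/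
lemma mul_integral_rpow_mul_cexp_neg {s : ℝ} (hs : 0 < s) {b : ℂ} (hb : 0 < b.re) :
    b * ∫ r in Ioi (0 : ℝ), ((r ^ s : ℝ) : ℂ) * Complex.exp (-(b * r)) =
      s * ∫ r in Ioi (0 : ℝ), ((r ^ (s - 1) : ℝ) : ℂ) * Complex.exp (-(b * r)) := by
  have i1 := (integrableOn_rpow_mul_cexp_neg hs hb).const_mul (s : ℂ)
  have i2 : IntegrableOn (fun r : ℝ => ((r ^ s : ℝ) : ℂ) * Complex.exp (-(b * r))) (Ioi 0) := by
    simpa using integrableOn_rpow_mul_cexp_neg (s := s + 1) (by linarith) hb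
  have i2' := i2.const_mul b
  have h := integral_Ioi_of_hasDerivAt_of_tendsto (a := 0) (m := 0)
    (f := fun r : ℝ => ((r ^ s : ℝ) : ℂ) * Complex.exp (-(b * r)))
    (f' := fun r : ℝ => s * (((r ^ (s - 1) : ℝ) : ℂ) * Complex.exp (-(b * r))) -
      b * (((r ^ s : ℝ) : ℂ) * Complex.exp (-(b * r))))
    (by
      have : Continuous fun r : ℝ => r ^ s := Real.continuous_rpow_const hs.le
      exact Continuous.continuousWithinAt (by fun_prop))
    (fun r hr => by
      have h1 := (Real.hasDerivAt_rpow_const (p := s) (Or.inl (ne_of_gt hr))).ofReal_comp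
      have h2 : HasDerivAt (fun r : ℝ => (r : ℂ)) 1 r := Complex.ofRealCLM.hasDerivAt
      have h3 := h1.mul ((h2.const_mul b).neg.cexp)
      convert! h3 using 1
      simp only [Pi.neg_apply]
      push_cast
      ring)
    (i1.sub i2')
    (by
      rw [tendsto_zero_iff_norm_tendsto_zero]
      refine (tendsto_rpow_mul_exp_neg_mul_atTop_nhds_zero s b.re hb).congr' ?_
      filter_upwards [eventually_gt_atTop 0] with r hr
      rw [norm_rpow_mul_cexp b hr, neg_mul])
  rw [integral_sub i1 i2', integral_const_mul, integral_const_mul] at h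
  simp only [Real.zero_rpow hs.ne', Complex.ofReal_zero, zero_mul, sub_zero] at h
  exact (sub_eq_zero.mp h).symm

/-- The Gamma integral with complex rate. -/
theorem integral_rpow_mul_cexp_neg {s : ℝ} (hs : 0 < s) {b : ℂ} (hb : 0 < b.re) :
    ∫ r in Ioi (0 : ℝ), ((r ^ (s - 1) : ℝ) : ℂ) * Complex.exp (-(b * r)) =
      Real.Gamma s * b ^ (-(s : ℂ)) := by
  set G : ℂ → ℂ := fun b => ∫ r in Ioi (0 : ℝ), ((r ^ (s - 1) : ℝ) : ℂ) * Complex.exp (-(b * r))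
    with hG
  have hderiv : ∀ b : ℂ, 0 < b.re → HasDerivAt G
      (∫ r in Ioi (0 : ℝ), -(((r ^ s : ℝ) : ℂ) * Complex.exp (-(b * r)))) b := by
    intro b hb
    have hnhds : {z : ℂ | b.re / 2 < z.re} ∈ 𝓝 b :=
      (isOpen_lt continuous_const Complex.continuous_re).mem_nhds (by simp; linarith)
    refine (hasDerivAt_integral_of_dominated_loc_of_deriv_le (μ := volume.restrict (Ioi (0 : ℝ)))
      (F := fun (b : ℂ) (r : ℝ) => ((r ^ (s - 1) : ℝ) : ℂ) * Complex.exp (-(b * r)))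
      (F' := fun (b : ℂ) (r : ℝ) => -(((r ^ s : ℝ) : ℂ) * Complex.exp (-(b * r))))
      (bound := fun r => r ^ ((s + 1) - 1) * Real.exp (-(b.re / 2 * r))) hnhds
      (Eventually.of_forall fun z => Measurable.aestronglyMeasurable (by fun_prop))
      (integrableOn_rpow_mul_cexp_neg hs hb) (Measurable.aestronglyMeasurable (by fun_prop)) ?_
      (integrableOn_rpow_mul_exp_neg (by linarith) (by linarith)) ?_).2
    · filter_upwards [ae_restrict_mem measurableSet_Ioi] with r hr z hz
      rw [norm_neg, norm_rpow_mul_cexp z hr, add_sub_cancel_right]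
      refine mul_le_mul_of_nonneg_left (Real.exp_le_exp.mpr ?_) (Real.rpow_nonneg (le_of_lt hr) _)
      have : b.re / 2 * r ≤ z.re * r := mul_le_mul_of_nonneg_right (le_of_lt hz) (le_of_lt hr)
      linarith
    · filter_upwards [ae_restrict_mem measurableSet_Ioi] with r hr z _
      have h2 : HasDerivAt (fun z : ℂ => Complex.exp (-(z * r))) (Complex.exp (-(z * r)) * -(1 * r)) z :=
        (((hasDerivAt_id z).mul_const (r : ℂ)).neg).cexp
      have h3 := h2.const_mul (((r ^ (s - 1) : ℝ)) : ℂ)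
      convert! h3 using 1
      have : r ^ s = r ^ (s - 1) * r := by
        rw [← Real.rpow_add_one (ne_of_gt hr), sub_add_cancel]
      rw [this]
      push_cast
      ring
  have hopen : IsOpen {z : ℂ | 0 < z.re} := isOpen_lt continuous_const Complex.continuous_re
  have hconv : Convex ℝ {z : ℂ | 0 < z.re} := convex_halfSpace_re_gt 0
  have hprod : ∀ z ∈ {z : ℂ | 0 < z.re}, HasDerivAt (fun z => z ^ (s : ℂ) * G z) 0 z := by
    intro z hz
    have hz0 : z ≠ 0 := fun h => by simp [h] at hz
    have h1 : HasDerivAt (fun z : ℂ => z ^ (s : ℂ)) ((s : ℂ) * z ^ ((s : ℂ) - 1) * 1) z :=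
      (hasDerivAt_id z).cpow_const (Or.inl hz)
    have h2 := h1.mul (hderiv z hz)
    convert! h2 using 1
    have h3 := mul_integral_rpow_mul_cexp_neg hs hz
    rw [integral_neg, hG]
    simp only
    have h4 : z ^ (s : ℂ) = z ^ ((s : ℂ) - 1) * z := by
      rw [Complex.cpow_sub _ _ hz0, Complex.cpow_one, div_mul_cancel₀ _ hz0]
    rw [h4]
    linear_combination (z ^ ((s : ℂ) - 1)) * h3
  have hconst := hopen.is_const_of_deriv_eq_zero hconv.isPreconnected
    (fun z hz => (hprod z hz).differentiableAt.differentiableWithinAt)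
    (fun z hz => (hprod z hz).deriv) hb (show (1 : ℂ) ∈ {z : ℂ | 0 < z.re} by simp)
  have hone : G 1 = Real.Gamma s := by
    rw [Real.Gamma_eq_integral hs, ← integral_complex_ofReal]
    refine integral_congr_ae (ae_of_all _ fun r => ?_)
    simp only [one_mul]
    push_cast
    ring
  rw [Complex.one_cpow, one_mul, hone] at hconst
  have hb0 : b ≠ 0 := fun h => by simp [h] at hb
  have hbs : b ^ (s : ℂ) ≠ 0 := by simp [Complex.cpow_eq_zero_iff, hb0]
  rw [Complex.cpow_neg, ← hconst, mul_comm, inv_mul_cancel_left₀ hbs]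

/-- The same integral along a ray of argument `φ` in the left half-plane. -/
lemma integral_rpow_mul_cexp_ray {s φ : ℝ} (hs : 0 < s) (h1 : Real.pi / 2 < φ) (h2 : φ < Real.pi) :
    ∫ r in Ioi (0 : ℝ), ((r ^ (s - 1) : ℝ) : ℂ) * Complex.exp (r * Complex.exp (φ * Complex.I)) =
      Real.Gamma s * Complex.exp (s * ((Real.pi - φ) * Complex.I)) := by
  have hb : 0 < (-Complex.exp (φ * Complex.I)).re := by
    rw [Complex.neg_re, Complex.exp_ofReal_mul_I_re, Left.neg_pos_iff]
    exact Real.cos_neg_of_pi_div_two_lt_of_lt h1 (by linarith [Real.pi_pos])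
  have h := integral_rpow_mul_cexp_neg hs hb
  have e1 : ∀ r : ℝ, -(-Complex.exp (φ * Complex.I) * r) = r * Complex.exp (φ * Complex.I) :=
    fun r => by ring
  simp_rw [e1] at h
  rw [h]
  congr 1
  have e2 : -Complex.exp (φ * Complex.I) = Complex.exp ((φ - Real.pi) * Complex.I) := by
    rw [sub_mul, Complex.exp_sub, Complex.exp_pi_mul_I]
    ring
  have e3 : ((φ - Real.pi) * Complex.I : ℂ).im = φ - Real.pi := by
    simp
  rw [e2, Complex.cpow_def_of_ne_zero (Complex.exp_ne_zero _), Complex.log_exp]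
  · congr 1
    ring
  · rw [e3]; linarith [Real.pi_pos]
  · rw [e3]; linarith [Real.pi_pos]

/-! ### Contour representation of `ξ_η` -/

/-- The integrand of the contour representation of `θ ξ_η(θ)` along the ray of argument `φ`: with
`ζ = r e^{iφ}` it is `exp(ζ - θ ζ^η) dζ/dr`. -/
noncomputable def rayIntegrand (η φ θ r : ℝ) : ℂ :=
  Complex.exp (r * Complex.exp (φ * Complex.I) -
    θ * ((r ^ η : ℝ) * Complex.exp ((η * φ : ℝ) * Complex.I))) * Complex.exp (φ * Complex.I)

lemma norm_rayIntegrand (η φ θ r : ℝ) :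
    ‖rayIntegrand η φ θ r‖ =
      Real.exp (r * Real.cos φ) * Real.exp (-(θ * (r ^ η * Real.cos (η * φ)))) := by
  rw [rayIntegrand, norm_mul, Complex.norm_exp_ofReal_mul_I, mul_one, Complex.norm_exp,
    Complex.sub_re, Complex.re_ofReal_mul, Complex.re_ofReal_mul, Complex.re_ofReal_mul,
    Complex.exp_ofReal_mul_I_re, Complex.exp_ofReal_mul_I_re, ← Real.exp_add, sub_eq_add_neg]

lemma integrableOn_exp_rpow_sub {η θ c : ℝ} (h0 : 0 < η) (h1 : η < 1) (hc : 0 < c) :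
    IntegrableOn (fun r : ℝ => Real.exp (θ * r ^ η) * Real.exp (-(c * r))) (Ioi 0) := by
  refine integrable_of_isBigO_exp_neg (b := c / 2) (by linarith) ?_ ?_
  · have : Continuous fun r : ℝ => r ^ η := Real.continuous_rpow_const h0.le
    exact Continuous.continuousOn (by fun_prop)
  · have hlim : Tendsto (fun r : ℝ => θ * r ^ (-(1 - η))) atTop (𝓝 0) := by
      simpa using (tendsto_rpow_neg_atTop (y := 1 - η) (by linarith)).const_mul θ
    refine Asymptotics.IsBigO.of_bound 1 ?_
    filter_upwards [hlim.eventually (gt_mem_nhds (show (0 : ℝ) < c / 2 by linarith)),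
      eventually_gt_atTop 0] with r hr hr0
    rw [← Real.exp_add, one_mul, Real.norm_eq_abs, Real.norm_eq_abs, Real.abs_exp, Real.abs_exp]
    refine Real.exp_le_exp.mpr ?_
    have : r ^ η = r ^ (-(1 - η)) * r := by
      rw [← Real.rpow_add_one hr0.ne']
      congr 1
      ring
    rw [this]
    nlinarith

/-- Expansion of the ray integral in powers of `θ`. -/
theorem hasSum_im_integral_rayIntegrand {η φ : ℝ} (h0 : 0 < η) (h1 : η < 1)
    (hφ : Real.pi / 2 < φ) (hφ' : φ < Real.pi) (θ : ℝ) :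
    HasSum (fun n : ℕ => -(-θ) ^ n / n.factorial * Real.Gamma (n * η + 1) * Real.sin (n * Real.pi * η))
      (∫ r in Ioi (0 : ℝ), rayIntegrand η φ θ r).im := by
  have hcos : Real.cos φ < 0 :=
    Real.cos_neg_of_pi_div_two_lt_of_lt hφ (by linarith [Real.pi_pos])
  set e : ℂ := Complex.exp (φ * Complex.I) with he
  set f : ℂ := Complex.exp ((η * φ : ℝ) * Complex.I) with hf
  have hexp : ∀ r : ℝ, HasSum (fun n : ℕ => (-θ * f) ^ n / n.factorial * e *
      (((r ^ η) ^ n : ℝ) * Complex.exp (r * e))) (rayIntegrand η φ θ r) := by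
    intro r
    have h := NormedSpace.exp_series_hasSum_exp' (𝕂 := ℂ) (-θ * f * (r ^ η : ℝ))
    rw [← Complex.exp_eq_exp_ℂ] at h
    have h2 := h.mul_right (Complex.exp (r * e) * e)
    have e1 : Complex.exp (-θ * f * (r ^ η : ℝ)) * (Complex.exp (r * e) * e) =
        rayIntegrand η φ θ r := by
      rw [← mul_assoc, ← Complex.exp_add, rayIntegrand]
      congr 2
      ring
    rw [e1] at h2
    refine h2.congr_fun fun n => ?_
    rw [smul_eq_mul, mul_pow (-θ * f)]
    push_cast
    ring
  have hnorm : ∀ n : ℕ, ∀ r ∈ Ioi (0 : ℝ), ‖(-θ * f) ^ n / n.factorial * e *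
      (((r ^ η) ^ n : ℝ) * Complex.exp (r * e))‖ =
      (|θ| * r ^ η) ^ n / n.factorial * Real.exp (-(-Real.cos φ * r)) := by
    intro n r hr
    have : 0 ≤ r ^ η := Real.rpow_nonneg (le_of_lt hr) _
    rw [norm_mul, norm_mul, norm_mul, norm_div, norm_pow, norm_mul, he, hf,
      Complex.norm_exp_ofReal_mul_I, Complex.norm_exp_ofReal_mul_I, Complex.norm_exp,
      Complex.re_ofReal_mul, Complex.exp_ofReal_mul_I_re, Complex.norm_real,
      Real.norm_of_nonneg (by positivity), norm_neg, Complex.norm_real, Complex.norm_natCast,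
      Real.norm_eq_abs, mul_pow]
    ring_nf
  have hbs : ∀ r : ℝ, HasSum (fun n : ℕ => (|θ| * r ^ η) ^ n / n.factorial *
      Real.exp (-(-Real.cos φ * r))) (Real.exp (|θ| * r ^ η) * Real.exp (-(-Real.cos φ * r))) := by
    intro r
    have h := NormedSpace.exp_series_hasSum_exp' (𝕂 := ℝ) (|θ| * r ^ η)
    rw [← Real.exp_eq_exp_ℝ] at h
    refine (h.mul_right _).congr_fun fun n => ?_
    rw [smul_eq_mul]
    ring
  have hsum := hasSum_integral_of_dominated_convergence (μ := volume.restrict (Ioi (0 : ℝ)))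
    (F := fun (n : ℕ) (r : ℝ) => (-θ * f) ^ n / n.factorial * e *
      (((r ^ η) ^ n : ℝ) * Complex.exp (r * e)))
    (f := fun r => rayIntegrand η φ θ r)
    (fun n r => (|θ| * r ^ η) ^ n / n.factorial * Real.exp (-(-Real.cos φ * r)))
    (fun n => Measurable.aestronglyMeasurable (by fun_prop))
    (fun n => by
      filter_upwards [ae_restrict_mem measurableSet_Ioi] with r hr
      exact (hnorm n r hr).le)
    (ae_of_all _ fun r => (hbs r).summable)
    (by
      simp_rw [fun r => (hbs r).tsum_eq]
      exact integrableOn_exp_rpow_sub h0 h1 (by linarith))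
    (ae_of_all _ hexp)
  have him := Complex.hasSum_im hsum
  refine him.congr_fun fun n => ?_
  rw [integral_const_mul]
  have e2 : ∫ r in Ioi (0 : ℝ), (((r ^ η) ^ n : ℝ) : ℂ) * Complex.exp (r * e) =
      Real.Gamma (n * η + 1) * Complex.exp (((n * η + 1 : ℝ) : ℂ) * ((Real.pi - φ) * Complex.I)) := by
    rw [← integral_rpow_mul_cexp_ray (s := n * η + 1) (by positivity) hφ hφ']
    refine setIntegral_congr_fun measurableSet_Ioi fun r hr => ?_
    rw [add_sub_cancel_right, mul_comm (n : ℝ) η, Real.rpow_mul_natCast (le_of_lt hr)]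
  rw [e2]
  have e3 : (-θ * f) ^ n / n.factorial * e * (Real.Gamma (n * η + 1) *
      Complex.exp (((n * η + 1 : ℝ) : ℂ) * ((Real.pi - φ) * Complex.I))) =
      (((-θ) ^ n / n.factorial * Real.Gamma (n * η + 1) : ℝ) : ℂ) *
        Complex.exp (((n * Real.pi * η + Real.pi : ℝ) : ℂ) * Complex.I) := by
    have : Complex.exp (((n * Real.pi * η + Real.pi : ℝ) : ℂ) * Complex.I) =
        f ^ n * e * Complex.exp (((n * η + 1 : ℝ) : ℂ) * ((Real.pi - φ) * Complex.I)) := by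
      rw [hf, he, ← Complex.exp_nat_mul, ← Complex.exp_add, ← Complex.exp_add]
      congr 1
      push_cast
      ring
    rw [this, mul_pow]
    push_cast
    ring
  rw [e3, Complex.im_ofReal_mul, Complex.exp_ofReal_mul_I_im, Real.sin_add_pi]
  ring

/-- Contour representation of `θ ξ_η(θ)`. -/
theorem mul_xi_eq_im_integral {η φ : ℝ} (h0 : 0 < η) (h1 : η < 1)
    (hφ : Real.pi / 2 < φ) (hφ' : φ < Real.pi) {θ : ℝ} (hθ : 0 < θ) :
    θ * xi η θ = 1 / (Real.pi * η) * (∫ r in Ioi (0 : ℝ), rayIntegrand η φ θ r).im := by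
  have h := hasSum_im_integral_rayIntegrand h0 h1 hφ hφ' θ
  -- the term `n = 0` vanishes; the series for `ϖ_η` starts at `n = 1`
  have h2 := (hasSum_nat_add_iff' 1).mpr h
  simp only [Finset.range_one, Finset.sum_singleton, Nat.cast_zero, zero_mul, Real.sin_zero,
    mul_zero, sub_zero] at h2
  rw [← h2.tsum_eq, xi, stableDensity, ← tsum_mul_left, ← tsum_mul_left, ← tsum_mul_left,
    ← tsum_mul_left]
  refine tsum_congr fun k => ?_
  have e1 : (θ ^ (-(1 / η))) ^ (-((k + 1 : ℕ) : ℝ) * η - 1) = θ ^ (k + 1) * θ ^ (1 / η) := by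
    rw [← Real.rpow_mul hθ.le, ← Real.rpow_natCast, ← Real.rpow_add hθ]
    congr 1
    field_simp
    ring
  have e2 : θ * θ ^ (-1 - 1 / η) * θ ^ (1 / η) = 1 := by
    rw [← Real.rpow_one_add' hθ.le, ← Real.rpow_add hθ]
    · ring_nf
      simp
    · have : 0 < 1 / η := by positivity
      intro h
      linarith
  rw [e1]
  have e3 : -(-θ) ^ (k + 1) = (-1) ^ k * θ ^ (k + 1) := by
    rw [neg_pow θ, pow_succ (-1 : ℝ)]
    ring
  rw [e3]
  generalize θ ^ (-1 - 1 / η) = A at e2 ⊢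
  generalize θ ^ (1 / η) = A' at e2 ⊢
  generalize Real.Gamma (((k + 1 : ℕ) : ℝ) * η + 1) = g
  generalize Real.sin (((k + 1 : ℕ) : ℝ) * Real.pi * η) = s
  have hπ := Real.pi_ne_zero
  have hk : ((k + 1).factorial : ℝ) ≠ 0 := by positivity
  field_simp
  linear_combination (g * s) * e2

/-! ### First moment and sign of `ξ_η` -/

/-- Rays of such an argument `φ` lie in the half-plane where `e^ζ` decays, while `ζ ↦ e^{-θ ζ^η}`
still decays along them. -/
lemma exists_ray_angle {η : ℝ} (h0 : 0 < η) (h1 : η < 1) :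
    ∃ φ : ℝ, Real.pi / 2 < φ ∧ φ < Real.pi ∧ η * φ < Real.pi / 2 := by
  have hp := Real.pi_pos
  refine ⟨Real.pi / 2 * (1 + (1 - η) / 2), ?_, ?_, ?_⟩
  · nlinarith
  · nlinarith
  · have : η * (1 + (1 - η) / 2) < 1 := by nlinarith [sq_nonneg (1 - η)]
    nlinarith

lemma measurable_rayIntegrand (η φ : ℝ) :
    Measurable fun x : ℝ × ℝ => rayIntegrand η φ x.2 x.1 := by
  unfold rayIntegrand
  fun_prop

lemma cos_ray_pos {η φ : ℝ} (h0 : 0 < η) (hφ : Real.pi / 2 < φ) (h : η * φ < Real.pi / 2) :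
    0 < Real.cos (η * φ) := by
  have hp := Real.pi_pos
  refine Real.cos_pos_of_mem_Ioo ⟨?_, h⟩
  have : 0 < η * φ := mul_pos h0 (by linarith)
  linarith

/-- Integrating the norm over `θ` first leaves a Gamma integrand in `r`. -/
lemma integrable_rayIntegrand_prod {η φ : ℝ} (h0 : 0 < η) (h1 : η < 1)
    (hφ : Real.pi / 2 < φ) (hφ' : φ < Real.pi) (hηφ : η * φ < Real.pi / 2) :
    Integrable (fun x : ℝ × ℝ => rayIntegrand η φ x.2 x.1)
      ((volume.restrict (Ioi 0)).prod (volume.restrict (Ioi 0))) := by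
  have hcos : Real.cos φ < 0 :=
    Real.cos_neg_of_pi_div_two_lt_of_lt hφ (by linarith [Real.pi_pos])
  have hcos' := cos_ray_pos h0 hφ hηφ
  have hrate : ∀ r ∈ Ioi (0 : ℝ), 0 < r ^ η * Real.cos (η * φ) := fun r hr =>
    mul_pos (Real.rpow_pos_of_pos hr _) hcos'
  have hform : ∀ θ r, ‖rayIntegrand η φ θ r‖ =
      Real.exp (r * Real.cos φ) * Real.exp (-(r ^ η * Real.cos (η * φ)) * θ) := by
    intro θ r
    rw [norm_rayIntegrand]
    ring_nf
  rw [integrable_prod_iff (measurable_rayIntegrand η φ).aestronglyMeasurable]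
  constructor
  · filter_upwards [ae_restrict_mem measurableSet_Ioi] with r hr
    refine Integrable.mono' ((integrableOn_exp_mul_Ioi (a := -(r ^ η * Real.cos (η * φ)))
      (by linarith [hrate r hr]) 0).const_mul (Real.exp (r * Real.cos φ)))
      ((measurable_rayIntegrand η φ).comp measurable_prodMk_left).aestronglyMeasurable
      (ae_of_all _ fun θ => (hform θ r).le)
  · have h := (integrableOn_rpow_mul_exp_neg (s := 1 - η) (c := -Real.cos φ) (by linarith)
      (by linarith)).mul_const (Real.cos (η * φ))⁻¹
    refine h.congr ?_
    filter_upwards [ae_restrict_mem measurableSet_Ioi] with r hr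
    simp_rw [hform]
    rw [integral_const_mul, integral_exp_mul_Ioi (by linarith [hrate r hr])]
    have e1 : (1 : ℝ) - η - 1 = -η := by ring
    rw [e1, Real.rpow_neg (le_of_lt hr), mul_zero, Real.exp_zero]
    have e2 : -(-Real.cos φ * r) = r * Real.cos φ := by ring
    rw [e2]
    have := (Real.rpow_pos_of_pos (show 0 < r from hr) η).ne'
    field_simp

lemma integral_rayIntegrand_theta {η φ r : ℝ} (h0 : 0 < η)
    (hφ : Real.pi / 2 < φ) (hηφ : η * φ < Real.pi / 2) (hr : 0 < r) :
    ∫ θ in Ioi (0 : ℝ), rayIntegrand η φ θ r =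
      Complex.exp ((((1 - η) * φ : ℝ) : ℂ) * Complex.I) *
      (((r ^ ((1 - η) - 1) : ℝ) : ℂ) * Complex.exp (r * Complex.exp (φ * Complex.I))) := by
  have hcos' := cos_ray_pos h0 hφ hηφ
  have hrη := Real.rpow_pos_of_pos hr η
  set w : ℂ := (r ^ η : ℝ) * Complex.exp ((η * φ : ℝ) * Complex.I) with hw
  have hwre : (-w).re < 0 := by
    rw [hw, Complex.neg_re, Complex.re_ofReal_mul, Complex.exp_ofReal_mul_I_re]
    have := mul_pos hrη hcos'
    linarith
  have h : ∀ θ : ℝ, rayIntegrand η φ θ r = Complex.exp (r * Complex.exp (φ * Complex.I)) *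
      Complex.exp (φ * Complex.I) * Complex.exp (-w * θ) := by
    intro θ
    rw [rayIntegrand, sub_eq_add_neg, Complex.exp_add, hw]
    ring_nf
  simp_rw [h]
  rw [integral_const_mul, integral_exp_mul_complex_Ioi hwre]
  have e1 : (1 : ℝ) - η - 1 = -η := by ring
  rw [e1, Real.rpow_neg hr.le, hw]
  have e2 : Complex.exp (φ * Complex.I) = Complex.exp ((((1 - η) * φ : ℝ) : ℂ) * Complex.I) *
      Complex.exp ((η * φ : ℝ) * Complex.I) := by
    rw [← Complex.exp_add]
    congr 1
    push_cast
    ring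
  have e3 : ((r ^ η : ℝ) : ℂ) ≠ 0 := by exact_mod_cast hrη.ne'
  have e4 := Complex.exp_ne_zero ((η * φ : ℝ) * Complex.I)
  generalize Complex.exp (r * Complex.exp (φ * Complex.I)) = E
  rw [e2]
  simp only [Complex.ofReal_zero, mul_zero, Complex.exp_zero]
  push_cast at e3 e4 ⊢
  field_simp

/-- The first moment of `ξ_η` exists. -/
theorem integrableOn_mul_xi {η : ℝ} (h0 : 0 < η) (h1 : η < 1) :
    IntegrableOn (fun θ => θ * xi η θ) (Ioi 0) := by
  obtain ⟨φ, hφ, hφ', hηφ⟩ := exists_ray_angle h0 h1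
  have h := (integrable_rayIntegrand_prod h0 h1 hφ hφ' hηφ).integral_prod_right.im.const_mul
    (1 / (Real.pi * η))
  refine h.congr ?_
  filter_upwards [ae_restrict_mem measurableSet_Ioi] with θ hθ
  rw [mul_xi_eq_im_integral h0 h1 hφ hφ' hθ]
  rfl

/-- The first moment of `ξ_η` is `1 / Γ(1 + η)`. -/
theorem integral_mul_xi {η : ℝ} (h0 : 0 < η) (h1 : η < 1) :
    ∫ θ in Ioi (0 : ℝ), θ * xi η θ = 1 / Real.Gamma (1 + η) := by
  obtain ⟨φ, hφ, hφ', hηφ⟩ := exists_ray_angle h0 h1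
  have hI := integrable_rayIntegrand_prod h0 h1 hφ hφ' hηφ
  have e1 : ∫ θ in Ioi (0 : ℝ), θ * xi η θ = ∫ θ in Ioi (0 : ℝ), 1 / (Real.pi * η) *
      (∫ r in Ioi (0 : ℝ), rayIntegrand η φ θ r).im :=
    setIntegral_congr_fun measurableSet_Ioi fun θ hθ => mul_xi_eq_im_integral h0 h1 hφ hφ' hθ
  have e2 : ∫ θ in Ioi (0 : ℝ), (∫ r in Ioi (0 : ℝ), rayIntegrand η φ θ r).im =
      (∫ θ in Ioi (0 : ℝ), ∫ r in Ioi (0 : ℝ), rayIntegrand η φ θ r).im :=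
    integral_im (𝕜 := ℂ) hI.integral_prod_right
  have e3 : ∫ θ in Ioi (0 : ℝ), ∫ r in Ioi (0 : ℝ), rayIntegrand η φ θ r =
      ∫ r in Ioi (0 : ℝ), ∫ θ in Ioi (0 : ℝ), rayIntegrand η φ θ r :=
    integral_integral_swap (f := fun θ r => rayIntegrand η φ θ r) hI.swap
  have e4 : ∫ r in Ioi (0 : ℝ), ∫ θ in Ioi (0 : ℝ), rayIntegrand η φ θ r =
      ∫ r in Ioi (0 : ℝ), Complex.exp ((((1 - η) * φ : ℝ) : ℂ) * Complex.I) *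
      (((r ^ ((1 - η) - 1) : ℝ) : ℂ) * Complex.exp (r * Complex.exp (φ * Complex.I))) :=
    setIntegral_congr_fun measurableSet_Ioi fun r hr => integral_rayIntegrand_theta h0 hφ hηφ hr
  rw [e1, integral_const_mul, e2, e3, e4, integral_const_mul,
    integral_rpow_mul_cexp_ray (by linarith) hφ hφ']
  have e5 : Complex.exp ((((1 - η) * φ : ℝ) : ℂ) * Complex.I) * (Real.Gamma (1 - η) *
      Complex.exp (((1 - η : ℝ) : ℂ) * ((Real.pi - φ) * Complex.I))) =
      (Real.Gamma (1 - η) : ℂ) * Complex.exp (((Real.pi - Real.pi * η : ℝ) : ℂ) * Complex.I) := by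
    rw [mul_left_comm, ← Complex.exp_add]
    congr 2
    push_cast
    ring
  rw [e5, Complex.im_ofReal_mul, Complex.exp_ofReal_mul_I_im, Real.sin_pi_sub]
  have hG := Real.Gamma_mul_Gamma_one_sub η
  have hs : 0 < Real.sin (Real.pi * η) :=
    Real.sin_pos_of_pos_of_lt_pi (by positivity) (by nlinarith [Real.pi_pos])
  have hΓ := Real.Gamma_pos_of_pos h0
  rw [eq_div_iff hs.ne'] at hG
  rw [add_comm, Real.Gamma_add_one h0.ne']
  have hπ := Real.pi_ne_zero
  field_simp
  linarith

/-- Letting the ray tend to the imaginary axis, where the integral is a Fourier integral. -/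
lemma tendsto_integral_rayIntegrand {η φ θ : ℝ} (h0 : 0 < η)
    (hφ : Real.pi / 2 < φ) (hφ' : φ < Real.pi) (hηφ : η * φ < Real.pi / 2) (hθ : 0 < θ) :
    Tendsto (fun α => ∫ r in Ioi (0 : ℝ), rayIntegrand η α θ r) (𝓝[>] (Real.pi / 2))
      (𝓝 (∫ r in Ioi (0 : ℝ), rayIntegrand η (Real.pi / 2) θ r)) := by
  have hcos' := cos_ray_pos h0 hφ hηφ
  have hint : IntegrableOn (fun r : ℝ => Real.exp (-(θ * Real.cos (η * φ)) * r ^ η))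
      (Ioi 0) := by
    simpa using integrableOn_rpow_mul_exp_neg_mul_rpow (s := 0) (by norm_num) h0 (mul_pos hθ hcos')
  refine tendsto_integral_filter_of_dominated_convergence _ (Eventually.of_forall fun α =>
    ((measurable_rayIntegrand η α).comp measurable_prodMk_right).aestronglyMeasurable) ?_ hint ?_
  · filter_upwards [Ioo_mem_nhdsGT hφ] with α hα
    filter_upwards [ae_restrict_mem measurableSet_Ioi] with r hr
    rw [norm_rayIntegrand]
    have hr' : (0 : ℝ) < r := hr
    have h1 : Real.cos α ≤ 0 := Real.cos_nonpos_of_pi_div_two_le_of_le hα.1.le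
      (by linarith [hα.2, Real.pi_pos])
    have h2 : Real.cos (η * φ) ≤ Real.cos (η * α) := by
      refine Real.cos_le_cos_of_nonneg_of_le_pi ?_ (by linarith [Real.pi_pos])
        (mul_le_mul_of_nonneg_left hα.2.le h0.le)
      exact mul_nonneg h0.le (by linarith [hα.1, Real.pi_pos])
    have h3 : Real.exp (r * Real.cos α) ≤ 1 := Real.exp_le_one_iff.mpr
      (mul_nonpos_of_nonneg_of_nonpos hr'.le h1)
    refine (mul_le_of_le_one_left (Real.exp_pos _).le h3).trans (Real.exp_le_exp.mpr ?_)
    have := mul_le_mul_of_nonneg_left h2 (mul_nonneg hθ.le (Real.rpow_nonneg hr'.le η))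
    linarith
  · refine ae_of_all _ fun r => ?_
    have : Continuous fun α => rayIntegrand η α θ r := by
      unfold rayIntegrand
      fun_prop
    exact (this.tendsto _).mono_left nhdsWithin_le_nhds

/-- `ξ_η` is nonnegative on `(0, ∞)`. -/
theorem xi_nonneg {η θ : ℝ} (h0 : 0 < η) (h1 : η < 1) (hθ : 0 < θ) : 0 ≤ xi η θ := by
  obtain ⟨φ, hφ, hφ', hηφ⟩ := exists_ray_angle h0 h1
  have hlim := (Complex.continuous_im.tendsto _).comp
    (tendsto_integral_rayIntegrand h0 hφ hφ' hηφ hθ)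
  have hev : ∀ᶠ α in 𝓝[>] (Real.pi / 2),
      (Complex.im ∘ fun α => ∫ r in Ioi (0 : ℝ), rayIntegrand η α θ r) α =
        θ * xi η θ * (Real.pi * η) := by
    filter_upwards [Ioo_mem_nhdsGT hφ] with α hα
    rw [mul_xi_eq_im_integral h0 h1 hα.1 (hα.2.trans hφ') hθ, Function.comp]
    have := Real.pi_ne_zero
    field_simp
  have heq := tendsto_nhds_unique (tendsto_const_nhds.congr' (hev.mono fun _ h => h.symm)) hlim
  have hnn := re_integral_exp_neg_cpow_nonneg h0 h1 hθ
  have hI : ∫ r in Ioi (0 : ℝ), rayIntegrand η (Real.pi / 2) θ r =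
      (∫ r in Ioi (0 : ℝ), Complex.exp (r * Complex.I - θ * (r * Complex.I) ^ (η : ℂ))) *
        Complex.I := by
    rw [← integral_mul_const]
    refine setIntegral_congr_fun measurableSet_Ioi fun r hr => ?_
    have e1 : Complex.exp (((Real.pi / 2 : ℝ) : ℂ) * Complex.I) = Complex.I := by
      push_cast
      exact Complex.exp_pi_div_two_mul_I
    have e2 : (r * Complex.I : ℂ) ^ (η : ℂ) =
        (r ^ η : ℝ) * Complex.exp ((η * (Real.pi / 2) : ℝ) * Complex.I) := by
      rw [ofReal_mul_cpow hr Complex.I_ne_zero, Complex.cpow_def_of_ne_zero Complex.I_ne_zero,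
        Complex.log_I]
      congr 2
      push_cast
      ring
    simp only [rayIntegrand]
    rw [e1, e2]
  rw [hI, Complex.mul_I_im] at heq
  rw [← heq] at hnn
  have hp : 0 < θ * (Real.pi * η) := by positivity
  by_contra! hneg
  nlinarith

/-! ### The operators `T_η(t)` -/

section Semigroup

variable {Z : Type*} [NormedAddCommGroup Z] [NormedSpace ℝ Z] {T : ℝ → Z →L[ℝ] Z}

/-- Orbits of a bounded `C₀`-semigroup are continuous on `[0, ∞)`. -/
lemma IsC0Semigroup.continuousOn (hT : IsC0Semigroup T) {M : ℝ} (hM : ∀ t, 0 ≤ t → ‖T t‖ ≤ M)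
    (x : Z) : ContinuousOn (fun t => T t x) (Ici 0) := by
  have hM0 : 0 ≤ M := (norm_nonneg _).trans (hM 0 le_rfl)
  have key : ∀ s t : ℝ, 0 ≤ t → t ≤ s → ‖T s x - T t x‖ ≤ M * ‖T |s - t| x - x‖ := by
    intro s t ht hts
    have h : T s x = T t (T (s - t) x) := by
      have := hT.add t (s - t) ht (sub_nonneg.mpr hts)
      rw [add_sub_cancel] at this
      rw [this]
      rfl
    rw [h, ← map_sub, abs_of_nonneg (sub_nonneg.mpr hts)]
    exact (ContinuousLinearMap.le_opNorm _ _).trans (by gcongr; exact hM t ht)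
  have key' : ∀ s t : ℝ, 0 ≤ t → 0 ≤ s → ‖T s x - T t x‖ ≤ M * ‖T |s - t| x - x‖ := by
    intro s t ht hs
    rcases le_total t s with h | h
    · exact key s t ht h
    · rw [norm_sub_rev, abs_sub_comm]
      exact key t s hs h
  have hzero : Tendsto (fun h : ℝ => T |h| x) (𝓝 0) (𝓝 x) := by
    have h1 : Tendsto (fun t => T t x) (𝓝[≥] 0) (𝓝 x) := by
      rw [← Ioi_insert, nhdsWithin_insert]
      refine Tendsto.sup ?_ (hT.tendsto_zero x)
      rw [tendsto_pure_left]
      intro s hs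
      rw [hT.zero]
      exact mem_of_mem_nhds hs
    refine h1.comp (tendsto_nhdsWithin_iff.mpr ⟨?_, Eventually.of_forall fun h => abs_nonneg h⟩)
    simpa using (continuous_abs.tendsto (0 : ℝ))
  intro t ht
  rw [ContinuousWithinAt, tendsto_iff_norm_sub_tendsto_zero]
  have h2 : Tendsto (fun s => M * ‖T |s - t| x - x‖) (𝓝[Ici 0] t) (𝓝 0) := by
    have h3 : Tendsto (fun s : ℝ => s - t) (𝓝[Ici 0] t) (𝓝 0) := by
      have : Tendsto (fun s : ℝ => s - t) (𝓝 t) (𝓝 (t - t)) :=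
        (continuous_id.sub continuous_const).tendsto t
      rw [sub_self] at this
      exact this.mono_left nhdsWithin_le_nhds
    have h4 := ((hzero.comp h3).sub_const x).norm.const_mul M
    simpa using h4
  refine squeeze_zero' (Eventually.of_forall fun _ => norm_nonneg _) ?_ h2
  filter_upwards [self_mem_nhdsWithin] with s hs
  exact key' s t ht hs

variable {η M : ℝ}

lemma norm_subordination_le (hM : ∀ t, 0 ≤ t → ‖T t‖ ≤ M) (h0 : 0 < η) (h1 : η < 1)
    {t θ : ℝ} (ht : 0 ≤ t) (hθ : 0 < θ) (x : Z) :
    ‖(θ * xi η θ) • T (t ^ η * θ) x‖ ≤ θ * xi η θ * (M * ‖x‖) := by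
  rw [norm_smul, Real.norm_of_nonneg (mul_nonneg hθ.le (xi_nonneg h0 h1 hθ))]
  refine mul_le_mul_of_nonneg_left ?_ (mul_nonneg hθ.le (xi_nonneg h0 h1 hθ))
  refine (ContinuousLinearMap.le_opNorm _ _).trans ?_
  gcongr
  exact hM _ (mul_nonneg (Real.rpow_nonneg ht _) hθ.le)

lemma IsC0Semigroup.aestronglyMeasurable_subordination (hT : IsC0Semigroup T)
    (hM : ∀ t, 0 ≤ t → ‖T t‖ ≤ M) (h0 : 0 < η) (h1 : η < 1) {t : ℝ} (ht : 0 ≤ t) (x : Z) :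
    AEStronglyMeasurable (fun θ => (θ * xi η θ) • T (t ^ η * θ) x)
      (volume.restrict (Ioi 0)) := by
  refine (integrableOn_mul_xi h0 h1).aestronglyMeasurable.smul ?_
  refine ContinuousOn.aestronglyMeasurable ?_ measurableSet_Ioi
  refine (hT.continuousOn hM x).comp (by fun_prop) fun θ hθ => ?_
  exact mul_nonneg (Real.rpow_nonneg ht _) (le_of_lt hθ)

lemma IsC0Semigroup.integrableOn_subordination (hT : IsC0Semigroup T)
    (hM : ∀ t, 0 ≤ t → ‖T t‖ ≤ M) (h0 : 0 < η) (h1 : η < 1) {t : ℝ} (ht : 0 ≤ t) (x : Z) :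
    IntegrableOn (fun θ => (θ * xi η θ) • T (t ^ η * θ) x) (Ioi 0) := by
  refine ((integrableOn_mul_xi h0 h1).mul_const (M * ‖x‖)).mono'
    (hT.aestronglyMeasurable_subordination hM h0 h1 ht x) ?_
  filter_upwards [ae_restrict_mem measurableSet_Ioi] with θ hθ
  exact norm_subordination_le hM h0 h1 ht hθ x

lemma norm_fracSemigroup_le (hM : ∀ t, 0 ≤ t → ‖T t‖ ≤ M)
    (h0 : 0 < η) (h1 : η < 1) {t : ℝ} (ht : 0 ≤ t) (x : Z) :
    ‖fracSemigroup T η t x‖ ≤ M / Real.Gamma η * ‖x‖ := by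
  have hb : ‖∫ θ in Ioi (0 : ℝ), (θ * xi η θ) • T (t ^ η * θ) x‖ ≤
      ∫ θ in Ioi (0 : ℝ), θ * xi η θ * (M * ‖x‖) := by
    refine norm_integral_le_of_norm_le ((integrableOn_mul_xi h0 h1).mul_const _) ?_
    filter_upwards [ae_restrict_mem measurableSet_Ioi] with θ hθ
    exact norm_subordination_le hM h0 h1 ht hθ x
  rw [integral_mul_const, integral_mul_xi h0 h1] at hb
  rw [fracSemigroup, norm_smul, Real.norm_of_nonneg h0.le]
  refine (mul_le_mul_of_nonneg_left hb h0.le).trans (le_of_eq ?_)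
  rw [add_comm, Real.Gamma_add_one h0.ne']
  have := (Real.Gamma_pos_of_pos h0).ne'
  field_simp

lemma continuousOn_fracSemigroup (hT : IsC0Semigroup T) (hM : ∀ t, 0 ≤ t → ‖T t‖ ≤ M)
    (h0 : 0 < η) (h1 : η < 1) (x : Z) :
    ContinuousOn (fun t => fracSemigroup T η t x) (Ici 0) := by
  refine ContinuousOn.const_smul ?_ η
  refine continuousOn_of_dominated (bound := fun θ => θ * xi η θ * (M * ‖x‖))
    (fun t ht => hT.aestronglyMeasurable_subordination hM h0 h1 ht x) (fun t ht => ?_)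
    ((integrableOn_mul_xi h0 h1).mul_const _) ?_
  · filter_upwards [ae_restrict_mem measurableSet_Ioi] with θ hθ
    exact norm_subordination_le hM h0 h1 ht hθ x
  · filter_upwards [ae_restrict_mem measurableSet_Ioi] with θ hθ
    refine ContinuousOn.const_smul ?_ _
    refine (hT.continuousOn hM x).comp ?_ fun t ht =>
      mul_nonneg (Real.rpow_nonneg ht _) (le_of_lt hθ)
    exact ((Real.continuous_rpow_const h0.le).mul continuous_const).continuousOn

end Semigroup

namespace ImpulsiveSystem

variable {Z U : Type*} [NormedAddCommGroup Z] [NormedSpace ℝ Z]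
  [NormedAddCommGroup U] [NormedSpace ℝ U] (S : ImpulsiveSystem Z U)

lemma norm_T_le (t : ℝ) (ht : 0 ≤ t) : ‖S.T t‖ ≤ S.M :=
  le_csSup S.bounded ⟨t, ht, rfl⟩

lemma M_nonneg : 0 ≤ S.M := (norm_nonneg _).trans (S.norm_T_le 0 le_rfl)

/-- The operators `T_η(s)`, `s ≥ 0`, as continuous linear maps, extended by `T_η(0)` to `s < 0` so
that the family is strongly continuous on the whole line. -/
noncomputable def fracOp (s : ℝ) : Z →L[ℝ] Z :=
  LinearMap.mkContinuous
    { toFun := fun x => S.Tη (max s 0) x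
      map_add' := fun x y => by
        have h := fun x => S.semigroup.integrableOn_subordination S.norm_T_le S.η_pos S.η_lt_one
          (le_max_right s 0) x
        simp only [Tη, fracSemigroup, map_add, smul_add]
        rw [integral_add (h x) (h y), smul_add]
      map_smul' := fun c x => by
        simp only [Tη, fracSemigroup, map_smul, RingHom.id_apply]
        simp_rw [smul_comm _ c]
        rw [integral_smul, smul_comm] }
    (S.M / Real.Gamma S.η)
    fun x => norm_fracSemigroup_le S.norm_T_le S.η_pos S.η_lt_one (le_max_right s 0) x

lemma fracOp_apply {s : ℝ} (hs : 0 ≤ s) (x : Z) : S.fracOp s x = S.Tη s x := by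
  simp [fracOp, max_eq_left hs]

lemma gammaBound_nonneg : 0 ≤ S.M / Real.Gamma S.η :=
  div_nonneg S.M_nonneg (Real.Gamma_pos_of_pos S.η_pos).le

lemma norm_fracOp_le (s : ℝ) : ‖S.fracOp s‖ ≤ S.M / Real.Gamma S.η :=
  LinearMap.mkContinuous_norm_le _ S.gammaBound_nonneg _

lemma continuous_fracOp (x : Z) : Continuous fun s => S.fracOp s x := by
  have h := (continuousOn_fracSemigroup S.semigroup S.norm_T_le S.η_pos S.η_lt_one x).comp_continuous
    (f := fun s : ℝ => max s 0) (by fun_prop) fun s => le_max_right s 0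
  exact h

lemma fracOp_zero [CompleteSpace Z] (x : Z) : S.fracOp 0 x = (Real.Gamma S.η)⁻¹ • x := by
  rw [S.fracOp_apply le_rfl, Tη, fracSemigroup]
  simp only [Real.zero_rpow S.η_pos.ne', zero_mul, S.semigroup.zero, ContinuousLinearMap.id_apply]
  rw [integral_smul_const, integral_mul_xi S.η_pos S.η_lt_one, smul_smul, add_comm,
    Real.Gamma_add_one S.η_pos.ne']
  congr 1
  have := S.η_pos.ne'
  field_simp

end ImpulsiveSystem

/-! ### The weakly singular kernel -/

lemma intervalIntegrable_kernel {η : ℝ} (h0 : 0 < η) (t a b : ℝ) :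
    IntervalIntegrable (fun σ => (t - σ) ^ (η - 1)) volume a b := by
  have h := (intervalIntegral.intervalIntegrable_rpow' (a := t - a) (b := t - b) (r := η - 1)
    (by linarith)).comp_sub_left t
  simpa using h

lemma integral_kernel {η : ℝ} (h0 : 0 < η) (t a : ℝ) :
    ∫ σ in a..t, (t - σ) ^ (η - 1) = (t - a) ^ η / η := by
  rw [intervalIntegral.integral_comp_sub_left (fun x => x ^ (η - 1)) t, integral_rpow
    (Or.inl (by linarith)), sub_self, sub_add_cancel, Real.zero_rpow h0.ne', sub_zero]

lemma holderConjugate_conj {q : ℝ} (hq : 1 < q) : (q / (q - 1)).HolderConjugate q :=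
  (Real.HolderConjugate.conjExponent hq).symm

lemma kernel_rpow {η q t σ : ℝ} (hσ : σ ≤ t) :
    ((t - σ) ^ (η - 1)) ^ q = (t - σ) ^ (((η - 1) * q + 1) - 1) := by
  rw [← Real.rpow_mul (sub_nonneg.mpr hσ), add_sub_cancel_right]

lemma conj_exponent_pos {η q : ℝ} (hq : 1 < q) (hqη : 1 < q * η) :
    (η - 1) * (q / (q - 1)) + 1 = (q * η - 1) / (q - 1) ∧ 0 < (q * η - 1) / (q - 1) := by
  have : q - 1 ≠ 0 := by linarith
  constructor
  · field_simp
    ring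
  · apply div_pos <;> linarith

lemma memLp_kernel {η q : ℝ} (hq : 1 < q) (hqη : 1 < q * η) (a t : ℝ) :
    MemLp (fun σ => (t - σ) ^ (η - 1)) (ENNReal.ofReal (q / (q - 1)))
      (volume.restrict (Ioc a t)) := by
  have hq' : 0 < q / (q - 1) := div_pos (by linarith) (by linarith)
  rw [← integrable_norm_rpow_iff (Measurable.aestronglyMeasurable (by fun_prop))
    (by simpa using hq') ENNReal.ofReal_ne_top, ENNReal.toReal_ofReal hq'.le]
  obtain ⟨e1, e2⟩ := conj_exponent_pos hq hqη
  have h := (intervalIntegrable_kernel (η := (q * η - 1) / (q - 1)) e2 t a t).1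
  refine IntegrableOn.congr_fun h (fun σ hσ => ?_) measurableSet_Ioc
  rw [Real.norm_of_nonneg (Real.rpow_nonneg (sub_nonneg.mpr hσ.2) _), kernel_rpow hσ.2, e1]

/-- The constant in the Hölder estimate for the kernel `(t - σ)^(η - 1)` against `L^q`. -/
noncomputable def holderConst (η q : ℝ) : ℝ := ((q - 1) / (q * η - 1)) ^ ((q - 1) / q)

lemma holderConst_nonneg {η q : ℝ} (hq : 1 < q) (hqη : 1 < q * η) : 0 ≤ holderConst η q :=
  Real.rpow_nonneg (div_nonneg (by linarith) (by linarith)) _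

section Holder

variable {Z : Type*} [NormedAddCommGroup Z] {f : ℝ → Z} {η q a t : ℝ}

lemma integrableOn_kernel_mul_norm (hq : 1 < q) (hqη : 1 < q * η)
    (hf : MemLp f (ENNReal.ofReal q) (volume.restrict (Ioc a t))) :
    IntegrableOn (fun σ => (t - σ) ^ (η - 1) * ‖f σ‖) (Ioc a t) := by
  have : (ENNReal.ofReal (q / (q - 1))).HolderConjugate (ENNReal.ofReal q) :=
    (holderConjugate_conj hq).ennrealOfReal
  exact (memLp_kernel hq hqη a t).integrable_mul hf.norm

/-- Hölder's inequality for the weakly singular kernel. -/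
lemma integral_kernel_mul_norm_le (hq : 1 < q) (hqη : 1 < q * η) (hat : a ≤ t)
    (hf : MemLp f (ENNReal.ofReal q) (volume.restrict (Ioc a t))) :
    ∫ σ in Ioc a t, (t - σ) ^ (η - 1) * ‖f σ‖ ≤ holderConst η q * (t - a) ^ (η - 1 / q) *
      (eLpNorm f (ENNReal.ofReal q) (volume.restrict (Ioc a t))).toReal := by
  have hq0 : 0 < q := by linarith
  have hker : 0 ≤ᵐ[volume.restrict (Ioc a t)] fun σ => (t - σ) ^ (η - 1) := by
    filter_upwards [ae_restrict_mem measurableSet_Ioc] with σ hσ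
    exact Real.rpow_nonneg (sub_nonneg.mpr hσ.2) _
  refine (integral_mul_le_Lp_mul_Lq_of_nonneg (holderConjugate_conj hq) hker
    (ae_of_all _ fun σ => norm_nonneg (f σ)) (memLp_kernel hq hqη a t) hf.norm).trans (le_of_eq ?_)
  obtain ⟨e1, e2⟩ := conj_exponent_pos hq hqη
  congr 1
  · have h : ∫ σ in Ioc a t, ((t - σ) ^ (η - 1)) ^ (q / (q - 1)) =
        (t - a) ^ ((q * η - 1) / (q - 1)) / ((q * η - 1) / (q - 1)) := by
      rw [← integral_kernel e2, intervalIntegral.integral_of_le hat]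
      refine setIntegral_congr_fun measurableSet_Ioc fun σ hσ => ?_
      rw [kernel_rpow hσ.2, e1]
    have hta : 0 ≤ t - a := sub_nonneg.mpr hat
    have hq1 : q - 1 ≠ 0 := by linarith
    have hq2 : q * η - 1 ≠ 0 := by linarith
    rw [h, div_eq_mul_inv, Real.mul_rpow (Real.rpow_nonneg hta _) (by positivity),
      ← Real.rpow_mul hta, mul_comm, holderConst, inv_div]
    congr 1
    · congr 1
      field_simp
    · congr 1
      field_simp
  · rw [hf.eLpNorm_eq_integral_rpow_norm (by simpa using hq0) ENNReal.ofReal_ne_top,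
      ENNReal.toReal_ofReal hq0.le, ENNReal.toReal_ofReal (by positivity), one_div]

end Holder

/-! ### Weakly singular Volterra operators -/

/-- A uniformly bounded, strongly continuous family of operators. -/
structure IsBoundedFamily {Z : Type*} [NormedAddCommGroup Z] [NormedSpace ℝ Z]
    (K : ℝ → Z →L[ℝ] Z) (C : ℝ) : Prop where
  cont : ∀ x, Continuous fun s => K s x
  bound : ∀ s, ‖K s‖ ≤ C

/-- Functions on `(p, e]` that are integrable and lie in `L^q` away from `p`. -/
structure IsForcing {Z : Type*} [NormedAddCommGroup Z] (q p e : ℝ) (f : ℝ → Z) : Prop where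
  int : IntegrableOn f (Ioc p e)
  memLp : ∀ p' ∈ Ioo p e, MemLp f (ENNReal.ofReal q) (volume.restrict (Ioc p' e))

/-- The operator `f ↦ ∫_p^t (t - σ)^(η - 1) K(t - σ) f(σ) dσ`. -/
noncomputable def volterra {Z : Type*} [NormedAddCommGroup Z] [NormedSpace ℝ Z]
    (η : ℝ) (K : ℝ → Z →L[ℝ] Z) (p : ℝ) (f : ℝ → Z) (t : ℝ) : Z :=
  ∫ σ in p..t, (t - σ) ^ (η - 1) • K (t - σ) (f σ)

section Volterra

variable {Z : Type*} [NormedAddCommGroup Z] {η q p e : ℝ} {f g : ℝ → Z}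

namespace IsForcing

lemma add (hf : IsForcing q p e f) (hg : IsForcing q p e g) :
    IsForcing q p e fun s => f s + g s :=
  ⟨hf.int.add hg.int, fun p' hp' => (hf.memLp p' hp').add (hg.memLp p' hp')⟩

lemma of_memLp (hq : 1 ≤ q) (hf : MemLp f (ENNReal.ofReal q) (volume.restrict (Ioc p e))) :
    IsForcing q p e f :=
  ⟨hf.integrable (by simpa using hq), fun p' hp' =>
    hf.mono_measure (Measure.restrict_mono (Ioc_subset_Ioc_left hp'.1.le) le_rfl)⟩

/-- Functions with an integrable power singularity at `p` are forcing terms. -/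
lemma of_norm_le_rpow {β D : ℝ} (hβ : 0 < β)
    (hf : AEStronglyMeasurable f (volume.restrict (Ioc p e)))
    (hD : ∀ s ∈ Ioc p e, ‖f s‖ ≤ D * (s - p) ^ (β - 1)) : IsForcing q p e f := by
  constructor
  · have h := ((intervalIntegral.intervalIntegrable_rpow' (a := p - p) (b := e - p) (r := β - 1)
      (by linarith)).comp_sub_right p).1
    simp only [sub_add_cancel] at h
    refine (h.const_mul D).mono' hf ?_
    filter_upwards [ae_restrict_mem measurableSet_Ioc] with s hs using hD s hs
  · intro p' hp'
    have hc : ContinuousOn (fun s => D * (s - p) ^ (β - 1)) (Icc p' e) := by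
      refine continuousOn_const.mul (ContinuousOn.rpow_const (by fun_prop) fun s hs => Or.inl ?_)
      have := hp'.1.trans_le hs.1
      linarith
    obtain ⟨B, hB⟩ := isCompact_Icc.exists_bound_of_continuousOn hc
    refine MemLp.of_bound (hf.mono_measure
      (Measure.restrict_mono (Ioc_subset_Ioc_left hp'.1.le) le_rfl)) B ?_
    filter_upwards [ae_restrict_mem measurableSet_Ioc] with s hs
    exact (hD s ⟨hp'.1.trans hs.1, hs.2⟩).trans
      ((le_abs_self _).trans (hB s ⟨hs.1.le, hs.2⟩))

end IsForcing

lemma integrableOn_kernel_mul_norm_of_isForcing (hη : η < 1) (hq : 1 < q) (hqη : 1 < q * η)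
    (hf : IsForcing q p e f) {t : ℝ} (ht : t ∈ Ioc p e) :
    IntegrableOn (fun σ => (t - σ) ^ (η - 1) * ‖f σ‖) (Ioc p t) := by
  obtain ⟨p', h1, h2⟩ := exists_between ht.1
  rw [← Ioc_union_Ioc_eq_Ioc h1.le h2.le]
  refine IntegrableOn.union ?_ ?_
  · have hfi : IntegrableOn (fun σ => ‖f σ‖) (Ioc p p') :=
      (hf.int.mono_set (Ioc_subset_Ioc_right (h2.le.trans ht.2))).norm
    refine hfi.bdd_mul (c := (t - p') ^ (η - 1)) (Measurable.aestronglyMeasurable (by fun_prop)) ?_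
    filter_upwards [ae_restrict_mem measurableSet_Ioc] with σ hσ
    rw [Real.norm_of_nonneg (Real.rpow_nonneg (by linarith [hσ.2]) _)]
    exact Real.rpow_le_rpow_of_nonpos (by linarith) (by linarith [hσ.2]) (by linarith)
  · exact integrableOn_kernel_mul_norm hq hqη ((hf.memLp p' ⟨h1, h2.trans_le ht.2⟩).mono_measure
      (Measure.restrict_mono (Ioc_subset_Ioc_right ht.2) le_rfl))

variable [NormedSpace ℝ Z] {K : ℝ → Z →L[ℝ] Z} {C : ℝ}

namespace IsBoundedFamily

lemma nonneg (hK : IsBoundedFamily K C) : 0 ≤ C := (norm_nonneg _).trans (hK.bound 0)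

lemma norm_apply_le (hK : IsBoundedFamily K C) (s : ℝ) (x : Z) : ‖K s x‖ ≤ C * ‖x‖ :=
  (K s).le_of_opNorm_le (hK.bound s) x

lemma continuous_uncurry (hK : IsBoundedFamily K C) : Continuous fun x : ℝ × Z => K x.1 x.2 := by
  rw [continuous_iff_continuousAt]
  rintro ⟨s, x⟩
  rw [ContinuousAt, tendsto_iff_norm_sub_tendsto_zero]
  have h : Tendsto (fun y : ℝ × Z => C * ‖y.2 - x‖ + ‖K y.1 x - K s x‖) (𝓝 (s, x)) (𝓝 0) := by
    have hc : Continuous fun y : ℝ × Z => C * ‖y.2 - x‖ + ‖K y.1 x - K s x‖ := by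
      have := (hK.cont x).comp (continuous_fst (X := ℝ) (Y := Z))
      exact (continuous_const.mul (continuous_snd.sub continuous_const).norm).add
        (this.sub continuous_const).norm
    simpa using hc.tendsto (s, x)
  refine squeeze_zero (fun _ => norm_nonneg _) (fun y => ?_) h
  have e1 : K y.1 y.2 - K s x = K y.1 (y.2 - x) + (K y.1 x - K s x) := by
    rw [map_sub]
    abel
  rw [e1]
  exact (norm_add_le _ _).trans (add_le_add_left (hK.norm_apply_le _ _) _)

lemma aestronglyMeasurable_apply (hK : IsBoundedFamily K C) {μ : Measure ℝ}
    (hf : AEStronglyMeasurable f μ) (t : ℝ) :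
    AEStronglyMeasurable (fun σ => K (t - σ) (f σ)) μ :=
  hK.continuous_uncurry.comp_aestronglyMeasurable
    ((Continuous.aestronglyMeasurable (by fun_prop : Continuous fun σ : ℝ => t - σ)).prodMk hf)

lemma aestronglyMeasurable_integrand (hK : IsBoundedFamily K C) {μ : Measure ℝ}
    (hf : AEStronglyMeasurable f μ) (η t : ℝ) :
    AEStronglyMeasurable (fun σ => (t - σ) ^ (η - 1) • K (t - σ) (f σ)) μ :=
  (Measurable.aestronglyMeasurable (by fun_prop)).smul (hK.aestronglyMeasurable_apply hf t)

lemma norm_integrand_le (hK : IsBoundedFamily K C) {t σ : ℝ} (hσ : σ ≤ t) (x : Z) :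
    ‖(t - σ) ^ (η - 1) • K (t - σ) x‖ ≤ C * ((t - σ) ^ (η - 1) * ‖x‖) := by
  have h := Real.rpow_nonneg (sub_nonneg.mpr hσ) (η - 1)
  rw [norm_smul, Real.norm_of_nonneg h, mul_left_comm]
  exact mul_le_mul_of_nonneg_left (hK.norm_apply_le _ _) h

lemma integrableOn_integrand (hK : IsBoundedFamily K C) (hη : η < 1) (hq : 1 < q) (hqη : 1 < q * η)
    (hf : IsForcing q p e f) {t : ℝ} (ht : t ∈ Ioc p e) :
    IntegrableOn (fun σ => (t - σ) ^ (η - 1) • K (t - σ) (f σ)) (Ioc p t) := by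
  refine ((integrableOn_kernel_mul_norm_of_isForcing hη hq hqη hf ht).const_mul C).mono'
    (hK.aestronglyMeasurable_integrand
      (hf.int.mono_set (Ioc_subset_Ioc_right ht.2)).aestronglyMeasurable η t) ?_
  filter_upwards [ae_restrict_mem measurableSet_Ioc] with σ hσ
  exact hK.norm_integrand_le hσ.2 _

lemma intervalIntegrable_integrand (hK : IsBoundedFamily K C) (hη : η < 1) (hq : 1 < q)
    (hqη : 1 < q * η) (hf : IsForcing q p e f) {t : ℝ} (ht : t ∈ Ioc p e) :
    IntervalIntegrable (fun σ => (t - σ) ^ (η - 1) • K (t - σ) (f σ)) volume p t :=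
  (intervalIntegrable_iff_integrableOn_Ioc_of_le ht.1.le).mpr
    (hK.integrableOn_integrand hη hq hqη hf ht)

lemma volterra_add (hK : IsBoundedFamily K C) (hη : η < 1) (hq : 1 < q)
    (hqη : 1 < q * η) (hf : IsForcing q p e f) (hg : IsForcing q p e g) {t : ℝ} (ht : t ∈ Ioc p e) :
    volterra η K p (fun s => f s + g s) t = volterra η K p f t + volterra η K p g t := by
  simp only [volterra, map_add, smul_add]
  exact intervalIntegral.integral_add (hK.intervalIntegrable_integrand hη hq hqη hf ht)
    (hK.intervalIntegrable_integrand hη hq hqη hg ht)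

lemma volterra_sub (hK : IsBoundedFamily K C) (hη : η < 1) (hq : 1 < q)
    (hqη : 1 < q * η) (hf : IsForcing q p e f) (hg : IsForcing q p e g) {t : ℝ} (ht : t ∈ Ioc p e) :
    volterra η K p (fun s => f s - g s) t = volterra η K p f t - volterra η K p g t := by
  simp only [volterra, map_sub, smul_sub]
  exact intervalIntegral.integral_sub (hK.intervalIntegrable_integrand hη hq hqη hf ht)
    (hK.intervalIntegrable_integrand hη hq hqη hg ht)

/-- Comparison with a scalar Volterra integral. -/
lemma norm_volterra_le (hK : IsBoundedFamily K C) {t : ℝ} (ht : p ≤ t) {G : ℝ → ℝ}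
    (hG : IntegrableOn (fun σ => (t - σ) ^ (η - 1) * G σ) (Ioc p t))
    (hle : ∀ᵐ σ ∂volume.restrict (Ioc p t), ‖f σ‖ ≤ G σ) :
    ‖volterra η K p f t‖ ≤ C * ∫ σ in Ioc p t, (t - σ) ^ (η - 1) * G σ := by
  rw [volterra, intervalIntegral.integral_of_le ht, ← integral_const_mul]
  refine norm_integral_le_of_norm_le (hG.const_mul C) ?_
  filter_upwards [hle, ae_restrict_mem measurableSet_Ioc] with σ hσ hmem
  refine (hK.norm_integrand_le hmem.2 _).trans ?_
  have := Real.rpow_nonneg (sub_nonneg.mpr hmem.2) (η - 1)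
  have := hK.nonneg
  gcongr

lemma norm_volterra_le_eLpNorm (hK : IsBoundedFamily K C) (hq : 1 < q) (hqη : 1 < q * η)
    {t : ℝ} (ht : p ≤ t) (hf : MemLp f (ENNReal.ofReal q) (volume.restrict (Ioc p t))) :
    ‖volterra η K p f t‖ ≤ C * (holderConst η q * (t - p) ^ (η - 1 / q) *
      (eLpNorm f (ENNReal.ofReal q) (volume.restrict (Ioc p t))).toReal) :=
  (hK.norm_volterra_le ht (integrableOn_kernel_mul_norm hq hqη hf)
    (ae_of_all _ fun _ => le_rfl)).trans
      (mul_le_mul_of_nonneg_left (integral_kernel_mul_norm_le hq hqη ht hf) hK.nonneg)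

end IsBoundedFamily

end Volterra

/-! ### Continuity of Volterra integrals -/

/-- A continuous regularization of `s ↦ s₊^(η - 1)`, equal to it for `s ≥ δ`. -/
noncomputable def regKernel (η δ s : ℝ) : ℝ := max s 0 * max s δ ^ (η - 2)

lemma continuous_regKernel (η : ℝ) {δ : ℝ} (hδ : 0 < δ) : Continuous (regKernel η δ) := by
  unfold regKernel
  refine (by fun_prop : Continuous fun s : ℝ => max s 0).mul ?_
  exact (by fun_prop : Continuous fun s : ℝ => max s δ).rpow_const fun s =>
    Or.inl (lt_max_of_lt_right hδ).ne'

lemma regKernel_of_nonpos {η δ s : ℝ} (hs : s ≤ 0) : regKernel η δ s = 0 := by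
  simp [regKernel, max_eq_right hs]

lemma regKernel_of_le {η δ s : ℝ} (hδ : 0 < δ) (hs : δ ≤ s) : regKernel η δ s = s ^ (η - 1) := by
  have : 0 < s := hδ.trans_le hs
  rw [regKernel, max_eq_left this.le, max_eq_left hs, mul_comm, ← Real.rpow_add_one this.ne']
  congr 1
  ring

lemma regKernel_nonneg {η δ s : ℝ} (hδ : 0 < δ) : 0 ≤ regKernel η δ s :=
  mul_nonneg (le_max_right _ _) (Real.rpow_nonneg (hδ.le.trans (le_max_right _ _)) _)

lemma regKernel_le {η δ s : ℝ} (hη : η < 1) (hδ : 0 < δ) : regKernel η δ s ≤ δ ^ (η - 1) := by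
  have hpos : 0 < max s δ := lt_max_of_lt_right hδ
  have h1 : regKernel η δ s ≤ max s δ * max s δ ^ (η - 2) :=
    mul_le_mul_of_nonneg_right (max_le_max le_rfl hδ.le) (Real.rpow_nonneg hpos.le _)
  refine h1.trans ?_
  rw [mul_comm, ← Real.rpow_add_one hpos.ne']
  have : η - 2 + 1 = η - 1 := by ring
  rw [this]
  exact Real.rpow_le_rpow_of_nonpos hδ (le_max_right _ _) (by linarith)

lemma regKernel_le_rpow {η δ s : ℝ} (hη : η < 1) (hs : 0 ≤ s) :
    regKernel η δ s ≤ s ^ (η - 1) := by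
  rcases hs.eq_or_lt with rfl | hs
  · rw [regKernel_of_nonpos le_rfl]
    exact Real.rpow_nonneg le_rfl _
  have h1 : max s δ ^ (η - 2) ≤ s ^ (η - 2) :=
    Real.rpow_le_rpow_of_nonpos hs (le_max_left _ _) (by linarith)
  rw [regKernel, max_eq_left hs.le]
  refine (mul_le_mul_of_nonneg_left h1 hs.le).trans (le_of_eq ?_)
  rw [mul_comm, ← Real.rpow_add_one hs.ne']
  congr 1
  ring

section Continuity

variable {Z : Type*} [NormedAddCommGroup Z] [NormedSpace ℝ Z] {K : ℝ → Z →L[ℝ] Z} {C : ℝ}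
  {η q p e : ℝ} {f : ℝ → Z}

namespace IsBoundedFamily

lemma continuous_regularized (hK : IsBoundedFamily K C) (hη : η < 1) (hf : IntegrableOn f (Ioc p e))
    {δ : ℝ} (hδ : 0 < δ) :
    Continuous fun t => ∫ σ in Ioc p e, regKernel η δ (t - σ) • K (t - σ) (f σ) := by
  have hk := continuous_regKernel η hδ
  refine continuous_of_dominated (bound := fun σ => δ ^ (η - 1) * (C * ‖f σ‖)) (fun t => ?_)
    (fun t => ae_of_all _ fun σ => ?_) ((hf.norm.const_mul C).const_mul _) (ae_of_all _ fun σ => ?_)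
  · exact (hk.comp (by fun_prop : Continuous fun σ : ℝ => t - σ)).aestronglyMeasurable.smul
      (hK.aestronglyMeasurable_apply hf.aestronglyMeasurable t)
  · rw [norm_smul, Real.norm_of_nonneg (regKernel_nonneg hδ)]
    exact mul_le_mul (regKernel_le hη hδ) (hK.norm_apply_le _ _) (norm_nonneg _)
      (Real.rpow_nonneg hδ.le _)
  · exact (hk.comp (by fun_prop : Continuous fun t : ℝ => t - σ)).smul
      ((hK.cont (f σ)).comp (by fun_prop : Continuous fun t : ℝ => t - σ))

lemma norm_volterra_sub_regularized_le (hK : IsBoundedFamily K C) (hη : η < 1) (hq : 1 < q)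
    (hqη : 1 < q * η) (hf : IsForcing q p e f) {p' t δ : ℝ} (hp' : p < p') (ht : t ≤ e)
    (hδ : 0 < δ) (hδt : p' ≤ t - δ) :
    ‖volterra η K p f t - ∫ σ in Ioc p e, regKernel η δ (t - σ) • K (t - σ) (f σ)‖ ≤
      C * (holderConst η q * δ ^ (η - 1 / q) *
        (eLpNorm f (ENNReal.ofReal q) (volume.restrict (Ioc p' e))).toReal) := by
  have hp't : p' < t := by linarith
  have htm : t ∈ Ioc p e := ⟨hp'.trans hp't, ht⟩
  have e1 : ∫ σ in Ioc p e, regKernel η δ (t - σ) • K (t - σ) (f σ) =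
      ∫ σ in Ioc p t, regKernel η δ (t - σ) • K (t - σ) (f σ) := by
    refine (setIntegral_eq_of_subset_of_forall_sdiff_eq_zero measurableSet_Ioc
      (Ioc_subset_Ioc_right ht) fun σ hσ => ?_)
    have : t < σ := by
      by_contra! h
      exact hσ.2 ⟨hσ.1.1, h⟩
    rw [regKernel_of_nonpos (by linarith), zero_smul]
  have hi1 := hK.integrableOn_integrand hη hq hqη hf htm
  have hi2 : IntegrableOn (fun σ => regKernel η δ (t - σ) • K (t - σ) (f σ)) (Ioc p t) := by
    have hfi := hf.int.mono_set (Ioc_subset_Ioc_right ht)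
    refine ((hfi.norm.const_mul C).const_mul (δ ^ (η - 1))).mono' ?_ (ae_of_all _ fun σ => ?_)
    · exact ((continuous_regKernel η hδ).comp
        (by fun_prop : Continuous fun σ : ℝ => t - σ)).aestronglyMeasurable.smul
        (hK.aestronglyMeasurable_apply hfi.aestronglyMeasurable t)
    · rw [norm_smul, Real.norm_of_nonneg (regKernel_nonneg hδ)]
      exact mul_le_mul (regKernel_le hη hδ) (hK.norm_apply_le _ _) (norm_nonneg _)
        (Real.rpow_nonneg hδ.le _)
  rw [e1, volterra, intervalIntegral.integral_of_le htm.1.le, ← integral_sub hi1 hi2]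
  have e2 : ∫ σ in Ioc p t, ((t - σ) ^ (η - 1) • K (t - σ) (f σ) -
      regKernel η δ (t - σ) • K (t - σ) (f σ)) =
      ∫ σ in Ioc (t - δ) t, ((t - σ) ^ (η - 1) • K (t - σ) (f σ) -
      regKernel η δ (t - σ) • K (t - σ) (f σ)) := by
    refine setIntegral_eq_of_subset_of_forall_sdiff_eq_zero measurableSet_Ioc
      (Ioc_subset_Ioc_left (by linarith)) fun σ hσ => ?_
    have : σ ≤ t - δ := by
      by_contra! h
      exact hσ.2 ⟨h, hσ.1.2⟩
    rw [regKernel_of_le hδ (by linarith), sub_self]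
  have hf' : MemLp f (ENNReal.ofReal q) (volume.restrict (Ioc p' e)) :=
    hf.memLp p' ⟨hp', hp't.trans_le ht⟩
  have hle : volume.restrict (Ioc (t - δ) t) ≤ volume.restrict (Ioc p' e) :=
    Measure.restrict_mono (Ioc_subset_Ioc hδt ht) le_rfl
  have hf'' := hf'.mono_measure hle
  have hh := integral_kernel_mul_norm_le hq hqη (by linarith : t - δ ≤ t) hf''
  rw [sub_sub_cancel] at hh
  rw [e2]
  refine (norm_integral_le_of_norm_le ((integrableOn_kernel_mul_norm hq hqη hf'').const_mul C)
    (g := fun σ => C * ((t - σ) ^ (η - 1) * ‖f σ‖)) ?_).trans ?_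
  · filter_upwards [ae_restrict_mem measurableSet_Ioc] with σ hσ
    have hnn : 0 ≤ t - σ := by linarith [hσ.2]
    rw [← sub_smul, norm_smul, Real.norm_of_nonneg (by linarith [regKernel_le_rpow (δ := δ) hη hnn]),
      mul_left_comm]
    refine mul_le_mul (by linarith [regKernel_nonneg (η := η) (s := t - σ) hδ])
      (hK.norm_apply_le _ _) (norm_nonneg _) (Real.rpow_nonneg hnn _)
  · rw [integral_const_mul]
    refine mul_le_mul_of_nonneg_left (hh.trans ?_) hK.nonneg
    refine mul_le_mul_of_nonneg_left ?_
      (mul_nonneg (holderConst_nonneg hq hqη) (Real.rpow_nonneg hδ.le _))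
    exact ENNReal.toReal_mono hf'.eLpNorm_ne_top (eLpNorm_mono_measure _ hle)

/-- Weakly singular Volterra integrals are continuous: they are locally uniform limits of the
regularized ones. -/
theorem continuousOn_volterra (hK : IsBoundedFamily K C) (hη : η < 1) (hq : 1 < q)
    (hqη : 1 < q * η) (hf : IsForcing q p e f) : ContinuousOn (volterra η K p f) (Ioc p e) := by
  have hq0 : 0 < q := by linarith
  have hexp : 0 < η - 1 / q := by
    rw [sub_pos, div_lt_iff₀ hq0]
    linarith
  have hloc : TendstoLocallyUniformlyOn
      (fun δ t => ∫ σ in Ioc p e, regKernel η δ (t - σ) • K (t - σ) (f σ))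
      (volterra η K p f) (𝓝[>] 0) (Ioc p e) := by
    rw [Metric.tendstoLocallyUniformlyOn_iff]
    intro ε hε t₀ ht₀
    obtain ⟨p', hp1, hp2⟩ := exists_between ht₀.1
    obtain ⟨p'', hp3, hp4⟩ := exists_between hp2
    refine ⟨Ioc p'' e, ?_, ?_⟩
    · have : Ioi p'' ∩ Ioc p e ∈ 𝓝[Ioc p e] t₀ :=
        inter_mem (mem_nhdsWithin_of_mem_nhds (Ioi_mem_nhds hp4)) self_mem_nhdsWithin
      exact mem_of_superset this fun t ht => ⟨ht.1, ht.2.2⟩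
    · have hlim : Tendsto (fun δ : ℝ => C * (holderConst η q * δ ^ (η - 1 / q) *
          (eLpNorm f (ENNReal.ofReal q) (volume.restrict (Ioc p' e))).toReal)) (𝓝[>] 0) (𝓝 0) := by
        have h1 : Tendsto (fun δ : ℝ => δ ^ (η - 1 / q)) (𝓝 0) (𝓝 0) := by
          have := (Real.continuous_rpow_const hexp.le).tendsto 0
          rwa [Real.zero_rpow hexp.ne'] at this
        have h2 := ((((h1.mono_left (nhdsWithin_le_nhds (s := Ioi 0))).const_mul
          (holderConst η q)).mul_const
          (eLpNorm f (ENNReal.ofReal q) (volume.restrict (Ioc p' e))).toReal).const_mul C)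
        simpa using h2
      filter_upwards [hlim.eventually (gt_mem_nhds hε),
        Ioo_mem_nhdsGT (show (0 : ℝ) < p'' - p' by linarith)] with δ hδ1 hδ2 t ht
      rw [dist_eq_norm]
      refine (hK.norm_volterra_sub_regularized_le hη hq hqη hf hp1 ht.2 hδ2.1 ?_).trans_lt hδ1
      linarith [ht.1, hδ2.2]
  refine hloc.continuousOn (Eventually.frequently ?_)
  filter_upwards [self_mem_nhdsWithin] with δ hδ
  exact (hK.continuous_regularized hη hf.int hδ).continuousOn

end IsBoundedFamily

end Continuity

/-! ### Beta integrals and the Mittag-Leffler function -/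

/-- The Beta integral on `[p, t]`. -/
lemma integral_kernel_mul_rpow {α β p t : ℝ} (hα : 0 < α) (hβ : 0 < β) (hpt : p < t) :
    ∫ σ in Ioc p t, (t - σ) ^ (α - 1) * (σ - p) ^ (β - 1) =
      (t - p) ^ (α + β - 1) * (Real.Gamma α * Real.Gamma β / Real.Gamma (α + β)) := by
  have ha : 0 < t - p := sub_pos.mpr hpt
  have h1 : ∫ σ in Ioc p t, (t - σ) ^ (α - 1) * (σ - p) ^ (β - 1) =
      ∫ x in (0 : ℝ)..(t - p), x ^ (β - 1) * (t - p - x) ^ (α - 1) := by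
    have := intervalIntegral.integral_comp_sub_right (a := p) (b := t)
      (fun x => x ^ (β - 1) * (t - p - x) ^ (α - 1)) p
    rw [sub_self] at this
    rw [← this, intervalIntegral.integral_of_le hpt.le]
    refine setIntegral_congr_fun measurableSet_Ioc fun σ _ => ?_
    rw [mul_comm, sub_sub_sub_cancel_right]
  rw [h1]
  have h2 := Complex.betaIntegral_scaled (β : ℂ) (α : ℂ) ha
  have h3 := Complex.Gamma_mul_Gamma_eq_betaIntegral (s := (β : ℂ)) (t := (α : ℂ)) (by simpa)
    (by simpa)
  have h4 : ∫ x in (0 : ℝ)..(t - p), (x : ℂ) ^ ((β : ℂ) - 1) * (((t - p : ℝ) : ℂ) - x) ^ ((α : ℂ) - 1) =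
      ((∫ x in (0 : ℝ)..(t - p), x ^ (β - 1) * (t - p - x) ^ (α - 1) : ℝ) : ℂ) := by
    rw [← intervalIntegral.integral_ofReal]
    refine intervalIntegral.integral_congr fun x hx => ?_
    rw [uIcc_of_le ha.le] at hx
    rw [Complex.ofReal_mul, Complex.ofReal_cpow hx.1, Complex.ofReal_cpow (sub_nonneg.mpr hx.2)]
    push_cast
    rfl
  rw [h4] at h2
  rw [← Complex.ofReal_add, Complex.Gamma_ofReal, Complex.Gamma_ofReal, Complex.Gamma_ofReal] at h3
  have hΓ : Real.Gamma (β + α) ≠ 0 := (Real.Gamma_pos_of_pos (by linarith)).ne'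
  have h5 : (β : ℂ).betaIntegral α =
      ((Real.Gamma β * Real.Gamma α / Real.Gamma (β + α) : ℝ) : ℂ) := by
    have : (Real.Gamma (β + α) : ℂ) ≠ 0 := by exact_mod_cast hΓ
    push_cast
    field_simp
    rw [h3, mul_comm]
  have h6 : (((t - p : ℝ) : ℂ)) ^ ((β : ℂ) + α - 1) = (((t - p) ^ (β + α - 1) : ℝ) : ℂ) := by
    rw [Complex.ofReal_cpow ha.le]
    push_cast
    rfl
  rw [h5, h6, ← Complex.ofReal_mul] at h2
  rw [Complex.ofReal_inj.mp h2, add_comm β α, mul_comm (Real.Gamma β)]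

lemma integrableOn_kernel_mul_rpow {η β p t : ℝ} (h0 : 0 < η) (hη : η < 1) (hβ : 0 < β)
    (hpt : p < t) :
    IntegrableOn (fun σ => (t - σ) ^ (η - 1) * (σ - p) ^ (β - 1)) (Ioc p t) := by
  -- any exponent larger than `1 / η` would do
  have h1q : 1 < 2 / η := by rw [lt_div_iff₀ h0]; linarith
  have hqη : 1 < 2 / η * η := by rw [div_mul_cancel₀ _ h0.ne']; norm_num
  have hf : IsForcing (2 / η) p t fun σ => (σ - p) ^ (β - 1) :=
    IsForcing.of_norm_le_rpow (D := 1) hβ (Measurable.aestronglyMeasurable (by fun_prop))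
      fun s hs => by rw [Real.norm_of_nonneg (Real.rpow_nonneg (by linarith [hs.1]) _), one_mul]
  refine (integrableOn_kernel_mul_norm_of_isForcing hη h1q hqη hf ⟨hpt, le_rfl⟩).congr_fun
    (fun σ hσ => ?_) measurableSet_Ioc
  simp only
  rw [Real.norm_of_nonneg (Real.rpow_nonneg (by linarith [hσ.1]) _)]

/-- The terms of the Mittag-Leffler series. -/
noncomputable def mlTerm (η : ℝ) (i : ℕ) (x : ℝ) : ℝ := x ^ i / Real.Gamma (η * i + 1)

lemma mlTerm_nonneg {η x : ℝ} (h0 : 0 < η) (hx : 0 ≤ x) (i : ℕ) : 0 ≤ mlTerm η i x :=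
  div_nonneg (pow_nonneg hx _) (Real.Gamma_pos_of_pos (by positivity)).le

lemma mlTerm_le {η x y : ℝ} (h0 : 0 < η) (hx : 0 ≤ x) (hxy : x ≤ y) (i : ℕ) :
    mlTerm η i x ≤ mlTerm η i y :=
  div_le_div_of_nonneg_right (pow_le_pow_left₀ hx hxy _)
    (Real.Gamma_pos_of_pos (by positivity)).le

/-- `Γ(x + 1)` grows faster than every exponential. -/
lemma rpow_mul_exp_neg_le_Gamma {R x : ℝ} (hR : 0 < R) (hx : 0 ≤ x) :
    R ^ x * Real.exp (-R) ≤ Real.Gamma (x + 1) := by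
  rw [Real.Gamma_eq_integral (by linarith)]
  have hc := Real.GammaIntegral_convergent (s := x + 1) (by linarith)
  have h1 : R ^ x * Real.exp (-R) = ∫ t in Ioi R, Real.exp (-t) * R ^ x := by
    rw [integral_mul_const, integral_exp_neg_Ioi, mul_comm]
  rw [h1]
  refine (setIntegral_mono_on ((integrableOn_exp_neg_Ioi R).mul_const _)
    (hc.mono_set (Ioi_subset_Ioi hR.le)) measurableSet_Ioi fun t ht => ?_).trans
    (setIntegral_mono_set hc ?_ (Ioi_subset_Ioi hR.le).eventuallyLE)
  · have ht' : R < t := ht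
    rw [add_sub_cancel_right]
    gcongr
  · filter_upwards [ae_restrict_mem measurableSet_Ioi] with t ht
    exact mul_nonneg (Real.exp_pos _).le (Real.rpow_nonneg (le_of_lt ht) _)

lemma summable_mlTerm {η x : ℝ} (h0 : 0 < η) (hx : 0 ≤ x) : Summable fun i => mlTerm η i x := by
  -- with this choice `R ^ (η * i)` dominates `x ^ i` by the geometric factor `2 ^ i`
  set R : ℝ := (2 * (x + 1)) ^ (1 / η) with hR
  have hR0 : 0 < R := by positivity
  have hRη : R ^ η = 2 * (x + 1) := by
    rw [hR, ← Real.rpow_mul (by positivity), one_div_mul_cancel h0.ne', Real.rpow_one]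
  refine Summable.of_nonneg_of_le (fun i => mlTerm_nonneg h0 hx i) (fun i => ?_)
    ((summable_geometric_of_lt_one (r := 1 / 2) (by norm_num) (by norm_num)).mul_left
      (Real.exp R))
  have hG := rpow_mul_exp_neg_le_Gamma hR0 (by positivity : 0 ≤ η * i)
  rw [Real.rpow_mul hR0.le, hRη, Real.rpow_natCast] at hG
  rw [mlTerm, div_le_iff₀ (Real.Gamma_pos_of_pos (by positivity))]
  calc x ^ i ≤ (x + 1) ^ i := pow_le_pow_left₀ hx (by linarith) _
    _ = Real.exp R * (1 / 2) ^ i * ((2 * (x + 1)) ^ i * Real.exp (-R)) := by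
      have : Real.exp R * Real.exp (-R) = 1 := by rw [← Real.exp_add]; simp
      rw [mul_pow (2 : ℝ), one_div, inv_pow]
      field_simp
      linarith
    _ ≤ _ := by gcongr

lemma mittagLeffler_mono {η x y : ℝ} (h0 : 0 < η) (hx : 0 ≤ x) (hxy : x ≤ y) :
    mittagLeffler η x ≤ mittagLeffler η y :=
  (summable_mlTerm h0 hx).tsum_le_tsum (mlTerm_le h0 hx hxy) (summable_mlTerm h0 (hx.trans hxy))

lemma mittagLeffler_nonneg {η x : ℝ} (h0 : 0 < η) (hx : 0 ≤ x) : 0 ≤ mittagLeffler η x :=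
  tsum_nonneg fun i => mlTerm_nonneg h0 hx i

section Gronwall

variable {η b p t : ℝ}

lemma mlTerm_comp (η b : ℝ) (i : ℕ) {x : ℝ} (hx : 0 ≤ x) :
    mlTerm η i (b * x ^ η) = b ^ i / Real.Gamma (η * i + 1) * x ^ ((η * i + 1) - 1) := by
  rw [mlTerm, mul_pow, ← Real.rpow_mul_natCast hx, add_sub_cancel_right]
  ring

lemma integrableOn_kernel_mul_mlTerm (h0 : 0 < η) (hη : η < 1) (hpt : p < t) (i : ℕ) :
    IntegrableOn (fun σ => (t - σ) ^ (η - 1) * mlTerm η i (b * (σ - p) ^ η)) (Ioc p t) := by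
  have h := (integrableOn_kernel_mul_rpow (p := p) (t := t) (β := η * i + 1) h0 hη (by positivity)
    hpt).const_mul (b ^ i / Real.Gamma (η * i + 1))
  refine IntegrableOn.congr_fun h (fun σ hσ => ?_) measurableSet_Ioc
  rw [mlTerm_comp η b i (by linarith [hσ.1])]
  ring

/-- The fractional integral shifts the terms of the Mittag-Leffler series. -/
lemma integral_kernel_mul_mlTerm (h0 : 0 < η) (hpt : p < t) (i : ℕ) :
    b / Real.Gamma η * ∫ σ in Ioc p t, (t - σ) ^ (η - 1) * mlTerm η i (b * (σ - p) ^ η) =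
      mlTerm η (i + 1) (b * (t - p) ^ η) := by
  have h1 : ∫ σ in Ioc p t, (t - σ) ^ (η - 1) * mlTerm η i (b * (σ - p) ^ η) =
      ∫ σ in Ioc p t, b ^ i / Real.Gamma (η * i + 1) *
        ((t - σ) ^ (η - 1) * (σ - p) ^ ((η * i + 1) - 1)) := by
    refine setIntegral_congr_fun measurableSet_Ioc fun σ hσ => ?_
    rw [mlTerm_comp η b i (by linarith [hσ.1])]
    ring
  rw [h1, integral_const_mul, integral_kernel_mul_rpow h0 (by positivity) hpt,
    mlTerm_comp η b (i + 1) (by linarith)]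
  have e1 : η + (η * i + 1) = η * ((i + 1 : ℕ) : ℝ) + 1 := by
    push_cast
    ring
  rw [e1]
  have h2 := (Real.Gamma_pos_of_pos h0).ne'
  have h3 : Real.Gamma (η * i + 1) ≠ 0 := (Real.Gamma_pos_of_pos (by positivity)).ne'
  field_simp
  ring

/-- The Gronwall inequality for the weakly singular kernel: iterating the hypothesis `n` times leaves
a partial sum of the Mittag-Leffler series and `W` times its next term. -/
theorem le_mul_mittagLeffler {e A W : ℝ} {w : ℝ → ℝ} (h0 : 0 < η) (hη : η < 1) (hb : 0 ≤ b)
    (hw0 : ∀ s ∈ Ioc p e, 0 ≤ w s) (hW : ∀ s ∈ Ioc p e, w s ≤ W)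
    (h : ∀ t ∈ Ioc p e, w t ≤ A + b / Real.Gamma η * ∫ σ in Ioc p t, (t - σ) ^ (η - 1) * w σ)
    {t : ℝ} (ht : t ∈ Ioc p e) : w t ≤ A * mittagLeffler η (b * (t - p) ^ η) := by
  have hΓ := Real.Gamma_pos_of_pos h0
  have key : ∀ n : ℕ, ∀ t ∈ Ioc p e, w t ≤
      A * ∑ i ∈ Finset.range n, mlTerm η i (b * (t - p) ^ η) + W * mlTerm η n (b * (t - p) ^ η) := by
    intro n
    induction n with
    | zero =>
      intro t ht
      simpa [mlTerm] using hW t ht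
    | succ n ih =>
      intro t ht
      have hInt : ∀ i, IntegrableOn (fun σ => (t - σ) ^ (η - 1) * mlTerm η i (b * (σ - p) ^ η))
        (Ioc p t) := fun i => integrableOn_kernel_mul_mlTerm h0 hη ht.1 i
      have hsum : IntegrableOn (fun σ => ∑ i ∈ Finset.range n,
          (t - σ) ^ (η - 1) * mlTerm η i (b * (σ - p) ^ η)) (Ioc p t) :=
        integrable_finsetSum _ fun i _ => hInt i
      have hmaj : IntegrableOn (fun σ => A * ∑ i ∈ Finset.range n,
          (t - σ) ^ (η - 1) * mlTerm η i (b * (σ - p) ^ η) +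
          W * ((t - σ) ^ (η - 1) * mlTerm η n (b * (σ - p) ^ η))) (Ioc p t) :=
        (hsum.const_mul A).add ((hInt n).const_mul W)
      have hle : ∫ σ in Ioc p t, (t - σ) ^ (η - 1) * w σ ≤ ∫ σ in Ioc p t, (A * ∑ i ∈ Finset.range n,
          (t - σ) ^ (η - 1) * mlTerm η i (b * (σ - p) ^ η) +
          W * ((t - σ) ^ (η - 1) * mlTerm η n (b * (σ - p) ^ η))) := by
        refine integral_mono_of_nonneg ?_ hmaj ?_
        · filter_upwards [ae_restrict_mem measurableSet_Ioc] with σ hσ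
          exact mul_nonneg (Real.rpow_nonneg (by linarith [hσ.2]) _) (hw0 σ ⟨hσ.1, hσ.2.trans ht.2⟩)
        · filter_upwards [ae_restrict_mem measurableSet_Ioc] with σ hσ
          have := mul_le_mul_of_nonneg_left (ih σ ⟨hσ.1, hσ.2.trans ht.2⟩)
            (Real.rpow_nonneg (by linarith [hσ.2] : 0 ≤ t - σ) (η - 1))
          refine this.trans (le_of_eq ?_)
          rw [← Finset.mul_sum]
          ring
      have h1 := h t ht
      have h2 := mul_le_mul_of_nonneg_left hle (div_nonneg hb hΓ.le)
      rw [integral_add (hsum.const_mul A) ((hInt n).const_mul W), integral_const_mul,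
        integral_const_mul, integral_finsetSum _ fun i _ => hInt i] at h2
      have e1 : b / Real.Gamma η * (A * ∑ i ∈ Finset.range n, (∫ σ in Ioc p t,
          (t - σ) ^ (η - 1) * mlTerm η i (b * (σ - p) ^ η)) +
          W * ∫ σ in Ioc p t, (t - σ) ^ (η - 1) * mlTerm η n (b * (σ - p) ^ η)) =
          A * ∑ i ∈ Finset.range n, mlTerm η (i + 1) (b * (t - p) ^ η) +
            W * mlTerm η (n + 1) (b * (t - p) ^ η) := by
        simp_rw [← integral_kernel_mul_mlTerm h0 ht.1, ← Finset.mul_sum]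
        ring
      rw [e1] at h2
      rw [Finset.sum_range_succ']
      have e2 : mlTerm η 0 (b * (t - p) ^ η) = 1 := by simp [mlTerm]
      rw [e2]
      linarith
  have hx : 0 ≤ b * (t - p) ^ η := mul_nonneg hb (Real.rpow_nonneg (by linarith [ht.1]) _)
  have hs := summable_mlTerm (η := η) h0 hx
  have hlim := (hs.hasSum.tendsto_sum_nat.const_mul A).add (hs.tendsto_atTop_zero.const_mul W)
  rw [mul_zero, add_zero] at hlim
  exact ge_of_tendsto' hlim fun n => key n t ht

end Gronwall

/-! ### The local fixed point problem -/

/-- Superposition with a Carathéodory function preserves measurability. -/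
lemma aestronglyMeasurable_superposition {Z : Type*} [NormedAddCommGroup Z] {μ : Measure ℝ}
    {H : ℝ → Z → Z} (hm : ∀ x, AEStronglyMeasurable (fun s => H s x) μ)
    (hc : ∀ᵐ s ∂μ, Continuous (H s)) {z : ℝ → Z} (hz : AEStronglyMeasurable z μ) :
    AEStronglyMeasurable (fun s => H s (z s)) μ := by
  have hsimple : ∀ g : SimpleFunc ℝ Z, AEStronglyMeasurable (fun s => H s (g s)) μ := by
    intro g
    have h : AEStronglyMeasurable
        (fun s => ∑ x ∈ g.range, (g ⁻¹' {x}).indicator (fun s => H s x) s) μ :=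
      Finset.aestronglyMeasurable_fun_sum _ fun x _ => (hm x).indicator (g.measurableSet_preimage _)
    refine h.congr (ae_of_all _ fun s => ?_)
    simp only
    rw [Finset.sum_eq_single (g s)]
    · simp
    · intro x _ hx
      rw [indicator_of_notMem]
      simpa using hx.symm
    · intro h
      exact absurd (g.mem_range_self s) h
  have hsm := hz.stronglyMeasurable_mk
  have hmk : AEStronglyMeasurable (fun s => H s (hz.mk z s)) μ := by
    refine aestronglyMeasurable_of_tendsto_ae atTop (fun n => hsimple (hsm.approx n)) ?_
    filter_upwards [hc] with s hs
    exact (hs.tendsto _).comp (hsm.tendsto_approx s)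
  refine hmk.congr ?_
  filter_upwards [hz.ae_eq_mk] with s hs
  rw [hs]

/-- Nonlinearities on `(p, e]` with a weighted Lipschitz bound. -/
structure IsWeightedLipschitz {Z : Type*} [NormedAddCommGroup Z] (η q p e κ : ℝ)
    (H : ℝ → Z → Z) : Prop where
  meas : ∀ x, AEStronglyMeasurable (fun s => H s x) (volume.restrict (Ioc p e))
  zero_memLp : MemLp (fun s => H s 0) (ENNReal.ofReal q) (volume.restrict (Ioc p e))
  lip : ∀ s ∈ Ioc p e, ∀ x y, ‖H s x - H s y‖ ≤ κ * (s - p) ^ (1 - η) * ‖x - y‖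
  nonneg : 0 ≤ κ

/-- Continuous functions on `(p, e]` that are `O((t - p)^(η - 1))`. -/
structure IsWeightedCont {Z : Type*} [NormedAddCommGroup Z] (η p e : ℝ) (z : ℝ → Z) : Prop where
  cont : ContinuousOn z (Ioc p e)
  bdd : ∃ B, ∀ s ∈ Ioc p e, (s - p) ^ (1 - η) * ‖z s‖ ≤ B

/-- Forcing terms whose Volterra integral is `O((t - p)^(η - 1))`. -/
structure IsAdmissible {Z : Type*} [NormedAddCommGroup Z] [NormedSpace ℝ Z] (η q p e : ℝ)
    (K : ℝ → Z →L[ℝ] Z) (f : ℝ → Z) : Prop where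
  forcing : IsForcing q p e f
  bdd : ∃ B, ∀ t ∈ Ioc p e, (t - p) ^ (1 - η) * ‖volterra η K p f t‖ ≤ B

section

variable {Z : Type*} [NormedAddCommGroup Z] {η q p e κ : ℝ} {H : ℝ → Z → Z} {z z₁ z₂ : ℝ → Z}

lemma rpow_weight_pos {s : ℝ} (hs : s ∈ Ioc p e) (x : ℝ) : 0 < (s - p) ^ x :=
  Real.rpow_pos_of_pos (sub_pos.mpr hs.1) _

lemma rpow_weight_le {s x : ℝ} (hx : 0 ≤ x) (hs : s ∈ Ioc p e) : (s - p) ^ x ≤ (e - p) ^ x :=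
  Real.rpow_le_rpow (by linarith [hs.1]) (by linarith [hs.2]) hx

lemma IsWeightedCont.sub (h₁ : IsWeightedCont η p e z₁) (h₂ : IsWeightedCont η p e z₂) :
    IsWeightedCont η p e fun s => z₁ s - z₂ s := by
  obtain ⟨B₁, hB₁⟩ := h₁.bdd
  obtain ⟨B₂, hB₂⟩ := h₂.bdd
  refine ⟨h₁.cont.sub h₂.cont, B₁ + B₂, fun s hs => ?_⟩
  have := mul_le_mul_of_nonneg_left (norm_sub_le (z₁ s) (z₂ s)) (rpow_weight_pos hs (1 - η)).le
  linarith [hB₁ s hs, hB₂ s hs]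

namespace IsWeightedLipschitz

lemma continuous (hH : IsWeightedLipschitz η q p e κ H) {s : ℝ} (hs : s ∈ Ioc p e) :
    Continuous (H s) := by
  have : LipschitzWith (Real.toNNReal (κ * (s - p) ^ (1 - η))) (H s) := by
    refine LipschitzWith.of_dist_le_mul fun x y => ?_
    rw [dist_eq_norm, dist_eq_norm, Real.coe_toNNReal _
      (mul_nonneg hH.nonneg (rpow_weight_pos hs _).le)]
    exact hH.lip s hs x y
  exact this.continuous

lemma aestronglyMeasurable (hH : IsWeightedLipschitz η q p e κ H)
    (hz : IsWeightedCont η p e z) :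
    AEStronglyMeasurable (fun s => H s (z s)) (volume.restrict (Ioc p e)) := by
  refine aestronglyMeasurable_superposition hH.meas ?_
    (hz.cont.aestronglyMeasurable measurableSet_Ioc)
  filter_upwards [ae_restrict_mem measurableSet_Ioc] with s hs using hH.continuous hs

lemma norm_sub_le (hH : IsWeightedLipschitz η q p e κ H) {B : ℝ} {s : ℝ} (hs : s ∈ Ioc p e)
    (hB : (s - p) ^ (1 - η) * ‖z₁ s - z₂ s‖ ≤ B) : ‖H s (z₁ s) - H s (z₂ s)‖ ≤ κ * B := by
  refine (hH.lip s hs _ _).trans ?_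
  rw [mul_assoc]
  exact mul_le_mul_of_nonneg_left hB hH.nonneg

lemma memLp (hH : IsWeightedLipschitz η q p e κ H) (hz : IsWeightedCont η p e z) :
    MemLp (fun s => H s (z s)) (ENNReal.ofReal q) (volume.restrict (Ioc p e)) := by
  obtain ⟨B, hB⟩ := hz.bdd
  have hd : MemLp (fun s => H s (z s) - H s 0) (ENNReal.ofReal q) (volume.restrict (Ioc p e)) := by
    refine MemLp.of_bound ((hH.aestronglyMeasurable hz).sub (hH.meas 0)) (κ * B) ?_
    filter_upwards [ae_restrict_mem measurableSet_Ioc] with s hs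
    exact hH.norm_sub_le (z₁ := z) (z₂ := fun _ => 0) hs (by simpa using hB s hs)
  exact (hd.add hH.zero_memLp).ae_eq (ae_of_all _ fun s => by simp)

end IsWeightedLipschitz

variable [NormedSpace ℝ Z] {K : ℝ → Z →L[ℝ] Z} {C : ℝ} {f f₁ f₂ : ℝ → Z}

lemma IsBoundedFamily.volterra_weighted_le (hK : IsBoundedFamily K C) (hq : 1 < q)
    (hqη : 1 < q * η)
    (hf : MemLp f (ENNReal.ofReal q) (volume.restrict (Ioc p e))) {t : ℝ} (ht : t ∈ Ioc p e) :
    (t - p) ^ (1 - η) * ‖volterra η K p f t‖ ≤ C * holderConst η q * (e - p) ^ (1 - 1 / q) *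
      (eLpNorm f (ENNReal.ofReal q) (volume.restrict (Ioc p e))).toReal := by
  have hle : volume.restrict (Ioc p t) ≤ volume.restrict (Ioc p e) :=
    Measure.restrict_mono (Ioc_subset_Ioc_right ht.2) le_rfl
  have h := hK.norm_volterra_le_eLpNorm hq hqη ht.1.le (hf.mono_measure hle)
  have h1 := ENNReal.toReal_mono hf.eLpNorm_ne_top (eLpNorm_mono_measure f hle)
  set N := (eLpNorm f (ENNReal.ofReal q) (volume.restrict (Ioc p e))).toReal
  have hC := hK.nonneg
  have hh := holderConst_nonneg hq hqη
  have hw := rpow_weight_pos ht (1 - η)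
  have hw2 := rpow_weight_pos ht (η - 1 / q)
  have h2 : (t - p) ^ (1 - η) * (t - p) ^ (η - 1 / q) ≤ (e - p) ^ (1 - 1 / q) := by
    rw [← Real.rpow_add (sub_pos.mpr ht.1)]
    have : 1 - η + (η - 1 / q) = 1 - 1 / q := by ring
    rw [this]
    refine rpow_weight_le ?_ ht
    rw [sub_nonneg, div_le_one (by linarith)]
    exact hq.le
  calc (t - p) ^ (1 - η) * ‖volterra η K p f t‖
      ≤ (t - p) ^ (1 - η) * (C * (holderConst η q * (t - p) ^ (η - 1 / q) * N)) := by
        refine mul_le_mul_of_nonneg_left (h.trans ?_) hw.le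
        gcongr
    _ = C * holderConst η q * ((t - p) ^ (1 - η) * (t - p) ^ (η - 1 / q)) * N := by ring
    _ ≤ _ := by
        have : 0 ≤ N := ENNReal.toReal_nonneg
        gcongr

lemma IsAdmissible.of_memLp (hK : IsBoundedFamily K C) (hq : 1 < q) (hqη : 1 < q * η)
    (hf : MemLp f (ENNReal.ofReal q) (volume.restrict (Ioc p e))) : IsAdmissible η q p e K f :=
  ⟨IsForcing.of_memLp hq.le hf, _, fun _ ht => hK.volterra_weighted_le hq hqη hf ht⟩

lemma IsAdmissible.of_norm_le_rpow (hK : IsBoundedFamily K C) (h0 : 0 < η) (hη : η < 1) {D : ℝ}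
    (hf : AEStronglyMeasurable f (volume.restrict (Ioc p e)))
    (hD : ∀ s ∈ Ioc p e, ‖f s‖ ≤ D * (s - p) ^ (-η)) : IsAdmissible η q p e K f := by
  have e1 : ∀ s, (s - p) ^ (-η) = (s - p) ^ ((1 - η) - 1) := fun s => by
    congr 1
    ring
  simp_rw [e1] at hD
  refine ⟨IsForcing.of_norm_le_rpow (by linarith) hf hD,
    (e - p) ^ (1 - η) * |C * (D * (Real.Gamma η * Real.Gamma (1 - η)))|, fun t ht => ?_⟩
  have hint := integrableOn_kernel_mul_rpow (β := 1 - η) h0 hη (by linarith) ht.1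
  have h := hK.norm_volterra_le (f := f) (η := η) (G := fun s => D * (s - p) ^ ((1 - η) - 1)) ht.1.le
    (by
      refine IntegrableOn.congr_fun (hint.const_mul D) (fun σ _ => ?_) measurableSet_Ioc
      ring)
    (by
      filter_upwards [ae_restrict_mem measurableSet_Ioc] with s hs
      exact hD s ⟨hs.1, hs.2.trans ht.2⟩)
  simp_rw [mul_left_comm _ D] at h
  rw [integral_const_mul, integral_kernel_mul_rpow h0 (by linarith) ht.1] at h
  have e2 : η + (1 - η) = 1 := by ring
  rw [e2, sub_self, Real.rpow_zero, one_mul, Real.Gamma_one, div_one] at h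
  exact mul_le_mul (rpow_weight_le (by linarith) ht) (h.trans (le_abs_self _)) (norm_nonneg _)
    (Real.rpow_nonneg (by linarith [ht.1, ht.2]) _)

lemma IsAdmissible.add (hK : IsBoundedFamily K C) (hη : η < 1) (hq : 1 < q) (hqη : 1 < q * η)
    (h₁ : IsAdmissible η q p e K f₁) (h₂ : IsAdmissible η q p e K f₂) :
    IsAdmissible η q p e K fun s => f₁ s + f₂ s := by
  obtain ⟨B₁, hB₁⟩ := h₁.bdd
  obtain ⟨B₂, hB₂⟩ := h₂.bdd
  refine ⟨h₁.forcing.add h₂.forcing, B₁ + B₂, fun t ht => ?_⟩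
  rw [hK.volterra_add hη hq hqη h₁.forcing h₂.forcing ht]
  have := mul_le_mul_of_nonneg_left (norm_add_le (volterra η K p f₁ t) (volterra η K p f₂ t))
    (rpow_weight_pos ht (1 - η)).le
  linarith [hB₁ t ht, hB₂ t ht]

/-- Solutions on `(p, e]` of the Volterra equation with datum `ζ` at `p` and forcing `f`. -/
structure IsLocalSolution (η p e : ℝ) (K : ℝ → Z →L[ℝ] Z) (H : ℝ → Z → Z) (ζ : Z) (f : ℝ → Z)
    (z : ℝ → Z) : Prop where
  weighted : IsWeightedCont η p e z
  eq : ∀ t ∈ Ioc p e, z t = (t - p) ^ (η - 1) • K (t - p) ζ +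
    volterra η K p (fun s => f s + H s (z s)) t

/-- One step of the iteration: the weighted difference of the images is controlled by the scalar
fractional integral of the weighted difference. -/
lemma IsBoundedFamily.weighted_volterra_sub_le (hK : IsBoundedFamily K C) (hη : η < 1)
    (hH : IsWeightedLipschitz η q p e κ H) {G : ℝ → ℝ}
    {t : ℝ} (ht : t ∈ Ioc p e) (hG : IntegrableOn (fun σ => (t - σ) ^ (η - 1) * G σ) (Ioc p t))
    (hle : ∀ s ∈ Ioc p t, (s - p) ^ (1 - η) * ‖z₁ s - z₂ s‖ ≤ G s) :
    (t - p) ^ (1 - η) * ‖volterra η K p (fun s => H s (z₁ s) - H s (z₂ s)) t‖ ≤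
      C * κ * (e - p) ^ (1 - η) * ∫ σ in Ioc p t, (t - σ) ^ (η - 1) * G σ := by
  have h := hK.norm_volterra_le (f := fun s => H s (z₁ s) - H s (z₂ s)) (η := η)
    (G := fun s => κ * G s) ht.1.le
    (by
      refine IntegrableOn.congr_fun (hG.const_mul κ) (fun σ _ => ?_) measurableSet_Ioc
      ring)
    (by
      filter_upwards [ae_restrict_mem measurableSet_Ioc] with s hs
      exact hH.norm_sub_le ⟨hs.1, hs.2.trans ht.2⟩ (hle s hs))
  simp_rw [mul_left_comm _ κ] at h
  rw [integral_const_mul] at h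
  refine (mul_le_mul (rpow_weight_le (by linarith : 0 ≤ 1 - η) ht) h (norm_nonneg _)
    (Real.rpow_nonneg (by linarith [ht.1, ht.2]) _)).trans (le_of_eq ?_)
  ring

/-- Continuous dependence of local solutions on the forcing. -/
theorem IsLocalSolution.weighted_sub_le (hK : IsBoundedFamily K C) (h0 : 0 < η) (hη : η < 1)
    (hq : 1 < q) (hqη : 1 < q * η) (hH : IsWeightedLipschitz η q p e κ H) {ζ : Z}
    (hf₁ : IsForcing q p e f₁) (hf₂ : IsForcing q p e f₂)
    (hd : MemLp (fun s => f₁ s - f₂ s) (ENNReal.ofReal q) (volume.restrict (Ioc p e)))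
    (h₁ : IsLocalSolution η p e K H ζ f₁ z₁) (h₂ : IsLocalSolution η p e K H ζ f₂ z₂)
    {t : ℝ} (ht : t ∈ Ioc p e) :
    (t - p) ^ (1 - η) * ‖z₁ t - z₂ t‖ ≤ C * holderConst η q * (e - p) ^ (1 - 1 / q) *
      (eLpNorm (fun s => f₁ s - f₂ s) (ENNReal.ofReal q) (volume.restrict (Ioc p e))).toReal *
      mittagLeffler η (C * Real.Gamma η * κ * (e - p)) := by
  have hw := h₁.weighted.sub h₂.weighted
  obtain ⟨W, hW⟩ := hw.bdd
  have hC := hK.nonneg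
  have hκ := hH.nonneg
  have hpe : 0 < e - p := by linarith [ht.1, ht.2]
  have hΓ := Real.Gamma_pos_of_pos h0
  have hFH₁ := IsForcing.of_memLp hq.le (hH.memLp h₁.weighted)
  have hFH₂ := IsForcing.of_memLp hq.le (hH.memLp h₂.weighted)
  have hFd := IsForcing.of_memLp hq.le hd
  have hb : 0 ≤ C * Real.Gamma η * κ * (e - p) ^ (1 - η) := by positivity
  have hwF : IsForcing q p e fun s => (s - p) ^ (1 - η) * ‖z₁ s - z₂ s‖ := by
    refine IsForcing.of_norm_le_rpow (β := 1) (D := W) one_pos ?_ fun s hs => ?_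
    · exact AEStronglyMeasurable.mul (Measurable.aestronglyMeasurable (by fun_prop))
        (hw.cont.aestronglyMeasurable measurableSet_Ioc).norm
    · rw [Real.norm_of_nonneg (mul_nonneg (rpow_weight_pos hs _).le (norm_nonneg _))]
      simpa using hW s hs
  have hG := le_mul_mittagLeffler (p := p) (e := e) (W := W)
    (A := C * holderConst η q * (e - p) ^ (1 - 1 / q) *
      (eLpNorm (fun s => f₁ s - f₂ s) (ENNReal.ofReal q) (volume.restrict (Ioc p e))).toReal)
    (w := fun s => (s - p) ^ (1 - η) * ‖z₁ s - z₂ s‖) h0 hη hb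
    (fun s hs => mul_nonneg (rpow_weight_pos hs _).le (norm_nonneg _)) hW (fun t ht => ?_) ht
  · refine hG.trans (mul_le_mul_of_nonneg_left (mittagLeffler_mono h0 ?_ ?_) ?_)
    · exact mul_nonneg hb (rpow_weight_pos ht _).le
    · refine (mul_le_mul_of_nonneg_left (rpow_weight_le h0.le ht) hb).trans (le_of_eq ?_)
      rw [mul_assoc, ← Real.rpow_add hpe, sub_add_cancel, Real.rpow_one]
    · exact mul_nonneg (mul_nonneg (mul_nonneg hC (holderConst_nonneg hq hqη))
        (Real.rpow_nonneg hpe.le _)) ENNReal.toReal_nonneg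
  · have e1 : z₁ t - z₂ t = volterra η K p (fun s => f₁ s - f₂ s) t +
        volterra η K p (fun s => H s (z₁ s) - H s (z₂ s)) t := by
      rw [h₁.eq t ht, h₂.eq t ht, hK.volterra_add hη hq hqη hf₁ hFH₁ ht,
        hK.volterra_add hη hq hqη hf₂ hFH₂ ht, hK.volterra_sub hη hq hqη hf₁ hf₂ ht,
        hK.volterra_sub hη hq hqη hFH₁ hFH₂ ht]
      abel
    have i1 := hK.volterra_weighted_le hq hqη hd ht
    have i2 := hK.weighted_volterra_sub_le hη hH ht (z₁ := z₁) (z₂ := z₂)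
      (G := fun s => (s - p) ^ (1 - η) * ‖z₁ s - z₂ s‖)
      ((integrableOn_kernel_mul_norm_of_isForcing hη hq hqη hwF ht).congr_fun (fun s hs => by
        simp only
        rw [Real.norm_of_nonneg (mul_nonneg
          (Real.rpow_nonneg (by linarith [hs.1]) _) (norm_nonneg _))]) measurableSet_Ioc)
      fun s _ => le_rfl
    have i3 := mul_le_mul_of_nonneg_left (norm_add_le (volterra η K p (fun s => f₁ s - f₂ s) t)
      (volterra η K p (fun s => H s (z₁ s) - H s (z₂ s)) t)) (rpow_weight_pos ht (1 - η)).le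
    rw [← e1, mul_add] at i3
    have e2 : C * Real.Gamma η * κ * (e - p) ^ (1 - η) / Real.Gamma η =
        C * κ * (e - p) ^ (1 - η) := by
      field_simp
    rw [e2]
    linarith

end

/-! ### Existence of local solutions -/

section

variable {Z : Type*} [NormedAddCommGroup Z] [NormedSpace ℝ Z] {η q p e κ C : ℝ}
  {K : ℝ → Z →L[ℝ] Z} {H : ℝ → Z → Z} {f : ℝ → Z} {z : ℝ → Z}

open scoped BoundedContinuousFunction

open Classical in
/-- The function `s ↦ (s - p)^(η - 1) w(s)` on `(p, e]`, extended by zero. -/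
noncomputable def unweight (η p e : ℝ) (w : Ioc p e →ᵇ Z) (s : ℝ) : Z :=
  if h : s ∈ Ioc p e then (s - p) ^ (η - 1) • w ⟨s, h⟩ else 0

lemma unweight_apply (w : Ioc p e →ᵇ Z) {s : ℝ} (hs : s ∈ Ioc p e) :
    unweight η p e w s = (s - p) ^ (η - 1) • w ⟨s, hs⟩ := by
  rw [unweight, dif_pos hs]

lemma weight_mul_weight {s : ℝ} (hs : s ∈ Ioc p e) : (s - p) ^ (1 - η) * (s - p) ^ (η - 1) = 1 := by
  rw [← Real.rpow_add (sub_pos.mpr hs.1)]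
  simp

lemma weighted_unweight_sub (w₁ w₂ : Ioc p e →ᵇ Z) {s : ℝ} (hs : s ∈ Ioc p e) :
    (s - p) ^ (1 - η) * ‖unweight η p e w₁ s - unweight η p e w₂ s‖ =
      ‖w₁ ⟨s, hs⟩ - w₂ ⟨s, hs⟩‖ := by
  rw [unweight_apply w₁ hs, unweight_apply w₂ hs, ← smul_sub, norm_smul,
    Real.norm_of_nonneg (rpow_weight_pos hs _).le, ← mul_assoc, weight_mul_weight hs, one_mul]

lemma isWeightedCont_unweight (w : Ioc p e →ᵇ Z) : IsWeightedCont η p e (unweight η p e w) := by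
  refine ⟨?_, ‖w‖, fun s hs => ?_⟩
  · rw [continuousOn_iff_continuous_domRestrict]
    have h : (Ioc p e).domRestrict (unweight η p e w) =
        fun s : Ioc p e => ((s : ℝ) - p) ^ (η - 1) • w s := by
      ext s
      exact unweight_apply w s.2
    rw [h]
    refine Continuous.smul ?_ w.continuous
    exact (continuous_subtype_val.sub continuous_const).rpow_const fun s =>
      Or.inl (sub_pos.mpr s.2.1).ne'
  · rw [unweight_apply w hs, norm_smul, Real.norm_of_nonneg (rpow_weight_pos hs _).le, ← mul_assoc,
      weight_mul_weight hs, one_mul]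
    exact w.norm_coe_le_norm _

/-- The Picard map in weighted coordinates is well defined. -/
lemma exists_picard (hK : IsBoundedFamily K C) (hη : η < 1)
    (hq : 1 < q) (hqη : 1 < q * η) (hH : IsWeightedLipschitz η q p e κ H) (ζ : Z)
    (hf : IsAdmissible η q p e K f) (w : Ioc p e →ᵇ Z) :
    ∃ v : Ioc p e →ᵇ Z, ∀ s : Ioc p e, v s = K (s - p) ζ +
      ((s : ℝ) - p) ^ (1 - η) • volterra η K p (fun σ => f σ + H σ (unweight η p e w σ)) s := by
  have hadm := hf.add hK hη hq hqη
    (IsAdmissible.of_memLp hK hq hqη (hH.memLp (isWeightedCont_unweight (η := η) w)))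
  obtain ⟨B, hB⟩ := hadm.bdd
  have hcont := hK.continuousOn_volterra hη hq hqη hadm.forcing
  rw [continuousOn_iff_continuous_domRestrict] at hcont
  refine ⟨BoundedContinuousFunction.ofNormedAddCommGroup (fun s : Ioc p e => K (s - p) ζ +
    ((s : ℝ) - p) ^ (1 - η) • volterra η K p (fun σ => f σ + H σ (unweight η p e w σ)) s) ?_
    (C * ‖ζ‖ + B) fun s => ?_, fun s => rfl⟩
  · refine Continuous.add ?_ (Continuous.smul ?_ hcont)
    · exact (hK.cont ζ).comp (continuous_subtype_val.sub continuous_const)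
    · exact (continuous_subtype_val.sub continuous_const).rpow_const fun s =>
        Or.inl (sub_pos.mpr s.2.1).ne'
  · refine (norm_add_le _ _).trans (add_le_add (hK.norm_apply_le _ _) ?_)
    rw [norm_smul, Real.norm_of_nonneg (rpow_weight_pos s.2 _).le]
    exact hB s s.2

/-- Local solutions exist: some iterate of the Picard map is a contraction. -/
theorem exists_isLocalSolution [CompleteSpace Z] (hK : IsBoundedFamily K C) (h0 : 0 < η)
    (hη : η < 1) (hq : 1 < q) (hqη : 1 < q * η) (hpe : p < e)
    (hH : IsWeightedLipschitz η q p e κ H) (ζ : Z) (hf : IsAdmissible η q p e K f) :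
    ∃ z, IsLocalSolution η p e K H ζ f z := by
  choose Φ hΦ using exists_picard hK hη hq hqη hH ζ hf
  have hC := hK.nonneg
  have hκ := hH.nonneg
  have hΓ := Real.Gamma_pos_of_pos h0
  have hpe' : 0 < e - p := sub_pos.mpr hpe
  set b := C * Real.Gamma η * κ * (e - p) ^ (1 - η) with hb_def
  have hb : 0 ≤ b := by positivity
  have hiter : ∀ (n : ℕ) (w₁ w₂ : Ioc p e →ᵇ Z) (s : Ioc p e),
      ‖(Φ^[n] w₁) s - (Φ^[n] w₂) s‖ ≤ ‖w₁ - w₂‖ * mlTerm η n (b * ((s : ℝ) - p) ^ η) := by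
    intro n
    induction n with
    | zero =>
      intro w₁ w₂ s
      simpa [mlTerm] using (w₁ - w₂).norm_coe_le_norm s
    | succ n ih =>
      intro w₁ w₂ s
      rw [Function.iterate_succ_apply', Function.iterate_succ_apply', hΦ, hΦ, add_sub_add_left_eq_sub,
        ← smul_sub]
      set v₁ := unweight η p e (Φ^[n] w₁) with hv₁
      set v₂ := unweight η p e (Φ^[n] w₂) with hv₂
      have hF₁ := IsForcing.of_memLp hq.le (hH.memLp (isWeightedCont_unweight (η := η) (Φ^[n] w₁)))
      have hF₂ := IsForcing.of_memLp hq.le (hH.memLp (isWeightedCont_unweight (η := η) (Φ^[n] w₂)))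
      rw [hK.volterra_add hη hq hqη hf.forcing hF₁ s.2, hK.volterra_add hη hq hqη hf.forcing hF₂ s.2,
        add_sub_add_left_eq_sub, ← hK.volterra_sub hη hq hqη hF₁ hF₂ s.2, norm_smul,
        Real.norm_of_nonneg (rpow_weight_pos s.2 _).le]
      have hint := (integrableOn_kernel_mul_mlTerm (b := b) h0 hη s.2.1 n).const_mul ‖w₁ - w₂‖
      have hle := hK.weighted_volterra_sub_le hη hH s.2 (z₁ := v₁) (z₂ := v₂)
        (G := fun σ => ‖w₁ - w₂‖ * mlTerm η n (b * (σ - p) ^ η))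
        (IntegrableOn.congr_fun hint (fun σ _ => by ring) measurableSet_Ioc)
        (fun σ hσ => by
          have hσ' : σ ∈ Ioc p e := ⟨hσ.1, hσ.2.trans s.2.2⟩
          rw [hv₁, hv₂, weighted_unweight_sub _ _ hσ']
          exact ih w₁ w₂ ⟨σ, hσ'⟩)
      refine hle.trans (le_of_eq ?_)
      simp_rw [mul_left_comm _ ‖w₁ - w₂‖]
      rw [integral_const_mul, ← integral_kernel_mul_mlTerm h0 s.2.1, mul_left_comm]
      congr 2
      rw [hb_def]
      field_simp
  have hx : 0 ≤ b * (e - p) ^ η := by positivity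
  obtain ⟨n, hn⟩ := ((summable_mlTerm (η := η) h0 hx).tendsto_atTop_zero.eventually
    (gt_mem_nhds (show (0 : ℝ) < 1 / 2 by norm_num))).exists
  have hcontr : ContractingWith (1 / 2) Φ^[n] := by
    refine ⟨by norm_num [← NNReal.coe_lt_coe], LipschitzWith.of_dist_le_mul fun w₁ w₂ => ?_⟩
    rw [dist_eq_norm, dist_eq_norm]
    have hnn : 0 ≤ ‖w₁ - w₂‖ := norm_nonneg _
    refine (BoundedContinuousFunction.norm_le (by positivity)).mpr fun s => ?_
    refine (hiter n w₁ w₂ s).trans ?_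
    rw [mul_comm]
    refine mul_le_mul_of_nonneg_right ?_ hnn
    refine (mlTerm_le h0 (mul_nonneg hb (rpow_weight_pos s.2 _).le)
      (mul_le_mul_of_nonneg_left (rpow_weight_le h0.le s.2) hb) n).trans ?_
    simpa using hn.le
  set w := ContractingWith.fixedPoint Φ^[n] hcontr
  have hfix : Φ w = w := hcontr.isFixedPt_fixedPoint_iterate
  refine ⟨unweight η p e w, isWeightedCont_unweight w, fun t ht => ?_⟩
  have h1 := hΦ w ⟨t, ht⟩
  rw [hfix] at h1
  rw [unweight_apply w ht, h1, smul_add, smul_smul, mul_comm, weight_mul_weight ht, one_smul]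

end

/-! ### The memory term and step-by-step solutions -/

lemma IsWeightedCont.isForcing {Z : Type*} [NormedAddCommGroup Z] {η q p e : ℝ} {z : ℝ → Z}
    (h0 : 0 < η) (hz : IsWeightedCont η p e z) : IsForcing q p e z := by
  obtain ⟨B, hB⟩ := hz.bdd
  refine IsForcing.of_norm_le_rpow (D := B) h0 (hz.cont.aestronglyMeasurable measurableSet_Ioc)
    fun s hs => ?_
  have h := mul_le_mul_of_nonneg_left (hB s hs) (rpow_weight_pos hs (η - 1)).le
  rwa [← mul_assoc, mul_comm ((s - p) ^ (η - 1)), weight_mul_weight hs, one_mul, mul_comm] at h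

lemma IsWeightedCont.congr {Z : Type*} [NormedAddCommGroup Z] {η p e : ℝ} {z z' : ℝ → Z}
    (hz : IsWeightedCont η p e z) (h : EqOn z' z (Ioc p e)) : IsWeightedCont η p e z' := by
  obtain ⟨B, hB⟩ := hz.bdd
  exact ⟨hz.cont.congr h, B, fun s hs => by rw [h hs]; exact hB s hs⟩

lemma volterra_congr_ae {Z : Type*} [NormedAddCommGroup Z] [NormedSpace ℝ Z] {η p e : ℝ}
    {K : ℝ → Z →L[ℝ] Z} {f g : ℝ → Z} {t : ℝ} (ht : t ∈ Ioc p e)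
    (h : ∀ᵐ s ∂volume.restrict (Ioc p e), f s = g s) : volterra η K p f t = volterra η K p g t := by
  rw [volterra, volterra, intervalIntegral.integral_of_le ht.1.le,
    intervalIntegral.integral_of_le ht.1.le]
  refine integral_congr_ae ?_
  filter_upwards [ae_mono (Measure.restrict_mono (Ioc_subset_Ioc_right ht.2) le_rfl) h] with s hs
  rw [hs]

lemma IsLocalSolution.congr {Z : Type*} [NormedAddCommGroup Z] [NormedSpace ℝ Z] {η p e : ℝ}
    {K : ℝ → Z →L[ℝ] Z} {H : ℝ → Z → Z} {ζ : Z} {f g z z' : ℝ → Z}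
    (hs : IsLocalSolution η p e K H ζ f z) (h : EqOn z' z (Ioc p e))
    (hfg : ∀ᵐ s ∂volume.restrict (Ioc p e), g s = f s) : IsLocalSolution η p e K H ζ g z' := by
  refine ⟨hs.weighted.congr h, fun t ht => ?_⟩
  rw [h ht, hs.eq t ht]
  congr 1
  refine volterra_congr_ae ht ?_
  filter_upwards [hfg, ae_restrict_mem measurableSet_Ioc] with s hs1 hs2
  rw [hs1, h hs2]

/-- A convolution over `[b, c]` against the kernel `(s - σ)^{-(1 + η)}` is measurable in `s`. -/
lemma aestronglyMeasurable_memory {Z : Type*} [NormedAddCommGroup Z] [NormedSpace ℝ Z] {η b c : ℝ}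
    (hbc : b ≤ c) {g : ℝ → Z} (hg : AEStronglyMeasurable g (volume.restrict (Ioc b c)))
    (μ : Measure ℝ) [SFinite μ] :
    AEStronglyMeasurable (fun s => ∫ σ in b..c, ((s - σ) ^ (1 + η))⁻¹ • g σ) μ := by
  simp_rw [intervalIntegral.integral_of_le hbc]
  refine AEStronglyMeasurable.integral_prod_right'
    (f := fun x : ℝ × ℝ => ((x.1 - x.2) ^ (1 + η))⁻¹ • g x.2) ?_
  exact (Measurable.aestronglyMeasurable (by fun_prop)).smul hg.comp_snd

/-- Memory kernel against an integrable function supported away from `s`. -/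
lemma norm_memory_le_of_integrable {Z : Type*} [NormedAddCommGroup Z] [NormedSpace ℝ Z]
    {η b c p s : ℝ} (h0 : 0 < η) (hbc : b ≤ c) (hcp : c < p) (hps : p ≤ s) {g : ℝ → Z}
    (hg : IntegrableOn g (Ioc b c)) :
    ‖∫ σ in b..c, ((s - σ) ^ (1 + η))⁻¹ • g σ‖ ≤
      ((p - c) ^ (1 + η))⁻¹ * ∫ σ in Ioc b c, ‖g σ‖ := by
  rw [intervalIntegral.integral_of_le hbc, ← integral_const_mul]
  refine norm_integral_le_of_norm_le (hg.norm.const_mul _) ?_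
  filter_upwards [ae_restrict_mem measurableSet_Ioc] with σ hσ
  have h1 : p - c ≤ s - σ := by linarith [hσ.2]
  have h2 : 0 < p - c := sub_pos.mpr hcp
  rw [norm_smul, norm_inv, Real.norm_of_nonneg (Real.rpow_nonneg (by linarith) _)]
  gcongr

/-- Memory kernel against a bounded function supported to the left of `s`. -/
lemma norm_memory_le_of_bounded {Z : Type*} [NormedAddCommGroup Z] [NormedSpace ℝ Z]
    {η b c s B : ℝ} (h0 : 0 < η) (hbc : b ≤ c) (hcs : c < s) {g : ℝ → Z}
    (hB : ∀ σ ∈ Ioc b c, ‖g σ‖ ≤ B) (hB0 : 0 ≤ B) :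
    ‖∫ σ in b..c, ((s - σ) ^ (1 + η))⁻¹ • g σ‖ ≤ B / η * (s - c) ^ (-η) := by
  have hne : (0 : ℝ) ∉ uIcc (s - c) (s - b) := by
    rw [uIcc_of_le (by linarith)]
    exact fun h => by linarith [h.1]
  have hI : ∫ σ in b..c, (s - σ) ^ (-(1 + η)) = ((s - c) ^ (-η) - (s - b) ^ (-η)) / η := by
    rw [intervalIntegral.integral_comp_sub_left (fun x => x ^ (-(1 + η))) s,
      integral_rpow (Or.inr ⟨by linarith, hne⟩)]
    have : -(1 + η) + 1 = -η := by ring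
    rw [this]
    field_simp
    ring
  have hint : IntervalIntegrable (fun σ => (s - σ) ^ (-(1 + η))) volume b c := by
    refine ContinuousOn.intervalIntegrable ?_
    rw [uIcc_of_le hbc]
    exact ContinuousOn.rpow_const (by fun_prop) fun σ hσ => Or.inl (by linarith [hσ.2])
  have h1 : ‖∫ σ in b..c, ((s - σ) ^ (1 + η))⁻¹ • g σ‖ ≤ ∫ σ in b..c, (s - σ) ^ (-(1 + η)) * B := by
    refine intervalIntegral.norm_integral_le_of_norm_le hbc (ae_of_all _ fun σ hσ => ?_)
      (hint.mul_const B)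
    have h2 : 0 < s - σ := by linarith [hσ.2]
    rw [norm_smul, norm_inv, Real.norm_of_nonneg (Real.rpow_nonneg h2.le _), Real.rpow_neg h2.le]
    exact mul_le_mul_of_nonneg_left (hB σ hσ) (inv_nonneg.mpr (Real.rpow_nonneg h2.le _))
  refine h1.trans ?_
  rw [intervalIntegral.integral_mul_const, hI]
  have h3 : 0 ≤ (s - b) ^ (-η) := Real.rpow_nonneg (by linarith) _
  rw [div_mul_eq_mul_div, div_mul_eq_mul_div, mul_comm]
  gcongr
  linarith

namespace ImpulsiveSystem

variable {Z U : Type*} [NormedAddCommGroup Z] [NormedSpace ℝ Z]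
  [NormedAddCommGroup U] [NormedSpace ℝ U] (S : ImpulsiveSystem Z U)

lemma t_le_p {k : ℕ} (hk : k ≤ S.m) : S.t (k + 1) ≤ S.p (k + 1) := by
  rcases hk.eq_or_lt with rfl | h
  · rw [S.t_last, S.p_last]
  · exact (S.t_lt_p (k + 1) (by omega) (by omega)).le

lemma p_le_p {k r : ℕ} (hkr : k ≤ r) (hr : r ≤ S.m + 1) : S.p k ≤ S.p r := by
  induction r, hkr using Nat.le_induction with
  | base => exact le_rfl
  | succ r _ ih =>
    exact (ih (by omega)).trans ((S.p_lt_t r (by omega)).le.trans (S.t_le_p (by omega)))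

lemma p_nonneg {r : ℕ} (hr : r ≤ S.m + 1) : 0 ≤ S.p r := by
  rw [← S.p_zero]
  exact S.p_le_p (Nat.zero_le r) hr

lemma t_lt_p_of_lt {k r : ℕ} (hkr : k < r) (hr : r ≤ S.m) : S.t (k + 1) < S.p r :=
  (S.t_lt_p (k + 1) (by omega) (by omega)).trans_le (S.p_le_p hkr (by omega))

lemma p_le_a {r : ℕ} (hr : r ≤ S.m + 1) : S.p r ≤ S.a := by
  rw [← S.p_last]
  exact S.p_le_p hr le_rfl

lemma t_le_a {r : ℕ} (hr : r ≤ S.m) : S.t (r + 1) ≤ S.a :=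
  (S.t_le_p hr).trans (S.p_le_a (by omega))

lemma Ioc_subset {r : ℕ} (hr : r ≤ S.m) : Ioc (S.p r) (S.t (r + 1)) ⊆ Icc 0 S.a := fun _ hs =>
  ⟨(S.p_nonneg (by omega)).trans hs.1.le, hs.2.trans (S.t_le_a hr)⟩

lemma Icc_subset {r : ℕ} (hr : r ≤ S.m) : Icc (S.p r) (S.t (r + 1)) ⊆ Icc 0 S.a := fun _ hs =>
  ⟨(S.p_nonneg (by omega)).trans hs.1, hs.2.trans (S.t_le_a hr)⟩

lemma isBoundedFamily : IsBoundedFamily S.fracOp (S.M / Real.Gamma S.η) :=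
  ⟨S.continuous_fracOp, S.norm_fracOp_le⟩

variable {S}

lemma H0.one_lt_mul (h0 : S.H0) : 1 < S.q * S.η := by
  have := h0.1
  rwa [div_lt_iff₀ S.η_pos] at this

lemma H0.one_lt (h0 : S.H0) : 1 < S.q := by
  refine lt_trans ?_ h0.1
  rw [lt_div_iff₀ S.η_pos]
  linarith [S.η_lt_one]

lemma isWeightedLipschitz {κ' d : ℝ} {ς : ℝ → ℝ} (h2 : S.H2 ς d) (h5 : S.H5 κ') {r : ℕ}
    (hr : r ≤ S.m) : IsWeightedLipschitz S.η S.q (S.p r) (S.t (r + 1)) κ' S.h := by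
  have hle : volume.restrict (Ioc (S.p r) (S.t (r + 1))) ≤ volume.restrict (Icc 0 S.a) :=
    Measure.restrict_mono (S.Ioc_subset hr) le_rfl
  have hsub : Ioc (S.p r) (S.t (r + 1)) ⊆ Ioc (S.p r) (S.p (r + 1)) :=
    Ioc_subset_Ioc_right (S.t_le_p hr)
  refine ⟨fun x => (S.h_meas x).mono_measure hle, ?_, fun s hs x y =>
    h5.2 r ⟨Nat.zero_le _, hr⟩ s (hsub hs) x y, h5.1.le⟩
  refine (h2.1.mono_measure hle).mono' ((S.h_meas 0).mono_measure hle) ?_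
  filter_upwards [ae_mono (Measure.restrict_mono hsub le_rfl) (h2.2.2.2 r ⟨Nat.zero_le _, hr⟩)]
    with s hs
  simpa using hs 0

lemma continuousOn_psi {b : ℕ → ℝ} (h3 : S.H3 b) {r : ℕ} (h1 : 1 ≤ r) (hr : r ≤ S.m) (x : Z) :
    ContinuousOn (fun s => S.ψ r s x) (Icc (S.t r) (S.p r)) :=
  (h3 r ⟨h1, hr⟩).1.comp (f := fun s : ℝ => (s, x)) (by fun_prop) fun _ hs => ⟨hs, mem_univ _⟩

/-- The memory term is measurable and blows up at most like `(s - p_r)^{-η}` at `p_r`. -/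
lemma phi_properties {b : ℕ → ℝ} (h3 : S.H3 b) {r : ℕ} (hr : r ≤ S.m) {z : ℝ → Z}
    (hz : ∀ k < r, IsWeightedCont S.η (S.p k) (S.t (k + 1)) z) :
    AEStronglyMeasurable (fun s => S.φ r s z) (volume.restrict (Ioc (S.p r) (S.t (r + 1)))) ∧
    ∃ D, ∀ s ∈ Ioc (S.p r) (S.t (r + 1)), ‖S.φ r s z‖ ≤ D * (s - S.p r) ^ (-S.η) := by
  have hψ : ∀ k < r, ContinuousOn (fun σ => S.ψ (k + 1) σ (z (S.t (k + 1))))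
      (Icc (S.t (k + 1)) (S.p (k + 1))) := fun k hk => continuousOn_psi h3 (by omega) (by omega) _
  have hzi : ∀ k < r, IntegrableOn z (Ioc (S.p k) (S.t (k + 1))) := fun k hk =>
    ((hz k hk).isForcing (q := 1) S.η_pos).int
  constructor
  · refine AEStronglyMeasurable.const_smul ?_ _
    refine Finset.aestronglyMeasurable_fun_sum _ fun k hk => ?_
    have hk' := Finset.mem_range.mp hk
    refine AEStronglyMeasurable.add ?_ ?_
    · exact aestronglyMeasurable_memory (S.p_lt_t k (by omega)).le (hzi k hk').aestronglyMeasurable _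
    · exact aestronglyMeasurable_memory (S.t_le_p (by omega))
        (((hψ k hk').mono Ioc_subset_Icc_self).aestronglyMeasurable measurableSet_Ioc) _
  · have hterm : ∀ k < r, ∃ D, ∀ s ∈ Ioc (S.p r) (S.t (r + 1)),
        ‖(∫ σ in (S.p k)..(S.t (k + 1)), ((s - σ) ^ (1 + S.η))⁻¹ • z σ) +
          ∫ σ in (S.t (k + 1))..(S.p (k + 1)),
            ((s - σ) ^ (1 + S.η))⁻¹ • S.ψ (k + 1) σ (z (S.t (k + 1)))‖ ≤
          D * (s - S.p r) ^ (-S.η) := by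
      intro k hk
      obtain ⟨B, hB⟩ := isCompact_Icc.exists_bound_of_continuousOn (hψ k hk)
      have hB0 : 0 ≤ B := (norm_nonneg _).trans (hB (S.t (k + 1)) ⟨le_rfl, S.t_le_p (by omega)⟩)
      set A := ((S.p r - S.t (k + 1)) ^ (1 + S.η))⁻¹ *
        ∫ σ in Ioc (S.p k) (S.t (k + 1)), ‖z σ‖ with hA
      have hA0 : 0 ≤ A := mul_nonneg (inv_nonneg.mpr
        (Real.rpow_nonneg (sub_nonneg.mpr (S.t_lt_p_of_lt hk hr).le) _))
        (integral_nonneg fun _ => norm_nonneg _)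
      refine ⟨A * (S.t (r + 1) - S.p r) ^ S.η + B / S.η, fun s hs => ?_⟩
      have hs0 : 0 < s - S.p r := sub_pos.mpr hs.1
      refine (norm_add_le _ _).trans ?_
      rw [add_mul]
      refine add_le_add ?_ ?_
      · refine (norm_memory_le_of_integrable S.η_pos (S.p_lt_t k (by omega)).le
          (S.t_lt_p_of_lt hk hr) hs.1.le (hzi k hk)).trans ?_
        rw [← hA, mul_assoc]
        refine le_mul_of_one_le_right hA0 ?_
        rw [Real.rpow_neg hs0.le, ← div_eq_mul_inv, one_le_div (Real.rpow_pos_of_pos hs0 _)]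
        exact rpow_weight_le S.η_pos.le hs
      · have hp : S.p (k + 1) ≤ S.p r := S.p_le_p hk (by omega)
        refine (norm_memory_le_of_bounded S.η_pos (S.t_le_p (by omega)) (hp.trans_lt hs.1)
          (fun σ hσ => hB σ (Ioc_subset_Icc_self hσ)) hB0).trans ?_
        refine mul_le_mul_of_nonneg_left ?_ (div_nonneg hB0 S.η_pos.le)
        exact Real.rpow_le_rpow_of_nonpos hs0 (by linarith) (by linarith [S.η_pos])
    choose! D hD using hterm
    refine ⟨|S.η / Real.Gamma (1 - S.η)| * ∑ k ∈ Finset.range r, D k, fun s hs => ?_⟩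
    rw [φ, norm_smul, Real.norm_eq_abs, mul_assoc, Finset.sum_mul]
    refine mul_le_mul_of_nonneg_left ?_ (abs_nonneg _)
    exact (norm_sum_le _ _).trans (Finset.sum_le_sum fun k hk =>
      hD k (Finset.mem_range.mp hk) s hs)

lemma phi_congr {r : ℕ} (hr : r ≤ S.m) {z z' : ℝ → Z} (h : ∀ s ≤ S.p r, z' s = z s) (s : ℝ) :
    S.φ r s z' = S.φ r s z := by
  rw [φ, φ]
  congr 1
  refine Finset.sum_congr rfl fun k hk => ?_
  have hk' := Finset.mem_range.mp hk
  have ht : S.t (k + 1) ≤ S.p r := (S.t_lt_p_of_lt hk' hr).le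
  rw [h _ ht]
  congr 1
  refine intervalIntegral.integral_congr fun σ hσ => ?_
  rw [uIcc_of_le (S.p_lt_t k (by omega)).le] at hσ
  rw [h σ (hσ.2.trans ht)]

lemma datum_congr {r : ℕ} (hr : r ≤ S.m) {z z' : ℝ → Z} (h : ∀ s ≤ S.p r, z' s = z s) :
    S.datum r z' = S.datum r z := by
  rw [datum, datum]
  split_ifs with h0
  · rfl
  · rw [h _ (S.t_lt_p r (by omega) hr).le]

/-- `z` solves the Volterra equation with control term `v` on `(p_r, t_{r+1}]` and the impulse
relation on `(t_{r+1}, p_{r+1}]`. -/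
structure SolvesStep (S : ImpulsiveSystem Z U) (v z : ℝ → Z) (r : ℕ) : Prop where
  sol : IsLocalSolution S.η (S.p r) (S.t (r + 1)) S.fracOp S.h (S.datum r z)
    (fun σ => v σ + S.φ r σ z) z
  jump : r + 1 ≤ S.m → ∀ s ∈ Ioc (S.t (r + 1)) (S.p (r + 1)), z s = S.ψ (r + 1) s (z (S.t (r + 1)))

lemma SolvesStep.congr {v v' z z' : ℝ → Z} {r : ℕ} (hr : r ≤ S.m) (h : SolvesStep S v z r)
    (hz : ∀ s ≤ S.p (r + 1), z' s = z s)
    (hv : ∀ᵐ s ∂volume.restrict (Ioc (S.p r) (S.t (r + 1))), v' s = v s) :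
    SolvesStep S v' z' r := by
  have hp : S.p r ≤ S.p (r + 1) := S.p_le_p (by omega) (by omega)
  have hz' : ∀ s ≤ S.p r, z' s = z s := fun s hs => hz s (hs.trans hp)
  have ht : S.t (r + 1) ≤ S.p (r + 1) := S.t_le_p hr
  constructor
  · rw [datum_congr hr hz']
    refine h.sol.congr (fun s hs => hz s (hs.2.trans ht)) ?_
    filter_upwards [hv] with s hs
    rw [hs, phi_congr hr hz']
  · intro hm s hs
    rw [hz s hs.2, hz _ ht]
    exact h.jump hm s hs

lemma isAdmissible_step {b : ℕ → ℝ} (h0 : S.H0) (h3 : S.H3 b) {r : ℕ} (hr : r ≤ S.m)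
    {v z : ℝ → Z} (hz : ∀ k < r, SolvesStep S v z k) {v' : ℝ → Z}
    (hv : MemLp v' (ENNReal.ofReal S.q) (volume.restrict (Ioc (S.p r) (S.t (r + 1))))) :
    IsAdmissible S.η S.q (S.p r) (S.t (r + 1)) S.fracOp (fun σ => v' σ + S.φ r σ z) := by
  obtain ⟨hm, D, hD⟩ := phi_properties h3 hr fun k hk => (hz k hk).sol.weighted
  exact (IsAdmissible.of_memLp S.isBoundedFamily h0.one_lt h0.one_lt_mul hv).add S.isBoundedFamily
    S.η_lt_one h0.one_lt h0.one_lt_mul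
    (IsAdmissible.of_norm_le_rpow S.isBoundedFamily S.η_pos S.η_lt_one hm hD)

/-- A solution up to time `p_r` extends to one up to time `p_{r+1}`. -/
lemma exists_extension [CompleteSpace Z] {b : ℕ → ℝ} {κ' d : ℝ} {ς : ℝ → ℝ} (h0 : S.H0)
    (h2 : S.H2 ς d) (h3 : S.H3 b) (h5 : S.H5 κ') {r : ℕ} (hr : r ≤ S.m)
    {v z : ℝ → Z} (hz : ∀ k < r, SolvesStep S v z k) {v' : ℝ → Z}
    (hv : MemLp v' (ENNReal.ofReal S.q) (volume.restrict (Ioc (S.p r) (S.t (r + 1))))) :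
    ∃ z', (∀ s ≤ S.p r, z' s = z s) ∧ SolvesStep S v' z' r := by
  obtain ⟨y, hy⟩ := exists_isLocalSolution S.isBoundedFamily S.η_pos S.η_lt_one h0.one_lt
    h0.one_lt_mul (S.p_lt_t r hr) (isWeightedLipschitz h2 h5 hr) (S.datum r z)
    (isAdmissible_step h0 h3 hr hz hv)
  classical
  set z' : ℝ → Z := fun s => if s ≤ S.p r then z s else if s ≤ S.t (r + 1) then y s else
    S.ψ (r + 1) s (y (S.t (r + 1))) with hz'
  have h1 : ∀ s ≤ S.p r, z' s = z s := fun s hs => by simp [hz', hs]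
  have h2' : EqOn z' y (Ioc (S.p r) (S.t (r + 1))) := fun s hs => by
    simp [hz', hs.2, not_le.mpr hs.1]
  have hpt := S.p_lt_t r hr
  refine ⟨z', h1, ?_, fun hm s hs => ?_⟩
  · rw [datum_congr hr h1]
    refine hy.congr h2' (ae_of_all _ fun s => ?_)
    rw [phi_congr hr h1]
  · rw [h2' ⟨hpt, le_rfl⟩]
    simp [hz', not_le.mpr hs.1, not_le.mpr (hpt.trans hs.1)]

lemma exists_solvesSteps [CompleteSpace Z] {b : ℕ → ℝ} {κ' d : ℝ} {ς : ℝ → ℝ} (h0 : S.H0)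
    (h2 : S.H2 ς d) (h3 : S.H3 b) (h5 : S.H5 κ') {v : ℝ → Z}
    (hv : ∀ r ≤ S.m, MemLp v (ENNReal.ofReal S.q) (volume.restrict (Ioc (S.p r) (S.t (r + 1)))))
    (n : ℕ) (hn : n ≤ S.m + 1) : ∃ z, ∀ k < n, SolvesStep S v z k := by
  induction n with
  | zero => exact ⟨fun _ => 0, fun k hk => absurd hk (Nat.not_lt_zero k)⟩
  | succ n ih =>
    obtain ⟨z, hz⟩ := ih (by omega)
    obtain ⟨z', h1, h2'⟩ := exists_extension h0 h2 h3 h5 (by omega) hz (hv n (by omega))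
    refine ⟨z', fun k hk => ?_⟩
    rcases (Nat.lt_succ_iff.mp hk).eq_or_lt with rfl | h
    · exact h2'
    · exact (hz k h).congr (by omega) (fun s hs => h1 s (hs.trans (S.p_le_p h (by omega))))
        (ae_of_all _ fun _ => rfl)

end ImpulsiveSystem

/-! ### Mild solutions -/

lemma tendsto_nhdsLT_of_continuousOn_Ioc {Z : Type*} [TopologicalSpace Z] {z : ℝ → Z} {a b : ℝ}
    (hab : a < b) (hz : ContinuousOn z (Ioc a b)) : Tendsto z (𝓝[<] b) (𝓝 (z b)) :=
  (hz b ⟨hab, le_rfl⟩).mono_left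
    (nhdsWithin_le_of_mem (mem_of_superset (Ioo_mem_nhdsLT hab) Ioo_subset_Ioc_self))

namespace ImpulsiveSystem

variable {Z U : Type*} [NormedAddCommGroup Z] [NormedSpace ℝ Z]
  [NormedAddCommGroup U] [NormedSpace ℝ U] {S : ImpulsiveSystem Z U}

lemma memLp_B {r : ℕ} (hr : r ≤ S.m) (u : S.Control) :
    MemLp (S.B u) (ENNReal.ofReal S.q) (volume.restrict (Ioc (S.p r) (S.t (r + 1)))) :=
  (Lp.memLp (S.B u)).mono_measure (Measure.restrict_mono (S.Ioc_subset hr) le_rfl)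

lemma SolvesStep.continuousOn_jump {b : ℕ → ℝ} (h3 : S.H3 b) {v z : ℝ → Z} {k : ℕ}
    (hk : k + 1 ≤ S.m) (h : SolvesStep S v z k) :
    ContinuousOn z (Ioc (S.t (k + 1)) (S.p (k + 1))) :=
  ((continuousOn_psi h3 (by omega) hk (z (S.t (k + 1)))).mono Ioc_subset_Icc_self).congr
    fun s hs => h.jump hk s hs

lemma SolvesStep.bddAbove {b : ℕ → ℝ} (h3 : S.H3 b) {v z : ℝ → Z} {r : ℕ}
    (hr : r ≤ S.m) (h : SolvesStep S v z r) :
    BddAbove ((fun s => (s - S.p r) ^ (1 - S.η) * ‖z s‖) '' Ioc (S.p r) (S.p (r + 1))) := by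
  rw [← Ioc_union_Ioc_eq_Ioc (S.p_lt_t r hr).le (S.t_le_p hr), image_union, bddAbove_union]
  constructor
  · obtain ⟨B, hB⟩ := h.sol.weighted.bdd
    exact ⟨B, by rintro _ ⟨s, hs, rfl⟩; exact hB s hs⟩
  · rcases hr.eq_or_lt with rfl | hlt
    · rw [S.t_last, S.p_last]
      simp
    · obtain ⟨B, hB⟩ := isCompact_Icc.exists_bound_of_continuousOn
        (continuousOn_psi h3 (by omega) hlt (z (S.t (r + 1))))
      refine ⟨(S.p (r + 1) - S.p r) ^ (1 - S.η) * B, ?_⟩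
      rintro _ ⟨s, hs, rfl⟩
      have hs' : s ∈ Ioc (S.p r) (S.p (r + 1)) := ⟨(S.p_lt_t r hr).trans hs.1, hs.2⟩
      refine mul_le_mul (rpow_weight_le (by linarith [S.η_lt_one]) hs') ?_ (norm_nonneg _)
        (Real.rpow_nonneg (by linarith [hs'.1, hs'.2]) _)
      rw [h.jump hlt s hs]
      exact hB s (Ioc_subset_Icc_self hs)

lemma isPC_of_solvesSteps {b : ℕ → ℝ} (h3 : S.H3 b) {v z : ℝ → Z}
    (h : ∀ k ≤ S.m, SolvesStep S v z k) : S.IsPC z := by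
  refine ⟨fun x hx => ContinuousAt.continuousWithinAt ?_, fun r hr => ?_, fun r hr => ?_,
    fun r hr => (h r hr.2).bddAbove h3 hr.2⟩
  · rcases hx with hx | hx
    · simp only [mem_iUnion] at hx
      obtain ⟨r, hr, hx⟩ := hx
      exact (h r hr.2).sol.weighted.cont.continuousAt
        (mem_of_superset (Ioo_mem_nhds hx.1 hx.2) Ioo_subset_Ioc_self)
    · simp only [mem_iUnion] at hx
      obtain ⟨r, hr, hx⟩ := hx
      obtain ⟨k, rfl⟩ : ∃ k, r = k + 1 := ⟨r - 1, by have := hr.1; omega⟩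
      exact ((h k (by have := hr.2; omega)).continuousOn_jump h3 hr.2).continuousAt
        (mem_of_superset (Ioo_mem_nhds hx.1 hx.2) Ioo_subset_Ioc_self)
  · obtain ⟨k, rfl⟩ : ∃ k, r = k + 1 := ⟨r - 1, by have := hr.1; omega⟩
    exact tendsto_nhdsLT_of_continuousOn_Ioc (S.t_lt_p _ hr.1 hr.2)
      ((h k (by have := hr.2; omega)).continuousOn_jump h3 hr.2)
  · obtain ⟨k, rfl⟩ : ∃ k, r = k + 1 := ⟨r - 1, by have := hr.1; omega⟩
    have hk : k ≤ S.m := by have := hr.2; omega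
    exact tendsto_nhdsLT_of_continuousOn_Ioc (S.p_lt_t k hk) (h k hk).sol.weighted.cont

/-- A function that solves every step is a mild solution. -/
theorem isMildSolution_of_solvesSteps {b : ℕ → ℝ} {κ' d : ℝ} {ς : ℝ → ℝ} (h0 : S.H0)
    (h2 : S.H2 ς d) (h3 : S.H3 b) (h5 : S.H5 κ') {u : S.Control} {z : ℝ → Z}
    (h : ∀ k ≤ S.m, SolvesStep S (S.B u) z k) : S.IsMildSolution u z := by
  refine ⟨isPC_of_solvesSteps h3 h, fun r hr s hs => ?_, fun r hr s hs => ?_⟩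
  · have hs' := h r hr.2
    have hf : IsForcing S.q (S.p r) (S.t (r + 1))
        fun σ => (S.B u σ + S.φ r σ z) + S.h σ (z σ) :=
      (isAdmissible_step h0 h3 hr.2 (fun k hk => h k (hk.le.trans hr.2))
        (memLp_B hr.2 u)).forcing.add (IsForcing.of_memLp h0.one_lt.le
          ((isWeightedLipschitz h2 h5 hr.2).memLp hs'.sol.weighted))
    have hint := S.isBoundedFamily.intervalIntegrable_integrand S.η_lt_one h0.one_lt
      h0.one_lt_mul hf hs
    have heq : ∀ σ ∈ uIcc (S.p r) s, (s - σ) ^ (S.η - 1) •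
        S.fracOp (s - σ) ((S.B u σ + S.φ r σ z) + S.h σ (z σ)) = S.mildIntegrand u z r s σ := by
      intro σ hσ
      rw [uIcc_of_le hs.1.le] at hσ
      rw [S.fracOp_apply (sub_nonneg.mpr hσ.2), mildIntegrand, add_right_comm]
    constructor
    · exact hint.congr fun σ hσ => heq σ (uIoc_subset_uIcc hσ)
    · rw [hs'.sol.eq s hs, volterra, S.fracOp_apply (sub_nonneg.mpr hs.1.le)]
      congr 1
      exact intervalIntegral.integral_congr heq
  · obtain ⟨k, rfl⟩ : ∃ k, r = k + 1 := ⟨r - 1, by have := hr.1; omega⟩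
    exact (h k (by have := hr.2; omega)).jump hr.2 s hs

end ImpulsiveSystem

/-! ### Approximate solvability of a perturbed linear equation -/

/-- If `R` is approximately as large as the whole space as far as `F` can see, with loss of norm at
most `ℵ`, then `v ↦ F v + F (N v)` restricted to `R` comes close to every value of `F`, provided the
Lipschitz constant `k` of `N` satisfies `ℵ k < 1`. The corrections of the error `F (N v - N v')`
form a geometric series. -/
theorem exists_mem_norm_map_add_map_sub_lt {X Z : Type*} [NormedAddCommGroup X]
    [NormedAddCommGroup Z] (F : X →+ Z) {L : ℝ} (hL : 0 ≤ L) (hF : ∀ x, ‖F x‖ ≤ L * ‖x‖)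
    {N : X → X} {k ℵ : ℝ} (hk : 0 ≤ k) (hN : ∀ x y, ‖N x - N y‖ ≤ k * ‖x - y‖) (hℵ : 0 ≤ ℵ)
    (R : AddSubgroup X)
    (hR : ∀ x, ∀ ε > 0, ∃ v ∈ R, ‖F x - F v‖ < ε ∧ ‖v‖ ≤ ℵ * ‖x‖) (hc : ℵ * k < 1)
    (x₀ : X) {ε : ℝ} (hε : 0 < ε) : ∃ v ∈ R, ‖F v + F (N v) - F x₀‖ < ε := by
  obtain ⟨v₀, hv₀, hv₀', -⟩ := hR (x₀ - N 0) (ε / 2 * (1 / 2)) (by positivity)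
  have hc0 : 0 ≤ ℵ * k := mul_nonneg hℵ hk
  have key : ∀ n : ℕ, ∃ v ∈ R, ∃ v' ∈ R, ‖v - v'‖ ≤ (ℵ * k) ^ n * ‖v₀‖ ∧
      ‖F v + F (N v') - F x₀‖ < ε / 2 * (1 - (1 / 2) ^ (n + 1)) := by
    intro n
    induction n with
    | zero =>
      refine ⟨v₀, hv₀, 0, R.zero_mem, by simp, ?_⟩
      have : F v₀ + F (N 0) - F x₀ = -(F (x₀ - N 0) - F v₀) := by
        rw [map_sub]
        abel
      rw [this, norm_neg]
      refine hv₀'.trans_le (le_of_eq ?_)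
      norm_num
    | succ n ih =>
      obtain ⟨v, hv, v', hv', h1, h2⟩ := ih
      obtain ⟨w, hw, hw1, hw2⟩ := hR (N v - N v') (ε / 2 * (1 / 2) ^ (n + 2)) (by positivity)
      refine ⟨v - w, R.sub_mem hv hw, v, hv, ?_, ?_⟩
      · calc ‖v - w - v‖ = ‖w‖ := by rw [sub_sub_cancel_left, norm_neg]
          _ ≤ ℵ * (k * ‖v - v'‖) := hw2.trans (mul_le_mul_of_nonneg_left (hN _ _) hℵ)
          _ ≤ ℵ * (k * ((ℵ * k) ^ n * ‖v₀‖)) := by gcongr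
          _ = (ℵ * k) ^ (n + 1) * ‖v₀‖ := by ring
      · have : F (v - w) + F (N v) - F x₀ =
            (F v + F (N v') - F x₀) + (F (N v - N v') - F w) := by
          simp only [map_sub]
          abel
        rw [this]
        refine (norm_add_le _ _).trans_lt ((add_lt_add h2 hw1).trans_le (le_of_eq ?_))
        ring
  have hlim : Tendsto (fun n : ℕ => L * (k * ((ℵ * k) ^ n * ‖v₀‖))) atTop (𝓝 0) := by
    have := (((tendsto_pow_atTop_nhds_zero_of_lt_one hc0 hc).mul_const ‖v₀‖).const_mul k).const_mul L
    simpa using this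
  obtain ⟨n, hn⟩ := (hlim.eventually_lt_const (half_pos hε)).exists
  obtain ⟨v, hv, v', -, h1, h2⟩ := key n
  refine ⟨v, hv, ?_⟩
  have e1 : F v + F (N v) - F x₀ = (F v + F (N v') - F x₀) + F (N v - N v') := by
    rw [map_sub]
    abel
  have h3 : ‖F (N v - N v')‖ < ε / 2 := by
    refine lt_of_le_of_lt ((hF _).trans (mul_le_mul_of_nonneg_left ((hN _ _).trans ?_) hL)) hn
    gcongr
  have h4 : ε / 2 * (1 - (1 / 2) ^ (n + 1)) ≤ ε / 2 :=
    mul_le_of_le_one_right (by positivity) (by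
      have : (0 : ℝ) < (1 / 2) ^ (n + 1) := by positivity
      linarith)
  rw [e1]
  have := norm_add_le (F v + F (N v') - F x₀) (F (N v - N v'))
  linarith

/-! ### The Volterra operator at the final time -/

section

variable {Z : Type*} [NormedAddCommGroup Z] [NormedSpace ℝ Z] {η q p e : ℝ}
  {K : ℝ → Z →L[ℝ] Z} {C : ℝ}

/-- The range of `f ↦ ∫_p^e (e - σ)^(η - 1) K(e - σ) f(σ) dσ` is dense if `K(0)` is a nonzero
multiple of the identity: concentrate `f` near `e`. -/
lemma IsBoundedFamily.exists_norm_volterra_sub_lt [CompleteSpace Z] (hK : IsBoundedFamily K C)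
    (h0 : 0 < η) (hpe : p < e) {γ : ℝ} (hγ : 0 < γ) {x : Z} (hx : K 0 x = γ⁻¹ • x) {ε : ℝ}
    (hε : 0 < ε) : ∃ f : ℝ → Z, MemLp f (ENNReal.ofReal q) (volume.restrict (Ioc p e)) ∧
      ‖volterra η K p f e - x‖ < ε := by
  obtain ⟨δ₀, hδ₀, hδ⟩ := Metric.continuous_iff.mp (hK.cont x) 0 (ε / (2 * γ)) (by positivity)
  set δ := min (δ₀ / 2) (e - p) with hδdef
  have hδpos : 0 < δ := lt_min (by positivity) (by linarith)
  have hδe : δ ≤ e - p := min_le_right _ _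
  have hδδ : δ < δ₀ := (min_le_left _ _).trans_lt (by linarith)
  have hδη : 0 < δ ^ η := Real.rpow_pos_of_pos hδpos _
  -- the factor makes `∫ c * (e - σ)^(η - 1) dσ` over `[e - δ, e]` equal to `γ`
  set c := γ * η / δ ^ η with hc
  have hc0 : 0 < c := by positivity
  refine ⟨(Ioc (e - δ) e).indicator fun _ => c • x, ?_, ?_⟩
  · exact (memLp_const (c • x)).indicator measurableSet_Ioc
  have h1 : volterra η K p ((Ioc (e - δ) e).indicator fun _ => c • x) e =
      ∫ σ in (e - δ)..e, (e - σ) ^ (η - 1) • c • K (e - σ) x := by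
    rw [volterra, intervalIntegral.integral_of_le hpe.le,
      intervalIntegral.integral_of_le (by linarith)]
    rw [setIntegral_eq_of_subset_of_forall_sdiff_eq_zero measurableSet_Ioc
      (Ioc_subset_Ioc_left (by linarith : p ≤ e - δ))]
    · refine setIntegral_congr_fun measurableSet_Ioc fun σ hσ => ?_
      rw [indicator_of_mem hσ, map_smul]
    · intro σ hσ
      rw [indicator_of_notMem hσ.2, map_zero, smul_zero]
  have hI := integral_kernel h0 e (e - δ)
  rw [sub_sub_cancel] at hI
  have h2 : ∫ σ in (e - δ)..e, (e - σ) ^ (η - 1) • c • γ⁻¹ • x = x := by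
    rw [intervalIntegral.integral_smul_const, hI, smul_smul, smul_smul, hc]
    have : δ ^ η / η * (γ * η / δ ^ η) * γ⁻¹ = 1 := by field_simp
    rw [this, one_smul]
  have hi := intervalIntegrable_kernel h0 e (e - δ) e
  have hi1 : IntervalIntegrable (fun σ => (e - σ) ^ (η - 1) • c • K (e - σ) x) volume (e - δ) e :=
    hi.smul_continuousOn (Continuous.continuousOn
      (((hK.cont x).comp (by fun_prop : Continuous fun σ => e - σ)).const_smul c))
  have hi2 : IntervalIntegrable (fun σ => (e - σ) ^ (η - 1) • c • γ⁻¹ • x) volume (e - δ) e :=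
    hi.smul_continuousOn continuousOn_const
  have h3 : volterra η K p ((Ioc (e - δ) e).indicator fun _ => c • x) e - x =
      ∫ σ in (e - δ)..e, (e - σ) ^ (η - 1) • c • (K (e - σ) x - K 0 x) := by
    rw [h1]
    nth_rewrite 2 [← h2]
    rw [← intervalIntegral.integral_sub hi1 hi2]
    refine intervalIntegral.integral_congr fun σ _ => ?_
    rw [hx, smul_sub, smul_sub]
  rw [h3]
  have h4 : ‖∫ σ in (e - δ)..e, (e - σ) ^ (η - 1) • c • (K (e - σ) x - K 0 x)‖ ≤
      ∫ σ in (e - δ)..e, (e - σ) ^ (η - 1) * (c * (ε / (2 * γ))) := by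
    refine intervalIntegral.norm_integral_le_of_norm_le (by linarith) (ae_of_all _ fun σ hσ => ?_)
      (hi.mul_const _)
    have hσ0 : 0 ≤ e - σ := sub_nonneg.mpr hσ.2
    rw [norm_smul, norm_smul, Real.norm_of_nonneg (Real.rpow_nonneg hσ0 _),
      Real.norm_of_nonneg hc0.le, ← dist_eq_norm]
    have : dist (e - σ) 0 < δ₀ := by
      rw [Real.dist_0_eq_abs, abs_of_nonneg hσ0]
      linarith [hσ.1]
    have := (hδ _ this).le
    gcongr
  refine h4.trans_lt ?_
  rw [intervalIntegral.integral_mul_const, hI, hc]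
  have : δ ^ η / η * (γ * η / δ ^ η * (ε / (2 * γ))) = ε / 2 := by field_simp
  rw [this]
  linarith

/-- `volterra` at the final time, as an additive map on `L^q`. -/
noncomputable def volterraHom (hK : IsBoundedFamily K C) (hη : η < 1) (hq : 1 < q)
    (hqη : 1 < q * η) (hpe : p < e) :
    Lp Z (ENNReal.ofReal q) (volume.restrict (Ioc p e)) →+ Z :=
  AddMonoidHom.mk' (fun f => volterra η K p f e) fun f g => by
    rw [← hK.volterra_add hη hq hqη (IsForcing.of_memLp hq.le (Lp.memLp f))
      (IsForcing.of_memLp hq.le (Lp.memLp g)) ⟨hpe, le_rfl⟩]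
    exact volterra_congr_ae ⟨hpe, le_rfl⟩ (Lp.coeFn_add f g)

/-- The superposition operator along solutions is Lipschitz in the forcing. -/
lemma IsLocalSolution.norm_toLp_sub_le (hK : IsBoundedFamily K C) (h0 : 0 < η) (hη : η < 1)
    (hq : 1 < q) (hqη : 1 < q * η) (hpe : p < e) {κ : ℝ} {H : ℝ → Z → Z}
    (hH : IsWeightedLipschitz η q p e κ H) {ζ : Z} {Φ z₁ z₂ : ℝ → Z} (hΦ : IsForcing q p e Φ)
    {f₁ f₂ : Lp Z (ENNReal.ofReal q) (volume.restrict (Ioc p e))}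
    (h₁ : IsLocalSolution η p e K H ζ (fun s => f₁ s + Φ s) z₁)
    (h₂ : IsLocalSolution η p e K H ζ (fun s => f₂ s + Φ s) z₂) :
    ‖(hH.memLp h₁.weighted).toLp - (hH.memLp h₂.weighted).toLp‖ ≤
      κ * (e - p) ^ (1 / q) * (C * holderConst η q * (e - p) ^ (1 - 1 / q) *
        mittagLeffler η (C * Real.Gamma η * κ * (e - p))) * ‖f₁ - f₂‖ := by
  have hsub : (fun s => (f₁ s + Φ s) - (f₂ s + Φ s)) =ᵐ[volume.restrict (Ioc p e)]
      ⇑(f₁ - f₂) := by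
    filter_upwards [Lp.coeFn_sub f₁ f₂] with s hs
    rw [hs, Pi.sub_apply, add_sub_add_right_eq_sub]
  have hd := (memLp_congr_ae hsub).mpr (Lp.memLp (f₁ - f₂))
  have hbd := fun t (ht : t ∈ Ioc p e) => IsLocalSolution.weighted_sub_le hK h0 hη hq hqη hH
    ((IsForcing.of_memLp hq.le (Lp.memLp f₁)).add hΦ)
    ((IsForcing.of_memLp hq.le (Lp.memLp f₂)).add hΦ) hd h₁ h₂ ht
  rw [eLpNorm_congr_ae hsub, ← Lp.norm_def] at hbd
  have hC := hK.nonneg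
  have hpe' : 0 ≤ e - p := by linarith
  have : Fact (1 ≤ ENNReal.ofReal q) := ⟨by simpa using hq.le⟩
  have hB : 0 ≤ κ * (C * holderConst η q * (e - p) ^ (1 - 1 / q) * ‖f₁ - f₂‖ *
      mittagLeffler η (C * Real.Gamma η * κ * (e - p))) := by
    have h1 := holderConst_nonneg hq hqη
    have h2 := hH.nonneg
    have h3 := Real.Gamma_pos_of_pos h0
    have h4 : 0 ≤ mittagLeffler η (C * Real.Gamma η * κ * (e - p)) :=
      mittagLeffler_nonneg h0 (by positivity)
    have h5 := norm_nonneg (f₁ - f₂)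
    exact mul_nonneg h2 (mul_nonneg (mul_nonneg (by positivity) h5) h4)
  rw [← MemLp.toLp_sub]
  refine (Lp.norm_le_of_ae_bound hB ?_).trans (le_of_eq ?_)
  · filter_upwards [MemLp.coeFn_toLp ((hH.memLp h₁.weighted).sub (hH.memLp h₂.weighted)),
      ae_restrict_mem measurableSet_Ioc] with s hs hmem
    rw [hs]
    exact hH.norm_sub_le hmem (hbd s hmem)
  · have : ((measureUnivNNReal (volume.restrict (Ioc p e)) : NNReal) : ℝ) = e - p := by
      change (volume.restrict (Ioc p e) univ).toReal = e - p
      rw [Measure.restrict_apply_univ, Real.volume_Ioc, ENNReal.toReal_ofReal hpe']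
    rw [this, ENNReal.toReal_ofReal (by linarith), one_div]
    ring

end

/-! ### The control problem on the last interval -/

namespace ImpulsiveSystem

variable {Z U : Type*} [NormedAddCommGroup Z] [NormedSpace ℝ Z]
  [NormedAddCommGroup U] [NormedSpace ℝ U] {S : ImpulsiveSystem Z U}

lemma sub_le_tau {r : ℕ} (hr : r ≤ S.m) : S.t (r + 1) - S.p r ≤ S.τ :=
  le_ciSup (f := fun r : Fin (S.m + 1) => S.t (r + 1) - S.p r) (Set.finite_range _).bddAbove
    ⟨r, by omega⟩

lemma muTerm_nonneg {b : ℕ → ℝ} (h3 : S.H3 b) {r : ℕ} (h1 : 1 ≤ r) (hr : r ≤ S.m) :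
    0 ≤ S.muTerm b r := by
  have hM := S.M_nonneg
  have hη := S.η_pos
  have hη1 : 0 < 1 - S.η := by linarith [S.η_lt_one]
  have g1 := Real.Gamma_pos_of_pos hη
  have g2 := Real.Gamma_pos_of_pos hη1
  have g3 := Real.Gamma_pos_of_pos (by linarith : 0 < 1 + S.η)
  have hb : ∀ k, 1 ≤ k → k ≤ S.m → 0 ≤ b k := fun k hk hk' => (h3 k ⟨hk, hk'⟩).2.1.1.le
  have hbr := hb r h1 hr
  have hlen : ∀ k ≤ S.m, 0 ≤ S.t (k + 1) - S.p k := fun k hk =>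
    sub_nonneg.mpr (S.p_lt_t k hk).le
  have hprev : 0 ≤ S.t r - S.p (r - 1) := by
    have := hlen (r - 1) (by omega)
    rwa [Nat.sub_add_cancel h1] at this
  have hr' := hlen r hr
  have s1 : 0 ≤ ∑ k ∈ Finset.range r, ((S.t (k + 1) - S.p k) / (S.p r - S.t (k + 1))) ^ S.η := by
    refine Finset.sum_nonneg fun k hk => Real.rpow_nonneg (div_nonneg ?_ ?_) _
    · exact hlen k (by have := Finset.mem_range.mp hk; omega)
    · exact sub_nonneg.mpr (S.t_lt_p_of_lt (Finset.mem_range.mp hk) hr).le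
  have s2 : 0 ≤ ∑ k ∈ Finset.range (r - 1), b (k + 1) * (S.t (r + 1) - S.p r) /
      ((S.t (k + 1) - S.p k) ^ (1 - S.η) * (S.p r - S.p (k + 1)) ^ S.η) := by
    refine Finset.sum_nonneg fun k hk => ?_
    have hk' := Finset.mem_range.mp hk
    refine div_nonneg (mul_nonneg (hb _ (by omega) (by omega)) hr')
      (mul_nonneg (Real.rpow_nonneg (hlen k (by omega)) _) (Real.rpow_nonneg ?_ _))
    exact sub_nonneg.mpr (S.p_le_p (by omega) (by omega))
  unfold muTerm
  exact add_nonneg (add_nonneg (by positivity) (mul_nonneg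
    (div_nonneg hM (mul_pos g3 g2).le) (add_nonneg s1 s2)))
    (by positivity)

lemma mu_nonneg {b : ℕ → ℝ} (h3 : S.H3 b) : 0 ≤ S.μ b :=
  Real.iSup_nonneg fun i => muTerm_nonneg h3 (by omega) (by omega)

/-- The last part of `(H8)` on the final interval bounds `ℵ` times the Lipschitz constant of the
superposition operator by `1`. -/
lemma aleph_mul_lt_one {b : ℕ → ℝ} {κ' ℵ : ℝ} (h0 : S.H0) (h3 : S.H3 b) (hκ : 0 < κ')
    (h7 : S.H7 b κ') (h8 : S.H8 b κ' ℵ) :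
    ℵ * (κ' * (S.t (S.m + 1) - S.p S.m) ^ (1 / S.q) * (S.M / Real.Gamma S.η *
      holderConst S.η S.q * (S.t (S.m + 1) - S.p S.m) ^ (1 - 1 / S.q) *
      mittagLeffler S.η (S.M / Real.Gamma S.η * Real.Gamma S.η * κ' *
        (S.t (S.m + 1) - S.p S.m)))) < 1 := by
  have hℵ := h8.1
  have hlen : 0 < S.t (S.m + 1) - S.p S.m := sub_pos.mpr (S.p_lt_t _ le_rfl)
  have hle := sub_le_tau (S := S) (le_refl S.m)
  have hM := S.M_nonneg
  have g1 := Real.Gamma_pos_of_pos S.η_pos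
  have g2 := Real.Gamma_pos_of_pos (by linarith [S.η_lt_one] : 0 < 1 - S.η)
  have hq := h0.one_lt
  have hh := holderConst_nonneg hq h0.one_lt_mul
  set l := S.t (S.m + 1) - S.p S.m with hl
  have hτ : 0 ≤ S.τ := hlen.le.trans hle
  set E := mittagLeffler S.η (S.M * κ' * S.τ) with hE
  have hE0 : 0 ≤ E := mittagLeffler_nonneg S.η_pos (by positivity)
  have hEle : mittagLeffler S.η (S.M / Real.Gamma S.η * Real.Gamma S.η * κ' * l) ≤ E := by
    rw [div_mul_cancel₀ _ g1.ne']
    exact mittagLeffler_mono S.η_pos (by positivity) (by gcongr)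
  have hρ : S.M / Real.Gamma S.η * holderConst S.η S.q * l ^ (1 - 1 / S.q) ≤ S.ϱ := by
    have h1q : 0 ≤ 1 - 1 / S.q := by
      rw [sub_nonneg, div_le_one (by linarith)]
      exact hq.le
    unfold ϱ
    rw [holderConst] at hh ⊢
    gcongr
  have hρ0 : 0 ≤ S.ϱ := le_trans (by positivity) hρ
  have hμ := mu_nonneg h3
  have hμE : 0 ≤ S.μ b * E := mul_nonneg hμ hE0
  have hμE1 : 0 < 1 - S.μ b * E := sub_pos.mpr h7
  refine lt_of_le_of_lt ?_ (h8.2.2 S.m ⟨S.one_le_m, le_rfl⟩)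
  rw [← hl, ← hE, mul_assoc ℵ]
  refine mul_le_mul_of_nonneg_left (mul_le_mul ?_ ?_ ?_ ?_) hℵ.le
  · refine le_add_of_nonneg_right (mul_nonneg (by positivity) (Finset.sum_nonneg fun k hk => ?_))
    have hk' := Finset.mem_range.mp hk
    have i1 : 0 ≤ S.t (k + 1) - S.p k := sub_nonneg.mpr (S.p_lt_t k hk'.le).le
    have i2 : 0 ≤ S.p S.m - S.t (k + 1) := sub_nonneg.mpr (S.t_lt_p_of_lt hk' le_rfl).le
    positivity
  · refine (mul_le_mul hρ hEle (mittagLeffler_nonneg S.η_pos (by positivity)) hρ0).trans ?_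
    rw [le_div_iff₀ hμE1]
    exact mul_le_of_le_one_right (mul_nonneg hρ0 hE0) (by linarith)
  · exact mul_nonneg (by positivity) (mittagLeffler_nonneg S.η_pos (by positivity))
  · refine add_nonneg (by positivity) (mul_nonneg (by positivity) (Finset.sum_nonneg fun k hk => ?_))
    have hk' := Finset.mem_range.mp hk
    have i1 : 0 ≤ S.t (k + 1) - S.p k := sub_nonneg.mpr (S.p_lt_t k hk'.le).le
    have i2 : 0 ≤ S.p S.m - S.t (k + 1) := sub_nonneg.mpr (S.t_lt_p_of_lt hk' le_rfl).le
    positivity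

lemma F_eq_volterra {r : ℕ} (hr : r ≤ S.m) (f : ℝ → Z) :
    S.F r f = volterra S.η S.fracOp (S.p r) f (S.t (r + 1)) := by
  refine intervalIntegral.integral_congr fun σ hσ => ?_
  rw [uIcc_of_le (S.p_lt_t r hr).le] at hσ
  rw [S.fracOp_apply (sub_nonneg.mpr hσ.2)]

/-- The traces on the last interval of those `B u` that vanish on all earlier intervals. -/
def lastRange (S : ImpulsiveSystem Z U) :
    AddSubgroup (Lp Z (ENNReal.ofReal S.q) (volume.restrict (Ioc (S.p S.m) (S.t (S.m + 1))))) where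
  carrier := {v | ∃ u : S.Control,
    (∀ᵐ s ∂volume.restrict (Ioc (S.p S.m) (S.t (S.m + 1))), S.B u s = v s) ∧
    ∀ k < S.m, ∀ᵐ s ∂volume.restrict (Ioc (S.p k) (S.t (k + 1))), S.B u s = 0}
  zero_mem' := by
    refine ⟨0, ?_, fun k hk => ?_⟩
    · rw [map_zero]
      filter_upwards [Lp.coeFn_zero Z (ENNReal.ofReal S.q)
          (volume.restrict (Ioc (S.p S.m) (S.t (S.m + 1)))),
        ae_mono (Measure.restrict_mono (S.Ioc_subset le_rfl) le_rfl) (Lp.coeFn_zero Z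
          (ENNReal.ofReal S.q) (volume.restrict (Icc 0 S.a)))] with s h1 h2
      rw [h1, h2]
    · rw [map_zero]
      exact ae_mono (Measure.restrict_mono (S.Ioc_subset hk.le) le_rfl) (Lp.coeFn_zero Z
          (ENNReal.ofReal S.q) (volume.restrict (Icc 0 S.a)))
  add_mem' := by
    rintro v₁ v₂ ⟨u₁, h1, h1'⟩ ⟨u₂, h2, h2'⟩
    have hadd := Lp.coeFn_add (S.B u₁) (S.B u₂)
    rw [← map_add] at hadd
    refine ⟨u₁ + u₂, ?_, fun k hk => ?_⟩
    · filter_upwards [h1, h2, Lp.coeFn_add v₁ v₂,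
        ae_mono (Measure.restrict_mono (S.Ioc_subset le_rfl) le_rfl) hadd] with s i1 i2 i3 i4
      rw [i3, i4, Pi.add_apply, Pi.add_apply, i1, i2]
    · filter_upwards [h1' k hk, h2' k hk,
        ae_mono (Measure.restrict_mono (S.Ioc_subset hk.le) le_rfl) hadd] with s i1 i2 i4
      rw [i4, Pi.add_apply, i1, i2, add_zero]
  neg_mem' := by
    rintro v ⟨u, h1, h1'⟩
    have hneg := Lp.coeFn_neg (S.B u)
    rw [← map_neg] at hneg
    refine ⟨-u, ?_, fun k hk => ?_⟩
    · filter_upwards [h1, Lp.coeFn_neg v,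
        ae_mono (Measure.restrict_mono (S.Ioc_subset le_rfl) le_rfl) hneg] with s i1 i3 i4
      rw [i3, i4, Pi.neg_apply, Pi.neg_apply, i1]
    · filter_upwards [h1' k hk,
        ae_mono (Measure.restrict_mono (S.Ioc_subset hk.le) le_rfl) hneg] with s i1 i4
      rw [i4, Pi.neg_apply, i1, neg_zero]

/-- By locality of `B`, a control may be replaced by `0` before `p_m` without changing `B u` on the
last interval. -/
lemma exists_control_localized (u : S.Control) : ∃ u' : S.Control,
    (∀ᵐ s ∂volume.restrict (Ioc (S.p S.m) (S.t (S.m + 1))), S.B u' s = S.B u s) ∧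
    ∀ k < S.m, ∀ᵐ s ∂volume.restrict (Ioc (S.p k) (S.t (k + 1))), S.B u' s = 0 := by
  have hmem : MemLp ((Ici (S.p S.m)).indicator u) (ENNReal.ofReal S.q)
      (volume.restrict (Icc 0 S.a)) := (Lp.memLp u).indicator measurableSet_Ici
  have hu' := hmem.coeFn_toLp
  refine ⟨hmem.toLp, ?_, fun k hk => ?_⟩
  · have h1 : ∀ᵐ s ∂volume.restrict (Icc (S.p S.m) (S.t (S.m + 1))), (hmem.toLp - u) s = 0 := by
      filter_upwards [ae_mono (Measure.restrict_mono (S.Icc_subset le_rfl) le_rfl) hu',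
        ae_mono (Measure.restrict_mono (S.Icc_subset le_rfl) le_rfl) (Lp.coeFn_sub hmem.toLp u),
        ae_restrict_mem measurableSet_Icc] with s i1 i2 i3
      rw [i2, Pi.sub_apply, i1, indicator_of_mem (mem_Ici.mpr i3.1), sub_self]
    have h2 := ae_mono (Measure.restrict_mono Ioc_subset_Icc_self le_rfl)
      (S.B_local S.m le_rfl _ h1)
    have h3 := Lp.coeFn_sub (S.B hmem.toLp) (S.B u)
    rw [← map_sub] at h3
    filter_upwards [h2, ae_mono (Measure.restrict_mono (S.Ioc_subset le_rfl) le_rfl) h3]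
      with s i1 i2
    rw [i2, Pi.sub_apply] at i1
    exact sub_eq_zero.mp i1
  · rw [restrict_Ioc_eq_restrict_Icc]
    refine S.B_local k hk.le _ ?_
    filter_upwards [ae_mono (Measure.restrict_mono (S.Icc_subset hk.le) le_rfl) hu',
      ae_restrict_mem measurableSet_Icc] with s i1 i2
    rw [i1, indicator_of_notMem]
    exact fun h => absurd (i2.2.trans_lt (S.t_lt_p_of_lt hk le_rfl)) (not_lt.mpr h)

/-- The range condition on `B`, on the last interval. -/
lemma exists_mem_lastRange {b : ℕ → ℝ} {κ' ℵ : ℝ} (h8 : S.H8 b κ' ℵ)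
    (f : Lp Z (ENNReal.ofReal S.q) (volume.restrict (Ioc (S.p S.m) (S.t (S.m + 1)))))
    {ε : ℝ} (hε : 0 < ε) : ∃ v ∈ S.lastRange,
      ‖volterra S.η S.fracOp (S.p S.m) f (S.t (S.m + 1)) -
        volterra S.η S.fracOp (S.p S.m) v (S.t (S.m + 1))‖ < ε ∧ ‖v‖ ≤ ℵ * ‖f‖ := by
  have hf := Lp.memLp f
  have hmeas : volume.restrict (Ioc (S.p S.m) (S.t (S.m + 1))) =
    volume.restrict (Icc (S.p S.m) (S.t (S.m + 1))) := restrict_Ioc_eq_restrict_Icc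
  obtain ⟨u, hu1, hu2⟩ := h8.2.1 S.m ⟨Nat.zero_le _, le_rfl⟩ ε hε f (hmeas ▸ hf)
  rw [← hmeas] at hu2
  rw [F_eq_volterra le_rfl, F_eq_volterra le_rfl] at hu1
  obtain ⟨u', h1, h2⟩ := exists_control_localized u
  have hB := memLp_B (le_refl S.m) u
  refine ⟨hB.toLp, ⟨u', ?_, h2⟩, ?_, ?_⟩
  · filter_upwards [h1, hB.coeFn_toLp] with s i1 i2
    rw [i1, i2]
  · rwa [volterra_congr_ae ⟨S.p_lt_t _ le_rfl, le_rfl⟩ hB.coeFn_toLp]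
  · rw [Lp.norm_toLp, Lp.norm_def, ← ENNReal.toReal_ofReal h8.1.le, ← ENNReal.toReal_mul]
    exact ENNReal.toReal_mono (ENNReal.mul_ne_top ENNReal.ofReal_ne_top hf.eLpNorm_ne_top) hu2

/-- Fix the history produced by `B u = 0` up to time `p_m`. On the last interval the final state is
`G + 𝔽 v + 𝔽 (N v)` with `v = B u`, a fixed vector `G` and a Lipschitz map `N`; the admissible `v`
form `lastRange`. -/
theorem approximatelyControllable [CompleteSpace Z] {κ' d ℵ : ℝ} {ς : ℝ → ℝ} {b : ℕ → ℝ}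
    (h0 : S.H0) (h2 : S.H2 ς d) (h3 : S.H3 b) (h5 : S.H5 κ') (h7 : S.H7 b κ')
    (h8 : S.H8 b κ' ℵ) : S.ApproximatelyControllable := by
  have hq := h0.one_lt
  have hqη := h0.one_lt_mul
  have : Fact (1 ≤ ENNReal.ofReal S.q) := ⟨by simpa using hq.le⟩
  have hK := S.isBoundedFamily
  have hpe := S.p_lt_t S.m le_rfl
  have hmem : S.t (S.m + 1) ∈ Ioc (S.p S.m) (S.t (S.m + 1)) := ⟨hpe, le_rfl⟩
  have hH := isWeightedLipschitz h2 h5 (le_refl S.m)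
  obtain ⟨z₀, hz₀⟩ := exists_solvesSteps (v := fun _ => 0) h0 h2 h3 h5
    (fun _ _ => MemLp.zero) S.m (Nat.le_succ _)
  choose z hz1 hz2 using fun f : Lp Z (ENNReal.ofReal S.q)
    (volume.restrict (Ioc (S.p S.m) (S.t (S.m + 1)))) =>
    exists_extension h0 h2 h3 h5 le_rfl hz₀ (Lp.memLp f)
  have hsol : ∀ f, IsLocalSolution S.η (S.p S.m) (S.t (S.m + 1)) S.fracOp S.h (S.datum S.m z₀)
      (fun σ => f σ + S.φ S.m σ z₀) (z f) := fun f => by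
    rw [← datum_congr le_rfl (hz1 f)]
    refine (hz2 f).sol.congr (fun _ _ => rfl) (ae_of_all _ fun s => ?_)
    rw [phi_congr le_rfl (hz1 f)]
  have hΦ : IsForcing S.q (S.p S.m) (S.t (S.m + 1)) fun σ => S.φ S.m σ z₀ := by
    simpa using (isAdmissible_step h0 h3 le_rfl hz₀ (v' := fun _ => 0) MemLp.zero).forcing
  set F := volterraHom hK S.η_lt_one hq hqη hpe with hF
  have hFa : ∀ f, F f = volterra S.η S.fracOp (S.p S.m) f (S.t (S.m + 1)) := fun _ => rfl
  set N := fun f => (hH.memLp (hsol f).weighted).toLp with hN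
  set G := (S.t (S.m + 1) - S.p S.m) ^ (S.η - 1) • S.fracOp (S.t (S.m + 1) - S.p S.m)
    (S.datum S.m z₀) + volterra S.η S.fracOp (S.p S.m) (fun σ => S.φ S.m σ z₀) (S.t (S.m + 1))
    with hG
  have hfinal : ∀ f, z f (S.t (S.m + 1)) = G + (F f + F (N f)) := fun f => by
    have e1 := volterra_congr_ae (η := S.η) (K := S.fracOp) hmem
      (hH.memLp (hsol f).weighted).coeFn_toLp
    have hf := IsForcing.of_memLp hq.le (Lp.memLp f)
    rw [(hsol f).eq _ hmem, hK.volterra_add S.η_lt_one hq hqη (hf.add hΦ)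
      (IsForcing.of_memLp hq.le (hH.memLp (hsol f).weighted)) hmem,
      hK.volterra_add S.η_lt_one hq hqη hf hΦ hmem, hFa, hFa, e1, hG]
    abel
  have hFb : ∃ L, 0 ≤ L ∧ ∀ f, ‖F f‖ ≤ L * ‖f‖ := by
    refine ⟨S.M / Real.Gamma S.η * (holderConst S.η S.q *
      (S.t (S.m + 1) - S.p S.m) ^ (S.η - 1 / S.q)), ?_, fun f => ?_⟩
    · exact mul_nonneg S.gammaBound_nonneg (mul_nonneg (holderConst_nonneg hq hqη)
        (Real.rpow_nonneg (sub_nonneg.mpr hpe.le) _))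
    · rw [mul_assoc, hFa, Lp.norm_def]
      exact hK.norm_volterra_le_eLpNorm hq hqη hpe.le (Lp.memLp f)
  obtain ⟨L, hL, hFL⟩ := hFb
  refine Metric.dense_iff.mpr fun x ε hε => ?_
  obtain ⟨f₀, hf₀, hx⟩ := hK.exists_norm_volterra_sub_lt (q := S.q) S.η_pos hpe
    (Real.Gamma_pos_of_pos S.η_pos) (S.fracOp_zero (x - G)) (half_pos hε)
  have hk : 0 ≤ κ' * (S.t (S.m + 1) - S.p S.m) ^ (1 / S.q) * (S.M / Real.Gamma S.η *
      holderConst S.η S.q * (S.t (S.m + 1) - S.p S.m) ^ (1 - 1 / S.q) *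
      mittagLeffler S.η (S.M / Real.Gamma S.η * Real.Gamma S.η * κ' *
        (S.t (S.m + 1) - S.p S.m))) := by
    have i1 := h5.1
    have i2 := sub_pos.mpr hpe
    have i3 := S.gammaBound_nonneg
    have i4 := Real.Gamma_pos_of_pos S.η_pos
    have i5 := holderConst_nonneg hq hqη
    have i6 := mittagLeffler_nonneg S.η_pos (x := S.M / Real.Gamma S.η * Real.Gamma S.η * κ' *
        (S.t (S.m + 1) - S.p S.m))
        (mul_nonneg (mul_nonneg (mul_nonneg i3 i4.le) i1.le) i2.le)
    exact mul_nonneg (by positivity) (mul_nonneg (mul_nonneg (mul_nonneg i3 i5)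
      (by positivity)) i6)
  obtain ⟨v, ⟨u, hu1, hu2⟩, hv⟩ := exists_mem_norm_map_add_map_sub_lt F hL hFL hk
    (N := N) (fun f g => IsLocalSolution.norm_toLp_sub_le hK S.η_pos S.η_lt_one hq hqη hpe hH hΦ
      (hsol f) (hsol g)) h8.1.le S.lastRange
    (fun f δ hδ => exists_mem_lastRange h8 f hδ) (aleph_mul_lt_one h0 h3 h5.1 h7 h8)
    hf₀.toLp (half_pos hε)
  refine ⟨z v S.a, ?_, u, z v, isMildSolution_of_solvesSteps h0 h2 h3 h5 fun k hk => ?_, rfl⟩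
  · rw [hFa hf₀.toLp, volterra_congr_ae hmem hf₀.coeFn_toLp] at hv
    rw [Metric.mem_ball, dist_eq_norm, ← S.t_last, hfinal v]
    have e1 : G + (F v + F (N v)) - x = (F v + F (N v) -
        volterra S.η S.fracOp (S.p S.m) f₀ (S.t (S.m + 1))) +
        (volterra S.η S.fracOp (S.p S.m) f₀ (S.t (S.m + 1)) - (x - G)) := by
      abel
    rw [e1]
    refine (norm_add_le _ _).trans_lt ?_
    linarith
  · rcases hk.eq_or_lt with rfl | hlt
    · exact (hz2 v).congr le_rfl (fun _ _ => rfl) hu1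
    · exact (hz₀ k hlt).congr hk (fun s hs => hz1 v s (hs.trans (S.p_le_p hlt (by omega))))
        (hu2 k hlt)

end ImpulsiveSystem

end RLImpulsive

theorem theorem2 {Z U : Type*} [NormedAddCommGroup Z] [NormedSpace ℝ Z] [CompleteSpace Z]
    [NormedAddCommGroup U] [NormedSpace ℝ U] [CompleteSpace U]
    (S : RLImpulsive.ImpulsiveSystem Z U)
    (κ d κ' ℵ : ℝ) (ς : ℝ → ℝ) (b c : ℕ → ℝ)
    (h0 : S.H0) (h1 : S.H1 κ) (h2 : S.H2 ς d) (h3 : S.H3 b) (h4 : S.H4 b κ)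
    (h5 : S.H5 κ') (h6 : S.H6 c) (h7 : S.H7 b κ') (h8 : S.H8 b κ' ℵ)
    (hA : RLImpulsive.IsDifferentiableSemigroup S.T ∨ S.DataInDomain) :
    S.ApproximatelyControllable := by
  exact RLImpulsive.ImpulsiveSystem.approximatelyControllable h0 h2 h3 h5 h7 h8
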